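/- Work over $\mathbb{C}(q)$, $q$ an indeterminate, and let $n$ be a positive integer. For $N\ge 1$ let $$R=q\sum_{i}e_{ii}\otimes e_{ii}+\sum_{i\neq j}e_{ii}\otimes e_{jj}+(q-q^{-1})\sum_{j<i}e_{ij}\otimes e_{ji}\in \mathrm{Mat}_N\otimes\mathrm{Mat}_N .$$ For a square matrix $Y$ put $Y_1=Y\otimes \mathrm{Id}$, $Y_2=\mathrm{Id}\otimes Y$; let $t_1$, $t_2$ denote transposition in the first, respectively second, tensor component. Let $\mathcal{O}_q(\mathrm{Mat}_N)$ be the algebra generated by the entries of $T=(t_{ij})_{1\le i,j\le N}$ with defining relations $RT_1T_2=T_2T_1R$, and let $\partial_{ij}$ be the generator of the opposite algebra $\mathcal{O}_q(\mathrm{Mat}_N)^{op}$ corresponding to $t_{ij}$. Type AI: $r=n$, $\mathscr{P}=\mathcal{O}_q(\mathrm{Mat}_n)$, $\mathscr{D}=\mathcal{O}_q(\mathrm{Mat}_n)^{op}$, $R_{\mathfrak g}=R$ (with $N=n$), and for $1\le i,j\le n$ $$x_{ij}=\sum_{k=1}^n t_{ik}t_{jk},\qquad d_{ij}=\sum_{k=1}^n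 q^{-2k}\partial_{ik}\partial_{jk}.$$ Type AII: $r=2n$, $\mathscr{P}=\mathcal{O}_q(\mathrm{Mat}_{2n})$, $\mathscr{D}=\mathcal{O}_q(\mathrm{Mat}_{2n})^{op}$, $R_{\mathfrak g}=R$ (with $N=2n$), and for $1\le i,j\le 2n$ $$x_{ij}=\sum_{k=1}^n (t_{i,2k-1}t_{j,2k}-q\,t_{i,2k}t_{j,2k-1}),\qquad d_{ij}=\sum_{k=1}^n q^{-4k+2}(\partial_{i,2k}\partial_{j,2k-1}-q\,\partial_{i,2k-1}\partial_{j,2k}).$$ Diagonal type: $r=2n$, $\mathscr{P}=\mathcal{O}_q(\mathrm{Mat}_n)\otimes\mathcal{O}_q(\mathrm{Mat}_n)$, $\mathscr{D}=\mathcal{O}_q(\mathrm{Mat}_n)^{op}\otimes\mathcal{O}_q(\mathrm{Mat}_n)^{op}$. Write $t_{ij}$ and $t_{n+i,n+j}$ ($1\le i,j\le n$) for the generators of the first and second factor of $\mathscr{P}$, similarly $\partial_{ij}$ and $\partial_{n+i,n+j}$ for $\mathscr{D}$. $R_{\mathfrak g}$ is the block diagonal matrix $(R,I,I,R)$ (with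 $N=n$) on the index pairs with both indices $\le n$, one $\leq n$ and the other $>n$ (two blocks), both $>n$. For $1\le i,j\le n$ put $$x_{i,n+j}=\sum_{k}t_{ik}t_{n+j,n+k},\quad x_{n+i,j}=\sum_k t_{n+i,n+k}t_{jk},\quad d_{i,n+j}=\sum_{k}q^{-2k}\partial_{ik}\partial_{n+j,n+k},\quad d_{n+i,j}=\sum_k q^{-2k}\partial_{n+i,n+k}\partial_{jk}$$ and $x_{ij}=x_{n+i,n+j}=d_{ij}=d_{n+i,n+j}=0$. In each type let $\mathscr{P}_\theta\subseteq\mathscr{P}$ be the subalgebra generated by the $x_{ij}$ and $\mathscr{D}_\theta\subseteq\mathscr{D}$ the subalgebra generated by the $d_{ij}$ ($1\le i,j\le r$). (A) The assignment $\tilde x_{ij}\mapsto x_{ij}$ defines an algebra surjection from the free algebra $\mathbb{C}(q)\langle\tilde x_{ij}:1\le i,j\le r\rangle$ onto $\mathscr{P}_\theta$, whose kernel is the two-sided ideal generated by - (i) in Type AI: $\tilde x_{ij}-q\tilde x_{ji}$ for $i<j$; - (ii) in Type AII: $\tilde x_{ij}+q^{-1}\tilde x_{ji}$ for $i<j$,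 and $\tilde x_{ii}$ for all $i$; - (iii) in the diagonal type: $\tilde x_{i,n+j}-\tilde x_{n+j,i}$, $\tilde x_{ij}$ and $\tilde x_{n+i,n+j}$ for $1\le i,j\le n$; - (iv) in every type: the entries of $R_{\mathfrak g}\tilde X_1R_{\mathfrak g}^{t_1}\tilde X_2-\tilde X_2R_{\mathfrak g}^{t_1}\tilde X_1R_{\mathfrak g}$, where $\tilde X=(\tilde x_{ij})$. In the diagonal type, in the presence of (iii), the relations (iv) are equivalent to (i.e. generate together with (iii) the same two-sided ideal as) the entries of $R\hat X_1\hat X_2-\hat X_2\hat X_1R$, where $\hat X=(\tilde x_{i,n+j})_{1\le i,j\le n}$; and there is an algebra isomorphism $\mathscr{P}_\theta\cong\mathcal{O}_q(\mathrm{Mat}_n)$ with $x_{i,n+j}\mapsto t_{ij}$. (B) The assignment $\tilde d_{ij}\mapsto d_{ij}$ defines an algebra surjection from the free algebra $\mathbb{C}(q)\langle\tilde d_{ij}:1\le i,j\le r\rangle$ onto $\mathscr{D}_\theta$, whose kernel is the two-sided ideal generated by - (i) in Type AI: $\tilde d_{ij}-q^{-1}\tilde d_{ji}$ for $i<j$;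 - (ii) in Type AII: $\tilde d_{ij}+q\tilde d_{ji}$ for $i<j$, and $\tilde d_{ii}$ for all $i$; - (iii) in the diagonal type: $\tilde d_{i,n+j}-\tilde d_{n+j,i}$, $\tilde d_{ij}$ and $\tilde d_{n+i,n+j}$ for $1\le i,j\le n$; - (iv) in every type: the entries of $R_{\mathfrak g}\tilde D_2R_{\mathfrak g}^{t_2}\tilde D_1-\tilde D_1R_{\mathfrak g}^{t_2}\tilde D_2R_{\mathfrak g}$, where $\tilde D=(\tilde d_{ij})$. In the diagonal type, in the presence of (iii), the relations (iv) are equivalent to the entries of $R\hat D_2\hat D_1-\hat D_1\hat D_2R$, where $\hat D=(\tilde d_{i,n+j})_{1\le i,j\le n}$; and there is an algebra isomorphism $\mathscr{D}_\theta\cong\mathcal{O}_q(\mathrm{Mat}_n)^{op}$ with $d_{i,n+j}\mapsto\partial_{ij}$. -/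

import Mathlib

open scoped TensorProduct Kronecker

namespace QuantumHomogeneous

noncomputable section

/-! ### R-matrices

An element `C = ∑ c^{ij}_{kl} e_{ik} ⊗ e_{jl}` of `Mat_I ⊗ Mat_I` is the matrix indexed by `I × I`
whose entry at `((i, j), (k, l))` is `c^{ij}_{kl}`. -/

/-- The standard R-matrix of type A on a linearly ordered index set:
`q ∑ e_ii ⊗ e_ii + ∑_{i ≠ j} e_ii ⊗ e_jj + (q - q⁻¹) ∑_{j < i} e_ij ⊗ e_ji`. -/
def rMat {K : Type*} [Field K] (q : K) (I : Type*) [LinearOrder I] :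
    Matrix (I × I) (I × I) K :=
  Matrix.of fun a b =>
    if a = b then (if a.1 = a.2 then q else 1)
    else if b = (a.2, a.1) ∧ a.2 < a.1 then q - q⁻¹
    else 0

/-- The block R-matrix `(R, 1, 1, R)` on the index set `{1, …, n} ⊔ {n+1, …, 2n}`, where
`Sum.inl i` stands for `i` and `Sum.inr i` stands for `n + i`. -/
def rMatDiag {K : Type*} [Field K] (q : K) (n : ℕ) :
    Matrix ((Fin n ⊕ Fin n) × (Fin n ⊕ Fin n)) ((Fin n ⊕ Fin n) × (Fin n ⊕ Fin n)) K :=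
  Matrix.of fun a b =>
    match a, b with
    | (Sum.inl i, Sum.inl j), (Sum.inl k, Sum.inl l) => rMat q (Fin n) (i, j) (k, l)
    | (Sum.inr i, Sum.inr j), (Sum.inr k, Sum.inr l) => rMat q (Fin n) (i, j) (k, l)
    | (Sum.inr i, Sum.inl j), (Sum.inr k, Sum.inl l) => if i = k ∧ j = l then 1 else 0
    | (Sum.inl i, Sum.inr j), (Sum.inl k, Sum.inr l) => if i = k ∧ j = l then 1 else 0
    | _, _ => 0

/-- Transpose in the first tensor component: `e_ij ⊗ e_kl ↦ e_ji ⊗ e_kl`. -/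
def tr₁ {K I : Type*} (C : Matrix (I × I) (I × I) K) : Matrix (I × I) (I × I) K :=
  Matrix.of fun a b => C (b.1, a.2) (a.1, b.2)

/-- Transpose in the second tensor component: `e_ij ⊗ e_kl ↦ e_ij ⊗ e_lk`. -/
def tr₂ {K I : Type*} (C : Matrix (I × I) (I × I) K) : Matrix (I × I) (I × I) K :=
  Matrix.of fun a b => C (a.1, b.2) (b.1, a.2)

/-- A scalar matrix viewed as a matrix over a `K`-algebra. -/
def scal {K : Type*} [Field K] (A : Type*) [Ring A] [Algebra K A] {I J : Type*}
    (C : Matrix I J K) : Matrix I J A :=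
  C.map (algebraMap K A)

/-- `Y₁ = Y ⊗ Id`. -/
def leg₁ {A I : Type*} [Ring A] [DecidableEq I] (Y : Matrix I I A) : Matrix (I × I) (I × I) A :=
  Y ⊗ₖ (1 : Matrix I I A)

/-- `Y₂ = Id ⊗ Y`. -/
def leg₂ {A I : Type*} [Ring A] [DecidableEq I] (Y : Matrix I I A) : Matrix (I × I) (I × I) A :=
  (1 : Matrix I I A) ⊗ₖ Y

/-- The set of entries of a matrix. -/
def entrySet {A I J : Type*} (M : Matrix I J A) : Set A := {a | ∃ i j, a = M i j}

/-! ### Quantized functions on matrices -/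

/-- The matrix of the generators of the free algebra on the letters `(i, j)`. -/
def freeMat (K : Type*) [Field K] (I : Type*) : Matrix I I (FreeAlgebra K (I × I)) :=
  Matrix.of fun i j => FreeAlgebra.ι K (i, j)

/-- The FRT relations `R T₁ T₂ = T₂ T₁ R`, entry by entry. -/
def frtRel {K : Type*} [Field K] (q : K) (I : Type*) [Fintype I] [LinearOrder I]
    (u v : FreeAlgebra K (I × I)) : Prop :=
  ∃ a b : I × I,
    u = (scal (FreeAlgebra K (I × I)) (rMat q I) * leg₁ (freeMat K I) * leg₂ (freeMat K I) :
      Matrix (I × I) (I × I) (FreeAlgebra K (I × I))) a b ∧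
    v = (leg₂ (freeMat K I) * leg₁ (freeMat K I) * scal (FreeAlgebra K (I × I)) (rMat q I) :
      Matrix (I × I) (I × I) (FreeAlgebra K (I × I))) a b

/-- The quantized function algebra `𝒪_q(Mat_I)`: the free algebra on the `t_ij` modulo the
FRT relations. -/
abbrev OqMat {K : Type*} [Field K] (q : K) (I : Type*) [Fintype I] [LinearOrder I] : Type _ :=
  RingQuot (frtRel q I)

/-- The matrix `T = (t_ij)` of the generators of `𝒪_q(Mat_I)`. -/
def tMat {K : Type*} [Field K] (q : K) (I : Type*) [Fintype I] [LinearOrder I] :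
    Matrix I I (OqMat q I) :=
  Matrix.of fun i j => RingQuot.mkAlgHom K (frtRel q I) (FreeAlgebra.ι K (i, j))

/-- The matrix `P = (∂_ij)` of the generators of `𝒪_q(Mat_I)ᵒᵖ`. -/
def pMat {K : Type*} [Field K] (q : K) (I : Type*) [Fintype I] [LinearOrder I] :
    Matrix I I (OqMat q I)ᵐᵒᵖ :=
  (tMat q I).map MulOpposite.op

/-- `𝒪_q(Mat_n) ⊗ 𝒪_q(Mat_n)`. -/
abbrev OqDiag {K : Type*} [Field K] (q : K) (n : ℕ) : Type _ :=
  OqMat q (Fin n) ⊗[K] OqMat q (Fin n)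

/-- `𝒪_q(Mat_n)ᵒᵖ ⊗ 𝒪_q(Mat_n)ᵒᵖ`. -/
abbrev OqDiagOp {K : Type*} [Field K] (q : K) (n : ℕ) : Type _ :=
  (OqMat q (Fin n))ᵐᵒᵖ ⊗[K] (OqMat q (Fin n))ᵐᵒᵖ

/-- The `2n × 2n` matrix `(t_ij)` of the diagonal type: `t_ij` (resp. `t_{n+i,n+j}`) are the
generators of the first (resp. second) tensor factor, and `t_{i,n+j} = t_{n+i,j} = 0`. -/
def tMatDiag {K : Type*} [Field K] (q : K) (n : ℕ) :
    Matrix (Fin n ⊕ Fin n) (Fin n ⊕ Fin n) (OqDiag q n) :=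
  Matrix.fromBlocks
    ((tMat q (Fin n)).map fun t => t ⊗ₜ[K] (1 : OqMat q (Fin n))) 0 0
    ((tMat q (Fin n)).map fun t => (1 : OqMat q (Fin n)) ⊗ₜ[K] t)

/-- The `2n × 2n` matrix `(∂_ij)` of the diagonal type. -/
def pMatDiag {K : Type*} [Field K] (q : K) (n : ℕ) :
    Matrix (Fin n ⊕ Fin n) (Fin n ⊕ Fin n) (OqDiagOp q n) :=
  Matrix.fromBlocks
    ((pMat q (Fin n)).map fun t => t ⊗ₜ[K] (1 : (OqMat q (Fin n))ᵐᵒᵖ)) 0 0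
    ((pMat q (Fin n)).map fun t => (1 : (OqMat q (Fin n))ᵐᵒᵖ) ⊗ₜ[K] t)

/-! ### The solutions `J(a)` of the reflection equation -/

/-- Type AI: `J(a) = ∑ a_k e_kk`. -/
def jAI {K : Type*} [Field K] {n : ℕ} (a : Fin n → K) : Matrix (Fin n) (Fin n) K :=
  Matrix.diagonal a

/-- The index `2k - 1` (for `k = 1, …, n`), counted from zero. -/
def oddIdx {n : ℕ} (k : Fin n) : Fin (2 * n) := ⟨2 * k.1, by omega⟩

/-- The index `2k` (for `k = 1, …, n`), counted from zero. -/
def evenIdx {n : ℕ} (k : Fin n) : Fin (2 * n) := ⟨2 * k.1 + 1, by omega⟩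

/-- Type AII: `J(a) = ∑ a_k (e_{2k-1,2k} - q e_{2k,2k-1})`. -/
def jAII {K : Type*} [Field K] (q : K) {n : ℕ} (a : Fin n → K) :
    Matrix (Fin (2 * n)) (Fin (2 * n)) K :=
  ∑ k, a k • (Matrix.single (oddIdx k) (evenIdx k) (1 : K)
    - q • Matrix.single (evenIdx k) (oddIdx k) (1 : K))

/-- Diagonal type: `J(a) = ∑ a_k (e_{k,n+k} + e_{n+k,k})`. -/
def jDiag {K : Type*} [Field K] {n : ℕ} (a : Fin n → K) :
    Matrix (Fin n ⊕ Fin n) (Fin n ⊕ Fin n) K :=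
  Matrix.fromBlocks 0 (Matrix.diagonal a) (Matrix.diagonal a) 0

/-- The matrix `Y J Yᵗ`, whose entry at `(i, j)` is `∑_{r,s} y_ir J_rs y_js`. -/
def quadMat {K : Type*} [Field K] {A I : Type*} [Ring A] [Algebra K A] [Fintype I]
    (Y : Matrix I I A) (J : Matrix I I K) : Matrix I I A :=
  Y * scal A J * Y.transpose

/-! ### The quadratic elements `x_ij` and `d_ij` -/

/-- Type AI: `x_ij = ∑_k t_ik t_jk`. -/
def xAI {K : Type*} [Field K] (q : K) (n : ℕ) : Matrix (Fin n) (Fin n) (OqMat q (Fin n)) :=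
  quadMat (tMat q (Fin n)) (jAI fun _ => (1 : K))

/-- Type AII: `x_ij = ∑_k (t_{i,2k-1} t_{j,2k} - q t_{i,2k} t_{j,2k-1})`. -/
def xAII {K : Type*} [Field K] (q : K) (n : ℕ) :
    Matrix (Fin (2 * n)) (Fin (2 * n)) (OqMat q (Fin (2 * n))) :=
  quadMat (tMat q (Fin (2 * n))) (jAII q fun _ : Fin n => (1 : K))

/-- Diagonal type: `x_{i,n+j} = ∑_k t_ik t_{n+j,n+k}` and `x_{n+i,j} = ∑_k t_{n+i,n+k} t_jk`. -/
def xDiag {K : Type*} [Field K] (q : K) (n : ℕ) :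
    Matrix (Fin n ⊕ Fin n) (Fin n ⊕ Fin n) (OqDiag q n) :=
  quadMat (tMatDiag q n) (jDiag fun _ => (1 : K))

/-- Type AI: `d_ij = ∑_k q^{-2k} ∂_ik ∂_jk`. -/
def dAI {K : Type*} [Field K] (q : K) (n : ℕ) : Matrix (Fin n) (Fin n) (OqMat q (Fin n))ᵐᵒᵖ :=
  quadMat (pMat q (Fin n)) (jAI fun k : Fin n => (q ^ (2 * (k.1 + 1)))⁻¹).transpose

/-- Type AII: `d_ij = ∑_k q^{-4k+2} (∂_{i,2k} ∂_{j,2k-1} - q ∂_{i,2k-1} ∂_{j,2k})`. -/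
def dAII {K : Type*} [Field K] (q : K) (n : ℕ) :
    Matrix (Fin (2 * n)) (Fin (2 * n)) (OqMat q (Fin (2 * n)))ᵐᵒᵖ :=
  quadMat (pMat q (Fin (2 * n)))
    (jAII q fun k : Fin n => (q ^ (4 * (k.1 + 1) - 2))⁻¹).transpose

/-- Diagonal type: `d_{i,n+j} = ∑_k q^{-2k} ∂_ik ∂_{n+j,n+k}` and
`d_{n+i,j} = ∑_k q^{-2k} ∂_{n+i,n+k} ∂_jk`. -/
def dDiag {K : Type*} [Field K] (q : K) (n : ℕ) :
    Matrix (Fin n ⊕ Fin n) (Fin n ⊕ Fin n) (OqDiagOp q n) :=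
  quadMat (pMatDiag q n) (jDiag fun k : Fin n => (q ^ (2 * (k.1 + 1)))⁻¹).transpose

/-- The subalgebra generated by the entries of a matrix. The algebra `𝒫_θ` is `genAlg K x` and
`𝒟_θ` is `genAlg K d` for the matrices `x` and `d` of the type in question. -/
abbrev genAlg (K : Type*) [Field K] {A I : Type*} [Ring A] [Algebra K A] (x : Matrix I I A) :
    Subalgebra K A :=
  Algebra.adjoin K (entrySet x)

/-! ### Relations in the free algebra -/

/-- `y_ij - c y_ji` for `i < j`. -/
def relSym {K : Type*} [Field K] (c : K) (n : ℕ) : Set (FreeAlgebra K (Fin n × Fin n)) :=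
  {u | ∃ i j : Fin n, i < j ∧ u = freeMat K (Fin n) i j - c • freeMat K (Fin n) j i}

/-- `y_ij + c y_ji` for `i < j`, and `y_ii`. -/
def relSkew {K : Type*} [Field K] (c : K) (n : ℕ) : Set (FreeAlgebra K (Fin n × Fin n)) :=
  {u | ∃ i j : Fin n, i < j ∧ u = freeMat K (Fin n) i j + c • freeMat K (Fin n) j i} ∪
  {u | ∃ i : Fin n, u = freeMat K (Fin n) i i}

/-- `y_{i,n+j} - y_{n+j,i}`, `y_ij` and `y_{n+i,n+j}`. -/
def relBlock (K : Type*) [Field K] (n : ℕ) :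
    Set (FreeAlgebra K ((Fin n ⊕ Fin n) × (Fin n ⊕ Fin n))) :=
  {u | ∃ i j : Fin n, u = freeMat K _ (Sum.inl i) (Sum.inr j) - freeMat K _ (Sum.inr j) (Sum.inl i)
    ∨ u = freeMat K _ (Sum.inl i) (Sum.inl j)
    ∨ u = freeMat K _ (Sum.inr i) (Sum.inr j)}

/-- The entries of `R X₁ R^{t₁} X₂ - X₂ R^{t₁} X₁ R`. -/
def relReflX {K : Type*} [Field K] {I : Type*} [Fintype I] [DecidableEq I]
    (R : Matrix (I × I) (I × I) K) : Set (FreeAlgebra K (I × I)) :=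
  entrySet
    (scal _ R * leg₁ (freeMat K I) * scal _ (tr₁ R) * leg₂ (freeMat K I)
      - leg₂ (freeMat K I) * scal _ (tr₁ R) * leg₁ (freeMat K I) * scal _ R)

/-- The entries of `R D₂ R^{t₂} D₁ - D₁ R^{t₂} D₂ R`. -/
def relReflD {K : Type*} [Field K] {I : Type*} [Fintype I] [DecidableEq I]
    (R : Matrix (I × I) (I × I) K) : Set (FreeAlgebra K (I × I)) :=
  entrySet
    (scal _ R * leg₂ (freeMat K I) * scal _ (tr₂ R) * leg₁ (freeMat K I)
      - leg₁ (freeMat K I) * scal _ (tr₂ R) * leg₂ (freeMat K I) * scal _ R)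

/-- The `n × n` matrix with entries `y_{i,n+j}`. -/
def hatMat (K : Type*) [Field K] (n : ℕ) :
    Matrix (Fin n) (Fin n) (FreeAlgebra K ((Fin n ⊕ Fin n) × (Fin n ⊕ Fin n))) :=
  Matrix.of fun i j => freeMat K (Fin n ⊕ Fin n) (Sum.inl i) (Sum.inr j)

/-- The entries of `R X̂₁ X̂₂ - X̂₂ X̂₁ R`. -/
def relHatX {K : Type*} [Field K] (q : K) (n : ℕ) :
    Set (FreeAlgebra K ((Fin n ⊕ Fin n) × (Fin n ⊕ Fin n))) :=
  entrySet
    (scal _ (rMat q (Fin n)) * leg₁ (hatMat K n) * leg₂ (hatMat K n)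
      - leg₂ (hatMat K n) * leg₁ (hatMat K n) * scal _ (rMat q (Fin n)))

/-- The entries of `R D̂₂ D̂₁ - D̂₁ D̂₂ R`. -/
def relHatD {K : Type*} [Field K] (q : K) (n : ℕ) :
    Set (FreeAlgebra K ((Fin n ⊕ Fin n) × (Fin n ⊕ Fin n))) :=
  entrySet
    (scal _ (rMat q (Fin n)) * leg₂ (hatMat K n) * leg₁ (hatMat K n)
      - leg₁ (hatMat K n) * leg₂ (hatMat K n) * scal _ (rMat q (Fin n)))

/-- The assignment `y_ij ↦ x_ij` defines an algebra surjection from the free algebra onto the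
subalgebra generated by the `x_ij`, whose kernel is the two-sided ideal generated by `S`. -/
def PresentedBy {K : Type*} [Field K] {A I : Type*} [Ring A] [Algebra K A] (x : Matrix I I A)
    (S : Set (FreeAlgebra K (I × I))) : Prop :=
  ∃ φ : FreeAlgebra K (I × I) →ₐ[K] genAlg K x,
    (∀ i j, (φ (FreeAlgebra.ι K (i, j)) : A) = x i j) ∧
    Function.Surjective φ ∧
    TwoSidedIdeal.ker φ = TwoSidedIdeal.span S

/-- The field `ℂ(q)`. -/
abbrev Cq : Type := RatFunc ℂ

/-- The indeterminate `q`. -/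
abbrev qq : Cq := RatFunc.X

/-- The generator `x_ij` as an element of the algebra that the entries of `x` generate. -/
def gen (K : Type*) [Field K] {A I : Type*} [Ring A] [Algebra K A] (x : Matrix I I A) (i j : I) :
    genAlg K x :=
  ⟨x i j, Algebra.subset_adjoin ⟨i, j, rfl⟩⟩

end

end QuantumHomogeneous

open QuantumHomogeneous

/-!
Each of the six presentations says that every relation between the quadratic elements `x = T J Tᵗ`
follows from the listed ones. That the listed relations hold is a computation with the relations
`R T₁ T₂ = T₂ T₁ R`: together with the reflection equation for the scalar matrix `J`
(`reflElt_diagonal`, `reflElt_symplectic`) they give the reflection equation for `x`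
(`IsFRT.reflElt_quadMat`). The elements `d_ij` are treated along with the `x_ij`, since the opposite
of a quantum matrix is a quantum matrix for the reversed order of the indices; everything below is
done for an arbitrary total order `lt`.

That there are no further relations is shown in the types AI and AII by degeneration to `q = 1`. Let
`O` be the local ring of `ℂ[q]` at `q = 1`, a valuation ring with fraction field `ℂ(q)`.

* Modulo the maximal ideal of `O` the reflection equation says that the generators commute
  (`commutator_mem_of_reflElt`). By Nakayama's lemma, applied in each degree, the ordered monomials
  in the `x_ij` with `i ≤ j` (with `i < j` in type AII) span the algebra presented by the relations
  (`span_sortedWord_eq_top`). No commutation rule needs to be solved for ordered monomials.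
* The ordered monomials in the actual `x_ij` are linearly independent. A linear relation can be
  rescaled to have coefficients in `O`, not all in the maximal ideal. It survives in every flat
  `O`-algebra that contains a quantum matrix, and hence holds for the commutative matrices `T₀` that
  are specializations of such quantum matrices (`IsQuantizable.sum_prod_eq_zero`). These are closed
  under products, because the product of two commuting quantum matrices is a quantum matrix, and
  they contain the diagonal matrices and the transvections; so over a field every matrix is one
  (`isQuantizable_of_field`). The transvections are quantized by operators on polynomials that are
  built from multiplications and `q`-shifts, which become multiplication operators at `q = 1`.
  For `T₀ = 1 + Z J⁻¹` with a generic symmetric or alternating matrix `Z`, the entries of `T₀ J T₀ᵗ`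
  are `J + 2 Z` up to terms of degree two, so they are algebraically independent
  (`algebraicIndependent_quad`), which contradicts the relation.

The diagonal type is formal. For a matrix with the block symmetry the reflection equation is the
relation `R X̂₁ X̂₂ = X̂₂ X̂₁ R` for its upper right block (`IsBlockSymm.reflElt_iff`), which `x`
satisfies as a product of commuting quantum matrices. Hence `t_ij ↦ x_{i,n+j}` is a homomorphism,
and a rescaled counit of the second tensor factor is a left inverse of it (`exists_counit`).
-/

open scoped TensorProduct Kronecker

namespace QuantumHomogeneous

/-! ### Quantum matrices -/

section FRT

variable {k : Type*} [CommRing k] {I : Type*}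

/-- The eigenvalue of the diagonal part of the R-matrix on `e_i ⊗ e_j`. -/
def diagWt [DecidableEq I] (q : k) (i j : I) : k := if i = j then q else 1

/-- The coefficient of the off-diagonal part of the R-matrix: `c` if `i` precedes `j`. -/
def stepWt (lt : I → I → Prop) [DecidableRel lt] (c : k) (i j : I) : k := if lt i j then c else 0

/-- The relations `R T₁ T₂ = T₂ T₁ R`, written out entry by entry, for the R-matrix of an
arbitrary relation `lt` on the index set, with `c` in the place of `q - q⁻¹`. Reversing `lt`
amounts to passing to the opposite algebra. -/
def IsFRT [DecidableEq I] (lt : I → I → Prop) [DecidableRel lt] (q c : k) {B : Type*} [Ring B]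
    [Algebra k B] (T : Matrix I I B) : Prop :=
  ∀ i j m l, diagWt q i j • (T i m * T j l) + stepWt lt c j i • (T j m * T i l) =
    diagWt q m l • (T j l * T i m) + stepWt lt c m l • (T j m * T i l)

variable [DecidableEq I] {lt : I → I → Prop} [DecidableRel lt] {q c : k}
variable {B : Type*} [Ring B] [Algebra k B] {T T' : Matrix I I B}

theorem diagWt_comm (i j : I) : diagWt q i j = diagWt q j i := by
  simp [diagWt, eq_comm]

theorem IsFRT.transpose (h : IsFRT lt q c T) : IsFRT lt q c T.transpose := by
  intro i j m l
  have := h l m j i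
  simp only [Matrix.transpose_apply]
  rw [diagWt_comm i j, diagWt_comm m l]
  exact this.symm

theorem IsFRT.map (h : IsFRT lt q c T) {C : Type*} [Ring C] [Algebra k C] (f : B →ₐ[k] C) :
    IsFRT lt q c (T.map f) := by
  intro i j m l
  simpa only [map_add, map_smul, map_mul, Matrix.map_apply] using congrArg f (h i j m l)

/-- Only entries of different factors need to commute, which is what makes quantization
multiplicative. -/
theorem IsFRT.mul [Fintype I] (h : IsFRT lt q c T) (h' : IsFRT lt q c T')
    (hc : ∀ i j m l, Commute (T i j) (T' m l)) : IsFRT lt q c (T * T') := by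
  intro i j m l
  have key : ∀ i j m l, (T * T') i m * (T * T') j l =
      ∑ a, ∑ b, (T i a * T j b) * (T' a m * T' b l) := by
    intro i j m l
    rw [Matrix.mul_apply, Matrix.mul_apply, Finset.sum_mul_sum]
    refine Finset.sum_congr rfl fun a _ => Finset.sum_congr rfl fun b _ => ?_
    rw [mul_assoc, ← mul_assoc (T' a m), ← (hc j b a m).eq]
    simp only [mul_assoc]
  have hL : ∀ a b, diagWt q i j • ((T i a * T j b) * (T' a m * T' b l)) +
      stepWt lt c j i • ((T j a * T i b) * (T' a m * T' b l)) =
      diagWt q a b • ((T j b * T i a) * (T' a m * T' b l)) +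
      stepWt lt c a b • ((T j a * T i b) * (T' a m * T' b l)) := by
    intro a b
    simpa only [add_mul, smul_mul_assoc] using congrArg (· * (T' a m * T' b l)) (h i j a b)
  have hR : ∀ a b, diagWt q a b • ((T j b * T i a) * (T' a m * T' b l)) +
      stepWt lt c b a • ((T j b * T i a) * (T' b m * T' a l)) =
      diagWt q m l • ((T j b * T i a) * (T' b l * T' a m)) +
      stepWt lt c m l • ((T j b * T i a) * (T' b m * T' a l)) := by
    intro a b
    simpa only [mul_add, mul_smul_comm] using congrArg ((T j b * T i a) * ·) (h' a b m l)
  have hL' := Finset.sum_congr rfl fun a (_ : a ∈ Finset.univ) =>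
    Finset.sum_congr rfl fun b (_ : b ∈ Finset.univ) => hL a b
  have hR' := Finset.sum_congr rfl fun a (_ : a ∈ Finset.univ) =>
    Finset.sum_congr rfl fun b (_ : b ∈ Finset.univ) => hR a b
  have hswap : ∑ a, ∑ b, stepWt lt c a b • ((T j a * T i b) * (T' a m * T' b l)) =
      ∑ a, ∑ b, stepWt lt c b a • ((T j b * T i a) * (T' b m * T' a l)) := Finset.sum_comm
  have hswap2 : ∑ a, ∑ b, (T j b * T i a) * (T' b l * T' a m) =
      ∑ a, ∑ b, (T j a * T i b) * (T' a l * T' b m) := Finset.sum_comm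
  have hswap3 : ∑ a, ∑ b, (T j b * T i a) * (T' b m * T' a l) =
      ∑ a, ∑ b, (T j a * T i b) * (T' a m * T' b l) := Finset.sum_comm
  simp only [Finset.sum_add_distrib, ← Finset.smul_sum] at hL' hR'
  rw [key, key, key]
  rw [hL', hswap, hR', hswap2, hswap3]

theorem isFRT_diagonal {a : I → B} (ha : ∀ i j, Commute (a i) (a j)) :
    IsFRT lt q c (Matrix.diagonal a) := by
  intro i j m l
  rw [((show Commute (Matrix.diagonal a i m) (Matrix.diagonal a j l) from ?_)).eq]
  · by_cases h1 : i = m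
    · subst h1
      by_cases h2 : j = l
      · subst h2
        by_cases h3 : i = j
        · subst h3; rfl
        · simp [h3, Ne.symm h3]
      · simp only [Matrix.diagonal_apply_ne _ h2, zero_mul, smul_zero, zero_add]
        by_cases h3 : i = j
        · subst h3; simp [Matrix.diagonal_apply_ne _ h2]
        · simp [Matrix.diagonal_apply_ne _ (Ne.symm h3)]
    · simp only [Matrix.diagonal_apply_ne _ h1, mul_zero, smul_zero, zero_add]
      by_cases h3 : j = m
      · subst h3
        by_cases h4 : i = l
        · subst h4; rfl
        · simp [Matrix.diagonal_apply_ne _ h4]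
      · simp [Matrix.diagonal_apply_ne _ h3]
  · simp only [Matrix.diagonal_apply]
    split_ifs
    · exact ha _ _
    · exact Commute.zero_right _
    · exact Commute.zero_left _
    · exact Commute.zero_right _

/-- For a total order, the FRT relations are the familiar relations of quantum matrices: entries of
a row, or of a column, `q`-commute, entries on an antidiagonal commute, and the commutator of
entries on a diagonal is `q - q⁻¹` times the product of the other two corners. -/
theorem isFRT_of_relations [IsStrictTotalOrder I lt] (hq : q * (q - c) = 1)
    (hrow : ∀ p r s, lt r s → T p r * T p s = q • (T p s * T p r))
    (hcol : ∀ p r s, lt p r → T p s * T r s = q • (T r s * T p s))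
    (hanti : ∀ p r s u, lt p r → lt s u → T p u * T r s = T r s * T p u)
    (hmain : ∀ p r s u, lt p r → lt s u →
      T p s * T r u - T r u * T p s = c • (T p u * T r s)) :
    IsFRT lt q c T := by
  have hirr : ∀ i, ¬ lt i i := fun i => irrefl i
  have hasymm : ∀ {i j}, lt i j → ¬ lt j i := fun h => asymm h
  have hne : ∀ {i j}, lt i j → i ≠ j := fun h e => hirr _ (e ▸ h)
  have hinv : ∀ {x y : B}, x = q • y → (q - c) • x = y := by
    rintro x y rfl
    rw [smul_smul, mul_comm, hq, one_smul]
  intro i j m l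
  rcases trichotomous_of lt i j with hij | rfl | hij <;>
    rcases trichotomous_of lt m l with hml | rfl | hml
  · have h1 := hmain i j m l hij hml
    have h2 := hanti i j m l hij hml
    simp only [diagWt, stepWt, hne hij, hne hml, hasymm hij, hml, if_true, if_false, one_smul,
      zero_smul, add_zero]
    rw [← h2, ← h1]; abel
  · simp [diagWt, stepWt, hne hij, hasymm hij, hirr, hcol i j m hij]
  · have h2 := hanti i j l m hij hml
    simp [diagWt, stepWt, hne hij, (hne hml).symm, hasymm hij, hasymm hml, h2]
  · have h1 := hinv (hrow i m l hml)
    simp only [diagWt, stepWt, hne hml, hirr, hml, if_true, if_false, one_smul,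
      zero_smul, add_zero]
    rw [← h1, ← add_smul]; congr 1; ring
  · simp [diagWt, stepWt, hirr]
  · have h1 := hrow i l m hml
    simp [diagWt, stepWt, hirr, (hne hml).symm, hasymm hml, h1]
  · have h2 := hanti j i m l hij hml
    simp [diagWt, stepWt, (hne hij).symm, hne hml, hij, hml, h2]
  · have h1 := hinv (hcol j i m hij)
    simp only [diagWt, stepWt, (hne hij).symm, hirr, hij, if_true, if_false, one_smul,
      zero_smul, add_zero]
    rw [← h1, ← add_smul]; congr 1; ring
  · have h1 := hmain j i l m hij hml
    simp only [diagWt, stepWt, (hne hij).symm, (hne hml).symm, hasymm hml, hij, if_true, if_false,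
      one_smul, zero_smul, add_zero]
    rw [← h1]; abel

end FRT

/-! ### Quantum transvections and operators with a symbol -/

section Bidiagonal

variable {k : Type*} [CommRing k] {I : Type*} [DecidableEq I] {lt : I → I → Prop} [DecidableRel lt]
variable {q c : k} {B : Type*} [Ring B] [Algebra k B]

/-- The matrix with diagonal entries `a` at `i`, `d` at `j` and `1` elsewhere, and with the one
off-diagonal entry `b` at `(j, i)`. -/
def bidiag (i j : I) (a b d : B) : Matrix I I B :=
  Matrix.of fun p r =>
    if p = r then (if p = i then a else if p = j then d else 1)
    else if p = j ∧ r = i then b else 0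

/-- If no index lies between `i` and `j`, three entries suffice for a quantum transvection. -/
theorem isFRT_bidiag [IsStrictTotalOrder I lt] (hq : q * (q - c) = 1) {i j : I} (hij : lt i j)
    (hadj : ∀ p, lt i p → ¬ lt p j) {a b d : B} (hab : a * b = q • (b * a))
    (hbd : b * d = q • (d * b)) (had : a * d = d * a) :
    IsFRT lt q c (bidiag i j a b d) := by
  have hne : ∀ {i j}, lt i j → i ≠ j := fun h e => irrefl (r := lt) _ (e ▸ h)
  have hij' := hne hij
  have htr : ∀ {x y z}, lt x y → lt y z → lt x z := fun h h' => _root_.trans h h'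
  have has : ∀ {x y}, lt x y → ¬ lt y x := fun h => asymm h
  have hzero : ∀ p r, p ≠ r → ¬ (p = j ∧ r = i) → bidiag i j a b d p r = 0 := by
    intro p r h1 h2; simp [bidiag, h1, h2]
  have hone : ∀ p, p ≠ i → p ≠ j → bidiag i j a b d p p = 1 := by
    intro p h1 h2; simp [bidiag, h1, h2]
  have hi : bidiag i j a b d i i = a := by simp [bidiag]
  have hj : bidiag i j a b d j j = d := by simp [bidiag, hij'.symm]
  have hb : bidiag i j a b d j i = b := by simp [bidiag, hij'.symm]
  have hdiag : ∀ p r, Commute (bidiag i j a b d p p) (bidiag i j a b d r r) := by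
    intro p r
    by_cases h1 : p = i
    · by_cases h2 : r = j
      · subst h1 h2; rw [hi, hj]; exact had
      · by_cases h3 : r = i
        · subst h1 h3; rfl
        · rw [hone r h3 h2]; exact Commute.one_right _
    · by_cases h2 : p = j
      · by_cases h3 : r = i
        · subst h2 h3; rw [hi, hj]; exact had.symm
        · by_cases h4 : r = j
          · subst h2 h4; rfl
          · rw [hone r h3 h4]; exact Commute.one_right _
      · rw [hone p h1 h2]; exact Commute.one_left _
  -- at most one of two entries on an antidiagonal can be nonzero
  have hcross : ∀ p r s u, lt p r → lt s u →
      bidiag i j a b d p u = 0 ∨ bidiag i j a b d r s = 0 := by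
    intro p r s u hpr hsu
    by_contra! hcon
    have h1 : p = u ∨ (p = j ∧ u = i) := by
      by_contra! h; exact hcon.1 (hzero _ _ h.1 (by tauto))
    have h2 : r = s ∨ (r = j ∧ s = i) := by
      by_contra! h; exact hcon.2 (hzero _ _ h.1 (by tauto))
    rcases h1 with rfl | ⟨rfl, rfl⟩ <;> rcases h2 with rfl | ⟨rfl, rfl⟩
    · exact has hpr hsu
    · exact hadj _ hsu hpr
    · exact has hij (htr hpr hsu)
    · exact has hpr hpr
  apply isFRT_of_relations hq
  · intro p r s hrs
    by_cases h : p = j ∧ r = i ∧ s = j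
    · obtain ⟨rfl, rfl, rfl⟩ := h; rw [hb, hj, hbd]
    · have : bidiag i j a b d p r = 0 ∨ bidiag i j a b d p s = 0 := by
        by_contra! hcon
        have h1 : p = r ∨ (p = j ∧ r = i) := by
          by_contra! h; exact hcon.1 (hzero _ _ h.1 (by tauto))
        have h2 : p = s ∨ (p = j ∧ s = i) := by
          by_contra! h; exact hcon.2 (hzero _ _ h.1 (by tauto))
        rcases h1 with rfl | ⟨rfl, rfl⟩ <;> rcases h2 with rfl | ⟨h3, rfl⟩
        · exact irrefl (r := lt) _ hrs
        · exact has hij (h3 ▸ hrs)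
        · exact h ⟨rfl, rfl, rfl⟩
        · exact irrefl (r := lt) _ hrs
      rcases this with h | h <;> simp [h]
  · intro p r s hpr
    by_cases h : p = i ∧ r = j ∧ s = i
    · obtain ⟨rfl, rfl, rfl⟩ := h; rw [hb, hi, hab]
    · have : bidiag i j a b d p s = 0 ∨ bidiag i j a b d r s = 0 := by
        by_contra! hcon
        have h1 : p = s ∨ (p = j ∧ s = i) := by
          by_contra! h; exact hcon.1 (hzero _ _ h.1 (by tauto))
        have h2 : r = s ∨ (r = j ∧ s = i) := by
          by_contra! h; exact hcon.2 (hzero _ _ h.1 (by tauto))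
        rcases h1 with rfl | ⟨rfl, rfl⟩ <;> rcases h2 with rfl | ⟨h3, h4⟩
        · exact irrefl (r := lt) _ hpr
        · exact h ⟨h4, h3, h4⟩
        · exact has hij hpr
        · exact irrefl (r := lt) _ (h3 ▸ hpr)
      rcases this with h | h <;> simp [h]
  · intro p r s u hpr hsu
    rcases hcross p r s u hpr hsu with h | h <;> simp [h]
  · intro p r s u hpr hsu
    have h0 : bidiag i j a b d p u * bidiag i j a b d r s = 0 := by
      rcases hcross p r s u hpr hsu with h | h <;> simp [h]
    rw [h0, smul_zero, sub_eq_zero]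
    by_cases h1 : p = s
    · subst h1
      by_cases h2 : r = u
      · subst h2; exact hdiag _ _
      · by_cases h3 : r = j ∧ u = i
        · obtain ⟨rfl, rfl⟩ := h3
          rw [hone p (hne hsu) (hne hpr)]; simp
        · simp [hzero _ _ h2 h3]
    · by_cases h3 : p = j ∧ s = i
      · obtain ⟨rfl, rfl⟩ := h3
        by_cases h2 : r = u
        · subst h2
          rw [hone r (hne hsu).symm (hne hpr).symm]; simp
        · rw [hzero r u h2 fun h => hne hpr h.1.symm]; simp
      · simp [hzero _ _ h1 h3]

end Bidiagonal

section Multiplicative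

variable {O : Type*} [CommRing O] {M S : Type*} [CommRing M] [Algebra O M] [CommRing S]
  [Algebra O S]

/-- The endomorphisms of `M` that the character `ev` turns into multiplications, i.e. that become
multiplication operators after specialization. -/
def symbolAlg (ev : M →ₐ[O] S) : Subalgebra O (Module.End O M) where
  carrier := {P | ∀ f, ev (P f) = ev (P 1) * ev f}
  mul_mem' := by
    intro P Q hP hQ f
    rw [Module.End.mul_apply, Module.End.mul_apply, hP, hQ, hP (Q 1), mul_assoc]
  add_mem' := by
    intro P Q hP hQ f
    rw [LinearMap.add_apply, LinearMap.add_apply, map_add, map_add, hP, hQ, add_mul]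
  algebraMap_mem' := by
    intro r f
    simp [Module.algebraMap_end_apply]

/-- The specialization of an operator in `symbolAlg ev`. -/
def symbol (ev : M →ₐ[O] S) : symbolAlg ev →ₐ[O] S where
  toFun P := ev (P.1 1)
  map_one' := by simp
  map_mul' P Q := by
    change ev ((P.1 * Q.1) 1) = _
    rw [Module.End.mul_apply, P.2]
  map_zero' := by simp
  map_add' P Q := by simp
  commutes' r := by
    change ev ((algebraMap O (Module.End O M) r) 1) = _
    simp [Module.algebraMap_end_apply, Algebra.smul_def]

end Multiplicative

/-! ### Quantization of commutative matrices -/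

section Quantizable

universe u
variable {O I S : Type u} [CommRing O] [CommRing S] [Algebra O S]
variable [DecidableEq I] {lt : I → I → Prop} [DecidableRel lt] {q c : O}

/-- The matrix `T₀` over the commutative `O`-algebra `S` is the specialization of a quantum matrix
with entries in a flat `O`-algebra. -/
def IsQuantizable (lt : I → I → Prop) [DecidableRel lt] (q c : O) (T₀ : Matrix I I S) : Prop :=
  ∃ (C : Type u) (_ : Ring C) (_ : Algebra O C) (_ : Module.Flat O C) (ε : C →ₐ[O] S)
    (T : Matrix I I C), IsFRT lt q c T ∧ T.map ε = T₀

theorem IsQuantizable.transpose {T₀ : Matrix I I S} (h : IsQuantizable lt q c T₀) :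
    IsQuantizable lt q c T₀.transpose := by
  obtain ⟨C, _, _, _, ε, T, hT, rfl⟩ := h
  exact ⟨C, _, _, ‹_›, ε, T.transpose, hT.transpose, rfl⟩

theorem IsQuantizable.mul [Fintype I] {T₀ T₁ : Matrix I I S} (h : IsQuantizable lt q c T₀)
    (h' : IsQuantizable lt q c T₁) : IsQuantizable lt q c (T₀ * T₁) := by
  obtain ⟨C, _, _, _, ε, T, hT, rfl⟩ := h
  obtain ⟨D, _, _, _, δ, U, hU, rfl⟩ := h'
  refine ⟨C ⊗[O] D, inferInstance, inferInstance, inferInstance,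
    Algebra.TensorProduct.lift ε δ fun _ _ => Commute.all _ _,
    T.map (Algebra.TensorProduct.includeLeft (R := O) (S := O)) *
      U.map (Algebra.TensorProduct.includeRight (R := O)), ?_, ?_⟩
  · refine (hT.map _).mul (hU.map _) fun i j m l => ?_
    simp [Commute, SemiconjBy]
  · ext i j
    simp [Matrix.mul_apply]

theorem isQuantizable_diagonal [Fintype I] (z : I → S) :
    IsQuantizable lt q c (Matrix.diagonal z) := by
  refine ⟨MvPolynomial I O, inferInstance, inferInstance, inferInstance, MvPolynomial.aeval z,
    Matrix.diagonal MvPolynomial.X, isFRT_diagonal fun _ _ => Commute.all _ _, ?_⟩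
  rw [Matrix.diagonal_map (map_zero _)]
  congr 1
  ext i
  simp

theorem flat_of_isTorsionFree (O : Type*) [CommRing O] [IsDomain O] [ValuationRing O] (M : Type*)
    [AddCommGroup M] [Module O M] [Module.IsTorsionFree O M] : Module.Flat O M := by
  rwa [Module.Flat.flat_iff_torsion_eq_bot_of_isBezout,
    ← Submodule.isTorsionFree_iff_torsion_eq_bot]

/-- Over a valuation ring the algebra of operators with a symbol is flat, as it has no torsion. -/
theorem flat_symbolAlg [IsDomain O] [ValuationRing O] {M : Type*} [CommRing M] [Algebra O M]
    [Module.IsTorsionFree O M] (ev : M →ₐ[O] S) : Module.Flat O (symbolAlg ev) := by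
  have : Module.IsTorsionFree O (symbolAlg ev) := by
    refine ⟨fun r hr P Q h => ?_⟩
    ext f
    have := congrArg (fun R : symbolAlg ev => R.1 f) h
    exact hr.isSMulRegular this
  exact flat_of_isTorsionFree O (symbolAlg ev)

/-- The matrix with entries `τ₀`, `x₀ τ₁` and `x₁` at `(i, i)`, `(j, i)` and `(j, j)` is a quantum
matrix if `τ₀` and `τ₁` are the `q`-shifts of the variables `x₀` and `x₁`. It specializes to a
transvection where the shifts become trivial and `x₁` becomes `1`. -/
theorem isQuantizable_transvection_of_shifts [IsDomain O] [ValuationRing O]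
    [IsStrictTotalOrder I lt] (hq : q * (q - c) = 1) {i j : I} (hij : lt i j)
    (hadj : ∀ p, lt i p → ¬ lt p j) {M : Type u} [CommRing M] [Algebra O M]
    [Module.IsTorsionFree O M] (ev : M →ₐ[O] S) (τ₀ τ₁ : M →ₐ[O] M) (h₀ : ∀ f, ev (τ₀ f) = ev f)
    (h₁ : ∀ f, ev (τ₁ f) = ev f) (hτ : ∀ f, τ₀ (τ₁ f) = τ₁ (τ₀ f)) {x₀ x₁ : M}
    (h00 : τ₀ x₀ = q • x₀) (h01 : τ₀ x₁ = x₁) (h11 : τ₁ x₁ = q • x₁) (hx₁ : ev x₁ = 1) :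
    IsQuantizable lt q c (Matrix.transvection j i (ev x₀)) := by
  have hij' : i ≠ j := fun e => irrefl (r := lt) _ (e ▸ hij)
  obtain ⟨a, ha⟩ : ∃ a : symbolAlg ev, ∀ f, a.1 f = τ₀ f :=
    ⟨⟨τ₀.toLinearMap, fun f => by simp [h₀]⟩, fun f => rfl⟩
  obtain ⟨b, hb⟩ : ∃ b : symbolAlg ev, ∀ f, b.1 f = x₀ * τ₁ f :=
    ⟨⟨LinearMap.mulLeft O x₀ * τ₁.toLinearMap, fun f => by simp [h₁]⟩, fun f => rfl⟩
  obtain ⟨d, hd⟩ : ∃ d : symbolAlg ev, ∀ f, d.1 f = x₁ * f :=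
    ⟨⟨LinearMap.mulLeft O x₁, fun f => by simp⟩, fun f => rfl⟩
  refine ⟨symbolAlg ev, inferInstance, inferInstance, flat_symbolAlg ev, symbol ev,
    bidiag i j a b d, isFRT_bidiag hq hij hadj ?_ ?_ ?_, ?_⟩
  · refine Subtype.ext (LinearMap.ext fun f => ?_)
    change a.1 (b.1 f) = q • b.1 (a.1 f)
    rw [ha, hb, hb, ha, map_mul, hτ, h00, smul_mul_assoc]
  · refine Subtype.ext (LinearMap.ext fun f => ?_)
    change b.1 (d.1 f) = q • d.1 (b.1 f)
    rw [hb, hb, hd, hd, map_mul, h11, smul_mul_assoc, mul_smul_comm, mul_left_comm]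
  · refine Subtype.ext (LinearMap.ext fun f => ?_)
    change a.1 (d.1 f) = d.1 (a.1 f)
    rw [ha, ha, hd, hd, map_mul, h01]
  · have ha' : symbol ev a = 1 := by
      change ev (a.1 1) = 1
      rw [ha, map_one, map_one]
    have hb' : symbol ev b = ev x₀ := by
      change ev (b.1 1) = _
      rw [hb, map_one, mul_one]
    have hd' : symbol ev d = 1 := by
      change ev (d.1 1) = 1
      rw [hd, mul_one, hx₁]
    ext p r
    simp only [Matrix.map_apply, bidiag, Matrix.of_apply, Matrix.transvection, Matrix.add_apply,
      Matrix.single_apply, Matrix.one_apply]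
    by_cases h1 : p = r
    · subst h1
      have : ¬ (j = p ∧ i = p) := fun h => hij' (h.2.trans h.1.symm)
      simp only [if_true, this, if_false, add_zero]
      split_ifs <;> simp [ha', hd']
    · by_cases h2 : p = j ∧ r = i
      · obtain ⟨rfl, rfl⟩ := h2
        simp [hij'.symm, hb']
      · have : ¬ (j = p ∧ i = r) := fun h => h2 ⟨h.1.symm, h.2.symm⟩
        simp [h1, h2, this]

/-- The shifts of `isQuantizable_transvection_of_shifts` exist on polynomials in two variables. -/
theorem isQuantizable_transvection_of_adjacent [IsDomain O] [ValuationRing O]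
    [IsStrictTotalOrder I lt] (hq : q * (q - c) = 1) (hq1 : algebraMap O S q = 1) {i j : I}
    (hij : lt i j) (hadj : ∀ p, lt i p → ¬ lt p j) (s : S) :
    IsQuantizable lt q c (Matrix.transvection j i s) := by
  let ev : MvPolynomial Bool O →ₐ[O] S := MvPolynomial.aeval fun t => cond t 1 s
  let τ : Bool → MvPolynomial Bool O →ₐ[O] MvPolynomial Bool O := fun t =>
    MvPolynomial.aeval fun t' => if t' = t then q • MvPolynomial.X t' else MvPolynomial.X t'
  have hτev : ∀ t f, ev (τ t f) = ev f := by
    intro t f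
    have : ev.comp (τ t) = ev := by
      ext t'
      simp only [ev, τ, AlgHom.comp_apply, MvPolynomial.aeval_X]
      split_ifs
      · simp [Algebra.smul_def, hq1]
      · simp
    exact congrArg (· f) this
  have hcomm : ∀ f, τ false (τ true f) = τ true (τ false f) := by
    intro f
    have : (τ false).comp (τ true) = (τ true).comp (τ false) := by
      refine MvPolynomial.algHom_ext fun t => ?_
      cases t <;> simp [τ]
    exact congrArg (· f) this
  have := isQuantizable_transvection_of_shifts hq hij hadj ev (τ false) (τ true) (hτev _) (hτev _)
    hcomm (x₀ := MvPolynomial.X false) (x₁ := MvPolynomial.X true) (by simp [τ]) (by simp [τ])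
    (by simp [τ]) (by simp [ev])
  simpa [ev] using this

/-- A transvection in non-adjacent rows is a commutator of transvections through an index in
between. -/
theorem transvection_eq_commutator {R : Type*} [CommRing R] [Fintype I] {i m j : I} (hjm : j ≠ m)
    (hmi : m ≠ i) (hji : j ≠ i) (s : R) :
    Matrix.transvection j i s = Matrix.transvection j m s * Matrix.transvection m i 1 *
      (Matrix.transvection j m (-s) * Matrix.transvection m i (-1)) := by
  simp only [Matrix.transvection, mul_add, add_mul, mul_one, one_mul,
    Matrix.single_mul_single_same, ne_eq, hjm.symm, hmi.symm, hji.symm,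
    not_false_eq_true, Matrix.single_mul_single_of_ne, add_zero]
  ext x y
  simp only [Matrix.add_apply, Matrix.single_apply]
  split_ifs <;> ring

/-- Induction on the number of indices between `i` and `j`. -/
theorem isQuantizable_transvection [Fintype I] [IsDomain O] [ValuationRing O]
    [IsStrictTotalOrder I lt] (hq : q * (q - c) = 1) (hq1 : algebraMap O S q = 1) {i j : I}
    (hij : lt i j) (s : S) : IsQuantizable lt q c (Matrix.transvection j i s) := by
  have hne : ∀ {i j}, lt i j → i ≠ j := fun h e => irrefl (r := lt) _ (e ▸ h)
  induction hn : (Finset.univ.filter fun p => lt i p ∧ lt p j).card using Nat.strong_induction_on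
    generalizing i j s with
  | _ n ih =>
    by_cases h : ∃ m, lt i m ∧ lt m j
    · obtain ⟨m, him, hmj⟩ := h
      have h1 : (Finset.univ.filter fun p => lt i p ∧ lt p m).card < n := by
        rw [← hn]
        refine Finset.card_lt_card ⟨fun p hp => ?_, fun hsub => ?_⟩
        · simp only [Finset.mem_filter, Finset.mem_univ, true_and] at hp ⊢
          exact ⟨hp.1, _root_.trans hp.2 hmj⟩
        · have := hsub (show m ∈ _ by simp [him, hmj])
          simp only [Finset.mem_filter, Finset.mem_univ, true_and] at this
          exact irrefl (r := lt) _ this.2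
      have h2 : (Finset.univ.filter fun p => lt m p ∧ lt p j).card < n := by
        rw [← hn]
        refine Finset.card_lt_card ⟨fun p hp => ?_, fun hsub => ?_⟩
        · simp only [Finset.mem_filter, Finset.mem_univ, true_and] at hp ⊢
          exact ⟨_root_.trans him hp.1, hp.2⟩
        · have := hsub (show m ∈ _ by simp [him, hmj])
          simp only [Finset.mem_filter, Finset.mem_univ, true_and] at this
          exact irrefl (r := lt) _ this.1
      rw [transvection_eq_commutator (hne hmj).symm (hne him).symm (hne hij).symm]
      exact ((ih _ h2 hmj _ rfl).mul (ih _ h1 him _ rfl)).mul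
        ((ih _ h2 hmj _ rfl).mul (ih _ h1 him _ rfl))
    · push Not at h
      exact isQuantizable_transvection_of_adjacent hq hq1 hij h s

/-- Matrices over a field are products of diagonal matrices and transvections, hence all of them
can be quantized. -/
theorem isQuantizable_of_field {S : Type u} [Field S] [Algebra O S] [Fintype I] [IsDomain O]
    [ValuationRing O] [IsStrictTotalOrder I lt] (hq : q * (q - c) = 1)
    (hq1 : algebraMap O S q = 1) (T₀ : Matrix I I S) : IsQuantizable lt q c T₀ := by
  refine Matrix.diagonal_transvection_induction _ T₀ (fun D _ => isQuantizable_diagonal D)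
    (fun t => ?_) fun _ _ => IsQuantizable.mul
  obtain ⟨i, j, hij, s⟩ := t
  rw [Matrix.TransvectionStruct.toMatrix_mk]
  rcases trichotomous_of lt i j with h | h | h
  · have : Matrix.transvection i j s = (Matrix.transvection j i s).transpose := by
      simp [Matrix.transvection, Matrix.transpose_single]
    rw [this]
    exact (isQuantizable_transvection hq hq1 h s).transpose
  · exact absurd h hij
  · exact isQuantizable_transvection hq hq1 h s

end Quantizable

/-! ### Ordered monomials -/

section Spanning

variable {O : Type*} [CommRing O] {A : Type*} [Ring A] [Algebra O A] {Λ : Type*}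

/-- The product of the `y a` for `a` in a multiset, in an arbitrary but fixed order. -/
noncomputable def sortedWord (y : Λ → A) (m : Multiset Λ) : A := (m.toList.map y).prod

theorem map_sortedWord {B F : Type*} [Ring B] [FunLike F A B] [RingHomClass F A B] (f : F)
    (y : Λ → A) (m : Multiset Λ) : f (sortedWord y m) = sortedWord (fun a => f (y a)) m := by
  simp [sortedWord, map_list_prod, Function.comp_def]

theorem smul_pow_mul_mem {𝔪 : Ideal O} {P : Submodule O A} {d e f : ℕ} (h : d + e = f) {x z : A}
    (hx : x ∈ 𝔪 • P ^ d) (hz : z ∈ P ^ e) : x * z ∈ 𝔪 • P ^ f := by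
  induction hx using Submodule.smul_induction_on' with
  | smul r hr w hw =>
    rw [smul_mul_assoc]
    exact Submodule.smul_mem_smul hr (h ▸ pow_add P d e ▸ Submodule.mul_mem_mul hw hz)
  | add x _ y _ hx hy => rw [add_mul]; exact add_mem hx hy

theorem mul_smul_pow_mem {𝔪 : Ideal O} {P : Submodule O A} {d e f : ℕ} (h : e + d = f) {x z : A}
    (hx : x ∈ 𝔪 • P ^ d) (hz : z ∈ P ^ e) : z * x ∈ 𝔪 • P ^ f := by
  induction hx using Submodule.smul_induction_on' with
  | smul r hr w hw =>
    rw [mul_smul_comm]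
    exact Submodule.smul_mem_smul hr (h ▸ pow_add P e d ▸ Submodule.mul_mem_mul hz hw)
  | add x _ y _ hx hy => rw [mul_add]; exact add_mem hx hy

theorem word_mem_pow (y : Λ → A) (l : List Λ) :
    (l.map y).prod ∈ Submodule.span O (Set.range y) ^ l.length := by
  induction l with
  | nil => simp [Submodule.one_le.mp le_rfl]
  | cons a l ih =>
    rw [List.map_cons, List.prod_cons, List.length_cons, pow_succ']
    exact Submodule.mul_mem_mul (Submodule.subset_span ⟨a, rfl⟩) ih

/-- If the letters commute modulo `𝔪 P ^ 2`, reordering a word of length `d` changes it by an element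
of `𝔪 P ^ d`, where `P` is spanned by the letters. -/
theorem word_sub_word_mem (y : Λ → A) {𝔪 : Ideal O}
    (h : ∀ a b, y a * y b - y b * y a ∈ 𝔪 • Submodule.span O (Set.range y) ^ 2)
    {l l' : List Λ} (hl : l.Perm l') :
    (l.map y).prod - (l'.map y).prod ∈ 𝔪 • Submodule.span O (Set.range y) ^ l.length := by
  induction hl with
  | nil => simp
  | cons a _ ih =>
    simp only [List.map_cons, List.prod_cons, List.length_cons, ← mul_sub]
    exact mul_smul_pow_mem (e := 1) (add_comm _ _) ih
      (by rw [pow_one]; exact Submodule.subset_span ⟨a, rfl⟩)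
  | swap a b l =>
    simp only [List.map_cons, List.prod_cons, List.length_cons, ← mul_assoc, ← sub_mul]
    exact smul_pow_mul_mem (d := 2) (e := l.length) (by ring) (h b a) (word_mem_pow y l)
  | trans h₁ _ ih₁ ih₂ =>
    rw [← h₁.length_eq] at ih₂
    simpa using add_mem ih₁ ih₂

/-- If the generators commute modulo the maximal ideal, then by Nakayama's lemma the ordered
monomials of degree `d` span all monomials of degree `d`. -/
theorem pow_le_span_sortedWord [IsLocalRing O] [Finite Λ] (y : Λ → A)
    (h : ∀ a b, y a * y b - y b * y a ∈
      IsLocalRing.maximalIdeal O • Submodule.span O (Set.range y) ^ 2) (d : ℕ) :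
    Submodule.span O (Set.range y) ^ d ≤ Submodule.span O (Set.range (sortedWord y)) := by
  have hfg : (Submodule.span O (Set.range y) ^ d).FG :=
    (Submodule.fg_span (Set.finite_range y)).pow d
  refine Submodule.le_of_le_smul_of_le_jacobson_bot hfg (IsLocalRing.maximalIdeal_le_jacobson _) ?_
  nth_rewrite 1 [Submodule.span_pow]
  rw [Submodule.span_le]
  rintro x hx
  obtain ⟨f, rfl⟩ := Set.mem_pow.mp hx
  choose g hg using fun i => (f i).2
  obtain ⟨l, hl, hl'⟩ : ∃ l : List Λ, l.length = d ∧
      (List.ofFn fun i => (f i : A)) = l.map y :=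
    ⟨List.ofFn g, by simp, by simp [List.map_ofFn, Function.comp_def, hg]⟩
  rw [hl', ← hl]
  have hp : l.Perm (l : Multiset Λ).toList := by
    rw [← Multiset.coe_eq_coe, Multiset.coe_toList]
  have := word_sub_word_mem y h hp
  rw [← sub_add_cancel (l.map y).prod (((l : Multiset Λ).toList).map y).prod, add_comm]
  exact Submodule.add_mem_sup (Submodule.subset_span ⟨(l : Multiset Λ), rfl⟩) this

theorem span_sortedWord_eq_top [IsLocalRing O] (K : Type*) [Field K] [Algebra O K] [Algebra K A]
    [IsScalarTower O K A] [Finite Λ] (y : Λ → A)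
    (h : ∀ a b, y a * y b - y b * y a ∈
      IsLocalRing.maximalIdeal O • Submodule.span O (Set.range y) ^ 2)
    (hgen : Algebra.adjoin K (Set.range y) = ⊤) :
    Submodule.span K (Set.range (sortedWord y)) = ⊤ := by
  have h1 : (Algebra.adjoin K (Set.range y)).toSubmodule = ⊤ := by rw [hgen]; rfl
  rw [eq_top_iff, ← h1, Algebra.adjoin_eq_span, Submodule.span_le]
  intro x hx
  obtain ⟨l, hl, rfl⟩ := Submonoid.exists_list_of_mem_closure hx
  obtain ⟨l', rfl⟩ : ∃ l' : List Λ, l'.map y = l := by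
    have : l ∈ Set.range (List.map y) := by rw [Set.range_list_map]; exact hl
    exact this
  exact Submodule.span_le_restrictScalars O K _ (pow_le_span_sortedWord y h _ (word_mem_pow y l'))

end Spanning

section Independence

variable {K : Type*} [Field K] {O : Type*} [CommRing O] [IsDomain O] [ValuationRing O]
  [Algebra O K] [IsFractionRing O K]

/-- A linear relation over `K` can be rescaled so that its coefficients lie in `O` and one of them
is `1`. -/
theorem exists_integral_multiple {Λ : Type*} {s : Finset Λ} (c : Λ → K) {a : Λ} (ha : a ∈ s)
    (hca : c a ≠ 0) :
    ∃ r : K, ∃ c' : Λ → O, (∀ b ∈ s, algebraMap O K (c' b) = r * c b) ∧ ∃ b ∈ s, c' b = 1 := by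
  obtain ⟨b, hb, hmax⟩ := s.exists_max_image (fun b => ValuationRing.valuation O K (c b)) ⟨a, ha⟩
  have hcb : c b ≠ 0 := by
    intro h0
    have := hmax a ha
    rw [h0, map_zero, le_zero_iff, map_eq_zero] at this
    exact hca this
  have key : ∀ e ∈ s, ∃ o : O, algebraMap O K o = (c b)⁻¹ * c e := by
    intro e he
    have : (c b)⁻¹ * c e ∈ (ValuationRing.valuation O K).integer := by
      rw [Valuation.mem_integer_iff, map_mul, map_inv₀]
      have hv : ValuationRing.valuation O K (c b) ≠ 0 := by simpa using hcb
      rw [← inv_mul_cancel₀ hv]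
      gcongr
      exact hmax e he
    rwa [ValuationRing.mem_integer_iff] at this
  classical
  choose! c' hc' using key
  refine ⟨(c b)⁻¹, c', hc', b, hb, ?_⟩
  apply IsFractionRing.injective O K
  rw [hc' b hb, inv_mul_cancel₀ hcb, map_one]

/-- Linear independence over `K` follows from linear independence modulo the maximal ideal. -/
theorem linearIndependent_of_integral {B Λ : Type*} [AddCommGroup B] [Module K B] (w : Λ → B)
    (h : ∀ (s : Finset Λ) (c : Λ → O), ∑ a ∈ s, algebraMap O K (c a) • w a = 0 →
      ∀ a ∈ s, ¬ IsUnit (c a)) : LinearIndependent K w := by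
  rw [linearIndependent_iff']
  intro s c hc a ha
  by_contra hca
  obtain ⟨r, c', hc', b, hb, hb1⟩ := exists_integral_multiple (O := O) c ha hca
  refine h s c' ?_ b hb (hb1 ▸ isUnit_one)
  rw [Finset.sum_congr rfl fun e he => by rw [hc' e he, mul_smul], ← Finset.smul_sum, hc, smul_zero]

end Independence

section Polynomial

variable {Λ F : Type*} [Field F]

open MvPolynomial

/-- The substitution `x_a ↦ x_a + (terms of degree ≥ 2)` is the identity on lowest components. -/
theorem aeval_sub_mem_pow (Q : Λ → MvPolynomial Λ F) (hQ : ∀ a, Q a ∈ idealOfVars Λ F ^ 2)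
    (d : ℕ) {g : MvPolynomial Λ F} (hg : g ∈ idealOfVars Λ F ^ d) :
    aeval (fun a => X a + Q a) g - g ∈ idealOfVars Λ F ^ (d + 1) := by
  have hψ : ∀ p, aeval (fun a => X a + Q a) p - p ∈ idealOfVars Λ F := by
    intro p
    induction p using MvPolynomial.induction_on with
    | C r => simp [algebraMap_eq]
    | add p q hp hq =>
      rw [map_add, add_sub_add_comm]; exact add_mem hp hq
    | mul_X p a hp =>
      have h1 : X a ∈ idealOfVars Λ F := Ideal.subset_span ⟨a, rfl⟩
      have h2 : Q a ∈ idealOfVars Λ F := Ideal.pow_le_self two_ne_zero (hQ a)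
      rw [map_mul, aeval_X]
      exact sub_mem (Ideal.mul_mem_left _ _ (add_mem h1 h2)) (Ideal.mul_mem_left _ _ h1)
  induction d generalizing g with
  | zero => simpa using hψ g
  | succ d ih =>
    rw [pow_succ] at hg
    induction hg using Submodule.mul_induction_on' with
    | mem_mul_mem p hp r hr =>
      have hr' : aeval (fun a => X a + Q a) r - r ∈ idealOfVars Λ F ^ 2 := by
        induction hr using Submodule.span_induction with
        | mem x hx =>
          obtain ⟨a, rfl⟩ := hx
          simpa using hQ a
        | zero => simp
        | add x y _ _ hx hy => rw [map_add, add_sub_add_comm]; exact add_mem hx hy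
        | smul u x hx' hx =>
          have : aeval (fun a => X a + Q a) (u • x) - u • x =
              aeval (fun a => X a + Q a) u * (aeval (fun a => X a + Q a) x - x) +
                (aeval (fun a => X a + Q a) u - u) * x := by
            simp only [smul_eq_mul, map_mul]; ring
          rw [this, pow_two]
          exact add_mem (Ideal.mul_mem_left _ _ (pow_two (idealOfVars Λ F) ▸ hx))
            (Ideal.mul_mem_mul (hψ u) hx')
      have hψp : aeval (fun a => X a + Q a) p ∈ idealOfVars Λ F ^ d := by
        have := add_mem (Ideal.pow_le_pow_right (Nat.le_succ d) (ih hp)) hp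
        simpa using this
      have : aeval (fun a => X a + Q a) (p * r) - p * r =
          aeval (fun a => X a + Q a) p * (aeval (fun a => X a + Q a) r - r) +
            (aeval (fun a => X a + Q a) p - p) * r := by
        simp only [map_mul]; ring
      rw [this]
      refine add_mem ?_ ?_
      · have := Ideal.mul_mem_mul hψp hr'
        rwa [← pow_add] at this
      · have := Ideal.mul_mem_mul (ih hp) hr
        rwa [← pow_succ] at this
    | add x _ y _ hx hy => rw [map_add, add_sub_add_comm]; exact add_mem hx hy

/-- A substitution `x_a ↦ x_a + (terms of degree ≥ 2)` preserves the lowest homogeneous component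
of a polynomial, so it is injective. -/
theorem aeval_X_add_injective (Q : Λ → MvPolynomial Λ F) (hQ : ∀ a, Q a ∈ idealOfVars Λ F ^ 2) :
    Function.Injective (aeval (R := F) (fun a => X a + Q a)) := by
  rw [injective_iff_map_eq_zero]
  intro g hg
  have : ∀ d, g ∈ idealOfVars Λ F ^ d := by
    intro d
    induction d with
    | zero => simp
    | succ d ih =>
      have := aeval_sub_mem_pow Q hQ d ih
      rw [hg, zero_sub] at this
      simpa using this
  ext x
  rw [coeff_zero]
  exact (mem_pow_idealOfVars_iff' _ _).mp (this (x.degree + 1)) x (Nat.lt_succ_self _)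

/-- The affine change of variables `x_a ↦ (x_a - j_a) / 2` reduces this to
`aeval_X_add_injective`. -/
theorem algebraicIndependent_affine_add (h2 : (2 : F) ≠ 0) (j : Λ → F)
    (Q : Λ → MvPolynomial Λ F) (hQ : ∀ a, Q a ∈ idealOfVars Λ F ^ 2) :
    AlgebraicIndependent F fun a => C (j a) + 2 * X a + Q a := by
  have h := aeval_X_add_injective (fun a => C 2⁻¹ * Q a) fun a => Ideal.mul_mem_left _ _ (hQ a)
  let θ : MvPolynomial Λ F →ₐ[F] MvPolynomial Λ F := aeval fun a => C 2⁻¹ * (X a - C (j a))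
  let θ' : MvPolynomial Λ F →ₐ[F] MvPolynomial Λ F := aeval fun a => C (j a) + 2 * X a
  have hC : (2 : MvPolynomial Λ F) = C 2 := (map_ofNat C 2).symm
  have hinv : C (2⁻¹ : F) * 2 = (1 : MvPolynomial Λ F) := by
    rw [hC, ← C_mul, inv_mul_cancel₀ h2, C_1]
  have h1 : θ.comp θ' = AlgHom.id _ _ := by
    ext1 a
    simp only [θ, θ', AlgHom.comp_apply, aeval_X, map_add, map_mul, map_ofNat, algHom_C,
      algebraMap_eq, AlgHom.id_apply]
    linear_combination (X a - C (j a)) * hinv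
  have h3 : (aeval fun a => C (j a) + 2 * X a + Q a).comp θ =
      aeval (R := F) fun a => X a + C 2⁻¹ * Q a := by
    ext1 a
    simp only [θ, AlgHom.comp_apply, aeval_X, map_sub, map_mul, algHom_C, algebraMap_eq]
    linear_combination X a * hinv
  rw [algebraicIndependent_iff]
  intro f hf
  have h4 : θ (θ' f) = f := congrArg (fun g : _ →ₐ[F] _ => g f) h1
  have h5 : θ' f = 0 := by
    apply h
    rw [map_zero, ← h3, AlgHom.comp_apply, h4, hf]
  rw [← h4, h5, map_zero]

theorem linearIndependent_prod_of_algebraicIndependent {S : Type*} [CommRing S] [Algebra F S]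
    {x : Λ → S} (hx : AlgebraicIndependent F x) :
    LinearIndependent F fun m : Multiset Λ => (m.map x).prod := by
  classical
  have h1 := ((MvPolynomial.basisMonomials Λ F).linearIndependent.map' (aeval x).toLinearMap
    (LinearMap.ker_eq_bot.mpr hx)).comp _ Multiset.toFinsupp.injective
  have h2 : (fun m : Multiset Λ => (m.map x).prod) =
      ((aeval x).toLinearMap ∘ basisMonomials Λ F) ∘ Multiset.toFinsupp := by
    funext m
    simp only [Function.comp_apply, coe_basisMonomials, AlgHom.toLinearMap_apply, aeval_monomial,
      map_one, one_mul]
    rw [Finset.prod_multiset_map_count, Finsupp.prod, Multiset.toFinsupp_support]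
    simp
  rw [h2]
  exact h1

end Polynomial

/-! ### Solutions of the reflection equation -/

section Reflection

section Entries

variable {k : Type*} [CommRing k] {I : Type*} [DecidableEq I] (lt : I → I → Prop) [DecidableRel lt]
variable (q c : k) {B : Type*} [Ring B] [Algebra k B]

/-- The entries of `Y₁ R^{t₁} Y₂`. -/
def reflHalf (y : Matrix I I B) (i j m l : I) : B :=
  diagWt q j m • (y i m * y j l) + stepWt lt c j m • (y i j * y m l)

/-- The entries of `Y₂ R^{t₁} Y₁`. -/
def reflHalf' (y : Matrix I I B) (i j m l : I) : B :=
  diagWt q i l • (y j l * y i m) + stepWt lt c i l • (y j i * y l m)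

/-- The entries of `R Y₁ R^{t₁} Y₂ - Y₂ R^{t₁} Y₁ R`. -/
def reflElt (y : Matrix I I B) (i j m l : I) : B :=
  diagWt q i j • reflHalf lt q c y i j m l + stepWt lt c j i • reflHalf lt q c y j i m l -
    (diagWt q m l • reflHalf' lt q c y i j m l + stepWt lt c m l • reflHalf' lt q c y i j l m)

variable {lt q c}

theorem map_reflElt (y : Matrix I I B) {C : Type*} [Ring C] [Algebra k C] (f : B →ₐ[k] C)
    (i j m l : I) : f (reflElt lt q c y i j m l) = reflElt lt q c (y.map f) i j m l := by
  simp only [reflElt, reflHalf, reflHalf', map_sub, map_add, map_smul, map_mul, Matrix.map_apply]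

theorem reflElt_diagonal (a : I → k) (hirr : ∀ i, ¬ lt i i) (i j m l : I) :
    reflElt lt q c (Matrix.diagonal a) i j m l = 0 := by
  have h0 : ∀ {x y : I}, x ≠ y → Matrix.diagonal a x y = 0 := fun h => Matrix.diagonal_apply_ne _ h
  simp only [reflElt, reflHalf, reflHalf', smul_eq_mul]
  by_cases h1 : i = m
  · subst h1
    by_cases h2 : j = l
    · subst h2
      by_cases h3 : i = j
      · subst h3; simp [stepWt, hirr]
      · simp only [h0 h3, h0 (Ne.symm h3), diagWt, h3, Ne.symm h3, if_false]; ring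
    · by_cases h3 : i = j
      · subst h3; simp [stepWt, h0 h2, h0 (Ne.symm h2)]
      · by_cases h4 : i = l
        · subst h4; simp [stepWt, hirr, h0 h2, h0 h3]
        · simp [h0 h2, h0 (Ne.symm h3), h0 h3, h0 h4]
  · by_cases h2 : i = l
    · subst h2
      by_cases h3 : j = m
      · subst h3
        simp only [h0 h1, h0 (Ne.symm h1), stepWt, hirr, if_false]; ring
      · by_cases h4 : i = j
        · subst h4; simp [h0 h1, h0 (Ne.symm h1)]
        · simp [h0 h1, h0 (Ne.symm h1), h0 h3, h0 h4, h0 (Ne.symm h4)]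
    · by_cases h3 : i = j
      · subst h3
        by_cases h4 : m = l
        · subst h4
          have hs : ∀ i, stepWt lt c i i = 0 := fun i => if_neg (hirr i)
          simp only [h0 h1, diagWt, hs, if_true]; ring
        · simp [h0 h1, h0 h2, h0 h4, h0 (Ne.symm h4)]
      · simp [h0 h1, h0 h2, h0 h3, h0 (Ne.symm h3)]

/-- The `q`-symplectic forms solve the reflection equation: `J` is supported on the pairs
`(i, p i)` for a fixed point free involution `p` whose orbits are intervals, and
`J_{p i, i} = -q J_{i, p i}` if `i` precedes `p i`. -/
theorem reflElt_symplectic [IsStrictTotalOrder I lt] (hq : q * (q - c) = 1) (J : Matrix I I k)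
    (p : I → I) (hpp : ∀ i, p (p i) = i) (hp : ∀ i, p i ≠ i)
    (hint : ∀ i j, j ≠ i → j ≠ p i → (lt i j ↔ lt (p i) j)) (hJ : ∀ i j, j ≠ p i → J i j = 0)
    (hJq : ∀ i, lt i (p i) → J (p i) i = -q * J i (p i)) (i j m l : I) :
    reflElt lt q c J i j m l = 0 := by
  have hirr : ∀ i, ¬ lt i i := fun i => irrefl i
  have hpinj : ∀ {x y}, p x = p y → x = y := fun {x y} h => by rw [← hpp x, h, hpp]
  have hsym : ∀ i, lt i (p i) ∨ lt (p i) i := fun i => by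
    rcases trichotomous_of lt i (p i) with h | h | h
    exacts [Or.inl h, absurd h.symm (hp i), Or.inr h]
  have hint' : ∀ i j, i ≠ j → i ≠ p j → (lt i j ↔ lt i (p j)) := by
    intro i j h1 h2
    have e1 := hint j i h1 h2
    have h3 : i ≠ p (p j) := by rwa [hpp]
    rcases trichotomous_of lt i j with h | h | h
    · rcases trichotomous_of lt i (p j) with h' | h' | h'
      · exact ⟨fun _ => h', fun _ => h⟩
      · exact absurd h' h2
      · exact absurd (e1.mpr h') (asymm h)
    · exact absurd h h1
    · exact ⟨fun h' => absurd h (asymm h'), fun h' => absurd (e1.mp h) (asymm h')⟩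
  -- the two forms in which the coefficients `J_{i, p i}` and `J_{p i, i}` get compared
  have hA : ∀ i, q * (J i (p i) + stepWt lt c (p i) i * J (p i) i) = -J (p i) i := by
    intro i
    rcases hsym i with h | h
    · rw [hJq i h, stepWt, if_neg (asymm h)]; ring
    · have := hJq (p i) (by rwa [hpp])
      rw [hpp] at this
      rw [this, stepWt, if_pos h]; linear_combination -J (p i) i * hq
  have hz : ∀ {x y}, y ≠ p x → J x y = 0 := fun h => hJ _ _ h
  have hqu : ∀ x : k, q * x = 0 → x = 0 := by
    intro x hx
    linear_combination (q - c) * hx - x * hq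
  simp only [reflElt, reflHalf, reflHalf', smul_eq_mul]
  by_cases hj : j = i
  · subst hj
    simp only [hz (hp j).symm, stepWt, hirr, if_false]
    by_cases hm : m = p j
    · subst hm
      by_cases hl : l = p j
      · subst hl; simp [diagWt, hirr, (hp j).symm]
      · simp [hz hl]
    · simp [hz hm]
  · by_cases hj' : j = p i
    · subst hj'
      by_cases hm : m = i
      · subst hm
        by_cases hl : l = p m
        · subst hl
          have e := hA m
          rcases hsym m with h | h
          · have := hJq m h
            simp only [hz (hp m).symm, hz (show p m ≠ p (p m) by rw [hpp]; exact hp m), diagWt,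
              stepWt, hirr, h, asymm h, (hp m).symm, if_true, if_false]
            linear_combination (-c * J (p m) m) * this
          · have := hJq (p m) (by rwa [hpp])
            rw [hpp] at this
            simp only [hz (hp m).symm, hz (show p m ≠ p (p m) by rw [hpp]; exact hp m), diagWt,
              stepWt, hirr, h, asymm h, hp m, (hp m).symm, if_true, if_false]
            linear_combination (c * J m (p m)) * this
        · have h1 : l ≠ p m := hl
          by_cases h2 : l = m
          · subst h2; simp [hz (hp l).symm]
          · simp [hz h1, hz (hp m).symm, hz (show m ≠ p l from fun h => h1 (by rw [h, hpp]))]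
      · by_cases hm' : m = p i
        · subst hm'
          by_cases hl : l = i
          · subst hl
            simp only [hz (show p l ≠ p (p l) by rw [hpp]; exact hp l), diagWt,
              stepWt, hirr, hp l, (hp l).symm, if_true, if_false]
            rcases hsym l with h | h
            · simp only [asymm h, if_false]; ring
            · simp only [h, asymm h, if_false]; ring
          · have h1 : l ≠ p (p i) := by rwa [hpp]
            have h2 : p i ≠ p l := fun h => hl (hpinj h.symm)
            simp [hz h1, hz h2, hz (show p i ≠ p (p i) by rw [hpp]; exact hp i)]
        · -- now `m` lies in neither of `i`, `p i`
          by_cases hl : l = p m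
          · subst hl
            have e1 : stepWt lt c (p i) m = stepWt lt c i m := by
              simp only [stepWt, (hint i m hm hm')]
            have e2 : stepWt lt c i (p m) = stepWt lt c i m := by
              simp only [stepWt, (hint' i m (Ne.symm hm) fun h => hm' (by rw [h, hpp]))]
            have e3 := hA i
            have e4 : q * (J (p m) m + stepWt lt c m (p m) * J m (p m)) = -J m (p m) := by
              simpa only [hpp] using hA (p m)
            apply hqu
            have h4 : p i ≠ p m := fun h => hm (hpinj h.symm)
            simp only [hz hm', hz (show m ≠ p (p i) by rwa [hpp]), e1, e2, diagWt,
              (hp i).symm, (hp m).symm, if_false]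
            linear_combination stepWt lt c i m * J m (p m) * e3 -
              stepWt lt c i m * J (p i) i * e4
          · have h5 : m ≠ p l := fun h => hl (by rw [h, hpp])
            simp [hz hl, hz h5, hz hm', hz (show m ≠ p (p i) by rwa [hpp])]
    · -- now `i` and `j` belong to different pairs
      have hj'' : i ≠ p j := fun h => hj' (by rw [h, hpp])
      by_cases hm : m = p i
      · subst hm
        by_cases hl : l = p j
        · subst hl
          have h1 : p i ≠ p j := fun h => hj (hpinj h.symm)
          simp [hz hj', hz hj'', hz h1, diagWt, hj', hj'', Ne.symm hj, h1]
          ring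
        · by_cases h2 : l = p i
          · subst h2
            simp [hz hj', hz hj'', hz hl]
          · simp [hz hj', hz hj'', hz hl, hz h2]
      · by_cases hm' : m = p j
        · subst hm'
          by_cases hl : l = p i
          · subst hl
            have e : stepWt lt c (p j) (p i) = stepWt lt c j i := by
              have h := (hint' j i (hj ·) hj').trans (hint j (p i) (Ne.symm hj') (Ne.symm hm))
              simp only [stepWt, h]
            simp only [hz hj', hz hj'', hz hm, e]
            ring
          · simp [hz hj', hz hj'', hz hl, hz hm]
        · simp [hz hj', hz hj'', hz hm, hz hm']

end Entries

end Reflection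

/-! ### R-matrices and the entries of the matrix equations -/

section MatrixForm

variable {K : Type*} [Field K] {I : Type*} [DecidableEq I] (lt : I → I → Prop) [DecidableRel lt]
variable (q c : K) {A : Type*} [Ring A] [Algebra K A]

/-- The R-matrix of a relation `lt` on the index set, with `c` in the place of `q - q⁻¹`. -/
def rGen : Matrix (I × I) (I × I) K :=
  Matrix.of fun a b => (if a = b then diagWt q a.1 a.2 else 0) +
    if b = (a.2, a.1) then stepWt lt c a.2 a.1 else 0

variable {lt q c}

theorem rGen_apply (i j m l : I) : rGen lt q c (i, j) (m, l) =
    (if i = m then if j = l then diagWt q i j else 0 else 0) +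
      if i = l then if j = m then stepWt lt c j i else 0 else 0 := by
  simp only [rGen, Matrix.of_apply, Prod.mk.injEq, ← ite_and, eq_comm (a := m), eq_comm (a := l)]
  congr 2
  simp only [and_comm]

theorem leg₁_apply (Y : Matrix I I A) (i j m l : I) :
    leg₁ Y (i, j) (m, l) = if j = l then Y i m else 0 := by
  simp [leg₁, Matrix.kroneckerMap_apply, Matrix.one_apply]

theorem leg₂_apply (Y : Matrix I I A) (i j m l : I) :
    leg₂ Y (i, j) (m, l) = if i = m then Y j l else 0 := by
  simp [leg₂, Matrix.kroneckerMap_apply, Matrix.one_apply]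

variable [Fintype I]

theorem scal_rGen_mul {J : Type*} (M : Matrix (I × I) J A) (i j : I) (b : J) :
    (scal A (rGen lt q c) * M) (i, j) b =
      diagWt q i j • M (i, j) b + stepWt lt c j i • M (j, i) b := by
  simp only [Matrix.mul_apply, Fintype.sum_prod_type, scal, Matrix.map_apply, rGen_apply, map_add,
    add_mul, Finset.sum_add_distrib, apply_ite (algebraMap K A), map_zero, ite_mul, zero_mul,
    Finset.sum_ite_eq, Finset.sum_ite_irrel, Finset.sum_const_zero, Finset.mem_univ, if_true,
    Algebra.smul_def]

theorem mul_scal_rGen {J : Type*} (M : Matrix J (I × I) A) (m l : I) (a : J) :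
    (M * scal A (rGen lt q c)) a (m, l) =
      diagWt q m l • M a (m, l) + stepWt lt c m l • M a (l, m) := by
  simp only [Matrix.mul_apply, Fintype.sum_prod_type, scal, Matrix.map_apply, rGen_apply, map_add,
    mul_add, Finset.sum_add_distrib, apply_ite (algebraMap K A), map_zero, mul_ite, mul_zero,
    Finset.sum_ite_eq', Finset.sum_ite_irrel, Finset.sum_const_zero, Finset.mem_univ, if_true,
    Algebra.smul_def, Algebra.commutes]

theorem leg₁_mul_leg₂ (Y Z : Matrix I I A) (i j m l : I) :
    (leg₁ Y * leg₂ Z) (i, j) (m, l) = Y i m * Z j l := by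
  simp [Matrix.mul_apply, Fintype.sum_prod_type, leg₁_apply, leg₂_apply]

theorem leg₂_mul_leg₁ (Y Z : Matrix I I A) (i j m l : I) :
    (leg₂ Y * leg₁ Z) (i, j) (m, l) = Y j l * Z i m := by
  simp [Matrix.mul_apply, Fintype.sum_prod_type, leg₁_apply, leg₂_apply]

theorem leg₁_mul_scal_mul_leg₂ (Y Z : Matrix I I A) (C : Matrix (I × I) (I × I) K) (i j m l : I) :
    (leg₁ Y * scal A C * leg₂ Z) (i, j) (m, l) =
      ∑ b, ∑ a, C (a, j) (m, b) • (Y i a * Z b l) := by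
  simp [Matrix.mul_apply, Fintype.sum_prod_type, leg₁_apply, leg₂_apply, scal, Finset.sum_mul,
    Algebra.smul_def, mul_assoc, Algebra.left_comm]

theorem leg₂_mul_scal_mul_leg₁ (Y Z : Matrix I I A) (C : Matrix (I × I) (I × I) K) (i j m l : I) :
    (leg₂ Y * scal A C * leg₁ Z) (i, j) (m, l) =
      ∑ a, ∑ b, C (i, b) (a, l) • (Y j b * Z a m) := by
  simp [Matrix.mul_apply, Fintype.sum_prod_type, leg₁_apply, leg₂_apply, scal, Finset.sum_mul,
    Algebra.smul_def, mul_assoc, Algebra.left_comm]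

theorem leg₁_mul_tr₁_mul_leg₂ (Y Z : Matrix I I A) (i j m l : I) :
    (leg₁ Y * scal A (tr₁ (rGen lt q c)) * leg₂ Z) (i, j) (m, l) =
      diagWt q j m • (Y i m * Z j l) + stepWt lt c j m • (Y i j * Z m l) := by
  rw [leg₁_mul_scal_mul_leg₂, diagWt_comm]
  simp [tr₁, rGen_apply, add_smul, Finset.sum_add_distrib, ite_smul]

theorem leg₂_mul_tr₁_mul_leg₁ (Y Z : Matrix I I A) (i j m l : I) :
    (leg₂ Y * scal A (tr₁ (rGen lt q c)) * leg₁ Z) (i, j) (m, l) =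
      diagWt q i l • (Y j l * Z i m) + stepWt lt c i l • (Y j i * Z l m) := by
  rw [leg₂_mul_scal_mul_leg₁]
  simp [tr₁, rGen_apply, add_smul, Finset.sum_add_distrib, ite_smul]

theorem leg₁_mul_tr₂_mul_leg₂ (Y Z : Matrix I I A) (i j m l : I) :
    (leg₁ Y * scal A (tr₂ (rGen lt q c)) * leg₂ Z) (i, j) (m, l) =
      diagWt q j m • (Y i m * Z j l) + stepWt lt c m j • (Y i j * Z m l) := by
  rw [leg₁_mul_scal_mul_leg₂, diagWt_comm]
  simp [tr₂, rGen_apply, add_smul, Finset.sum_add_distrib, ite_smul]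

theorem leg₂_mul_tr₂_mul_leg₁ (Y Z : Matrix I I A) (i j m l : I) :
    (leg₂ Y * scal A (tr₂ (rGen lt q c)) * leg₁ Z) (i, j) (m, l) =
      diagWt q i l • (Y j l * Z i m) + stepWt lt c l i • (Y j i * Z l m) := by
  rw [leg₂_mul_scal_mul_leg₁]
  simp [tr₂, rGen_apply, add_smul, Finset.sum_add_distrib, ite_smul]

theorem frtLeft_apply (T : Matrix I I A) (i j m l : I) :
    (scal A (rGen lt q c) * leg₁ T * leg₂ T) (i, j) (m, l) =
      diagWt q i j • (T i m * T j l) + stepWt lt c j i • (T j m * T i l) := by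
  rw [Matrix.mul_assoc, scal_rGen_mul]
  simp only [leg₁_mul_leg₂]

theorem frtRight_apply (T : Matrix I I A) (i j m l : I) :
    (leg₂ T * leg₁ T * scal A (rGen lt q c)) (i, j) (m, l) =
      diagWt q m l • (T j l * T i m) + stepWt lt c m l • (T j m * T i l) := by
  rw [mul_scal_rGen]
  simp only [leg₂_mul_leg₁]

/-- The entries of `R Y₂ Y₁`. -/
theorem frtLeft'_apply (T : Matrix I I A) (i j m l : I) :
    (scal A (rGen lt q c) * leg₂ T * leg₁ T) (i, j) (m, l) =
      diagWt q i j • (T j l * T i m) + stepWt lt c j i • (T i l * T j m) := by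
  rw [Matrix.mul_assoc, scal_rGen_mul]
  simp only [leg₂_mul_leg₁]

/-- The entries of `Y₁ Y₂ R`. -/
theorem frtRight'_apply (T : Matrix I I A) (i j m l : I) :
    (leg₁ T * leg₂ T * scal A (rGen lt q c)) (i, j) (m, l) =
      diagWt q m l • (T i m * T j l) + stepWt lt c m l • (T i l * T j m) := by
  rw [mul_scal_rGen]
  simp only [leg₁_mul_leg₂]

theorem isFRT_iff_matrix (T : Matrix I I A) : IsFRT lt q c T ↔
    scal A (rGen lt q c) * leg₁ T * leg₂ T = leg₂ T * leg₁ T * scal A (rGen lt q c) := by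
  refine ⟨fun h => ?_, fun h i j m l => ?_⟩
  · ext ⟨i, j⟩ ⟨m, l⟩
    rw [frtLeft_apply, frtRight_apply]
    exact h i j m l
  · rw [← frtLeft_apply, ← frtRight_apply, h]

theorem reflX_apply (y : Matrix I I A) (i j m l : I) :
    (scal A (rGen lt q c) * leg₁ y * scal A (tr₁ (rGen lt q c)) * leg₂ y -
      leg₂ y * scal A (tr₁ (rGen lt q c)) * leg₁ y * scal A (rGen lt q c)) (i, j) (m, l) =
      reflElt lt q c y i j m l := by
  rw [Matrix.sub_apply, Matrix.mul_assoc, Matrix.mul_assoc, scal_rGen_mul, mul_scal_rGen,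
    ← Matrix.mul_assoc]
  simp only [leg₁_mul_tr₁_mul_leg₂, leg₂_mul_tr₁_mul_leg₁]
  rfl

/-- The reflection equation for the matrix `D` is the reflection equation for the reversed order,
up to a permutation of the entries. -/
theorem reflD_apply (y : Matrix I I A) (i j m l : I) :
    (scal A (rGen lt q c) * leg₂ y * scal A (tr₂ (rGen lt q c)) * leg₁ y -
      leg₁ y * scal A (tr₂ (rGen lt q c)) * leg₂ y * scal A (rGen lt q c)) (i, j) (m, l) =
      reflElt (fun a b => lt b a) q c y j i l m := by
  rw [Matrix.sub_apply, Matrix.mul_assoc, Matrix.mul_assoc, scal_rGen_mul, mul_scal_rGen,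
    ← Matrix.mul_assoc]
  simp only [leg₁_mul_tr₂_mul_leg₂, leg₂_mul_tr₂_mul_leg₁]
  simp only [reflElt, reflHalf, reflHalf', diagWt_comm j i, diagWt_comm l m]
  rfl

theorem leg₁_mul (Y Z : Matrix I I A) : leg₁ (Y * Z) = leg₁ Y * leg₁ Z := by
  ext ⟨i, j⟩ ⟨m, l⟩
  simp [Matrix.mul_apply, Fintype.sum_prod_type, leg₁_apply, Finset.sum_ite_irrel]

theorem leg₂_mul (Y Z : Matrix I I A) : leg₂ (Y * Z) = leg₂ Y * leg₂ Z := by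
  ext ⟨i, j⟩ ⟨m, l⟩
  simp [Matrix.mul_apply, Fintype.sum_prod_type, leg₂_apply, Finset.sum_ite_irrel]

theorem leg₁_scal_comm (J : Matrix I I K) (Y : Matrix I I A) :
    leg₁ (scal A J) * leg₂ Y = leg₂ Y * leg₁ (scal A J) := by
  ext ⟨i, j⟩ ⟨m, l⟩
  simp [leg₁_mul_leg₂, leg₂_mul_leg₁, scal, Algebra.commutes]

theorem leg₂_scal_comm (J : Matrix I I K) (Y : Matrix I I A) :
    leg₁ Y * leg₂ (scal A J) = leg₂ (scal A J) * leg₁ Y := by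
  ext ⟨i, j⟩ ⟨m, l⟩
  simp [leg₁_mul_leg₂, leg₂_mul_leg₁, scal, Algebra.commutes]

/-- The partial transpose of the FRT relations. -/
theorem IsFRT.partial_transpose {T : Matrix I I A} (h : IsFRT lt q c T) :
    leg₁ T.transpose * scal A (tr₁ (rGen lt q c)) * leg₂ T =
      leg₂ T * scal A (tr₁ (rGen lt q c)) * leg₁ T.transpose := by
  ext ⟨i, j⟩ ⟨m, l⟩
  rw [leg₁_mul_tr₁_mul_leg₂, leg₂_mul_tr₁_mul_leg₁, diagWt_comm j m]
  exact h m j i l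

/-- If `T` satisfies the FRT relations and the scalar matrix `J` the reflection equation, then
`T J Tᵗ` satisfies the reflection equation. -/
theorem IsFRT.reflElt_quadMat {T : Matrix I I A} (h : IsFRT lt q c T) {J : Matrix I I K}
    (hJ : ∀ i j m l, reflElt lt q c J i j m l = 0) (i j m l : I) :
    reflElt lt q c (quadMat T J) i j m l = 0 := by
  rw [← reflX_apply, quadMat]
  set R := scal A (rGen lt q c)
  set R' := scal A (tr₁ (rGen lt q c))
  set U := T.transpose
  have e1 : R * leg₁ T * leg₂ T = leg₂ T * leg₁ T * R := (isFRT_iff_matrix T).mp h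
  have e2 : leg₁ U * R' * leg₂ T = leg₂ T * R' * leg₁ U := h.partial_transpose
  have e3 : R * leg₁ U * leg₂ U = leg₂ U * leg₁ U * R := (isFRT_iff_matrix U).mp h.transpose
  have e4 : leg₁ T * R' * leg₂ U = leg₂ U * R' * leg₁ T := h.transpose.partial_transpose
  have e5 : R * leg₁ (scal A J) * R' * leg₂ (scal A J) =
      leg₂ (scal A J) * R' * leg₁ (scal A J) * R := by
    rw [← sub_eq_zero]
    ext ⟨i, j⟩ ⟨m, l⟩
    rw [reflX_apply]
    have := congrArg (algebraMap K A) (hJ i j m l)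
    rw [map_zero] at this
    rw [Matrix.zero_apply, ← this]
    exact (map_reflElt J (Algebra.ofId K A) i j m l).symm
  have e6 : leg₁ (scal A J) * leg₂ T = leg₂ T * leg₁ (scal A J) := leg₁_scal_comm J T
  have e7 : leg₁ (scal A J) * leg₂ U = leg₂ U * leg₁ (scal A J) := leg₁_scal_comm J U
  have e8 : leg₁ T * leg₂ (scal A J) = leg₂ (scal A J) * leg₁ T := leg₂_scal_comm J T
  have e9 : leg₁ U * leg₂ (scal A J) = leg₂ (scal A J) * leg₁ U := leg₂_scal_comm J U
  simp only [leg₁_mul, leg₂_mul]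
  generalize leg₁ T = T₁ at *
  generalize leg₂ T = T₂ at *
  generalize leg₁ U = U₁ at *
  generalize leg₂ U = U₂ at *
  generalize leg₁ (scal A J) = J₁ at *
  generalize leg₂ (scal A J) = J₂ at *
  have : R * (T₁ * J₁ * U₁) * R' * (T₂ * J₂ * U₂) =
      T₂ * J₂ * U₂ * R' * (T₁ * J₁ * U₁) * R := by
    calc R * (T₁ * J₁ * U₁) * R' * (T₂ * J₂ * U₂)
        = R * T₁ * J₁ * (U₁ * R' * T₂) * J₂ * U₂ := by simp only [Matrix.mul_assoc]
      _ = R * T₁ * (J₁ * T₂) * R' * (U₁ * J₂) * U₂ := by rw [e2]; simp only [Matrix.mul_assoc]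
      _ = (R * T₁ * T₂) * J₁ * R' * J₂ * U₁ * U₂ := by rw [e6, e9]; simp only [Matrix.mul_assoc]
      _ = T₂ * T₁ * (R * J₁ * R' * J₂) * U₁ * U₂ := by rw [e1]; simp only [Matrix.mul_assoc]
      _ = T₂ * T₁ * J₂ * R' * J₁ * (R * U₁ * U₂) := by rw [e5]; simp only [Matrix.mul_assoc]
      _ = T₂ * (T₁ * J₂) * R' * (J₁ * U₂) * U₁ * R := by rw [e3]; simp only [Matrix.mul_assoc]
      _ = T₂ * J₂ * (T₁ * R' * U₂) * J₁ * U₁ * R := by rw [e7, e8]; simp only [Matrix.mul_assoc]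
      _ = _ := by rw [e4]; simp only [Matrix.mul_assoc]
  rw [this, sub_self, Matrix.zero_apply]

end MatrixForm

/-! ### Presentations, generic quantum matrices and generic symmetric matrices -/

section BaseChange

variable {O K : Type*} [CommRing O] [CommRing K] [Algebra O K] {I : Type*}
  {lt : I → I → Prop} [DecidableRel lt] {q c : O}
variable {A : Type*} [Ring A] [Algebra O A] [Algebra K A] [IsScalarTower O K A]

theorem stepWt_algebraMap (i j : I) :
    stepWt lt (algebraMap O K c) i j = algebraMap O K (stepWt lt c i j) := by
  simp only [stepWt]; split_ifs <;> simp

variable [DecidableEq I]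

theorem diagWt_algebraMap (i j : I) :
    diagWt (algebraMap O K q) i j = algebraMap O K (diagWt q i j) := by
  simp only [diagWt]; split_ifs <;> simp

theorem isFRT_algebraMap {T : Matrix I I A} (h : IsFRT lt q c T) :
    IsFRT lt (algebraMap O K q) (algebraMap O K c) T := by
  intro i j m l
  simp only [diagWt_algebraMap, stepWt_algebraMap, algebraMap_smul]
  exact h i j m l

theorem reflElt_algebraMap (y : Matrix I I A) (i j m l : I) :
    reflElt lt (algebraMap O K q) (algebraMap O K c) y i j m l = reflElt lt q c y i j m l := by
  simp only [reflElt, reflHalf, reflHalf', diagWt_algebraMap, stepWt_algebraMap, algebraMap_smul]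

end BaseChange

section Presentation

universe u

/-- The quotient by the two-sided ideal generated by `S`, as a homomorphism of algebras. -/
def spanQuot {K A : Type*} [Field K] [Ring A] [Algebra K A] (S : Set A) :
    A →ₐ[K] (TwoSidedIdeal.span S).ringCon.Quotient :=
  { (TwoSidedIdeal.span S).ringCon.mk' with commutes' := fun _ => rfl }

theorem spanQuot_eq_zero_iff {K A : Type*} [Field K] [Ring A] [Algebra K A] {S : Set A} {v : A} :
    spanQuot (K := K) S v = 0 ↔ v ∈ TwoSidedIdeal.span S := by
  rw [TwoSidedIdeal.mem_iff, ← map_zero (spanQuot (K := K) S)]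
  exact RingCon.eq _

/-- To prove a presentation, it suffices to show in every quotient `C` of the free algebra that
lies between the presented algebra and the algebra generated by the `x_ij` that the relations
between the `x_ij` hold. -/
theorem presentedBy_of {K A I : Type u} [Field K] [Ring A] [Algebra K A] (x : Matrix I I A)
    (S : Set (FreeAlgebra K (I × I)))
    (hS : ∀ s ∈ S, FreeAlgebra.lift K (fun p : I × I => x p.1 p.2) s = 0)
    (h : ∀ (C : Type u) [Ring C] [Algebra K C] (g : FreeAlgebra K (I × I) →ₐ[K] C),
      Function.Surjective g → (∀ s ∈ S, g s = 0) →
      (∀ u, g u = 0 → FreeAlgebra.lift K (fun p : I × I => x p.1 p.2) u = 0) →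
      ∀ u, FreeAlgebra.lift K (fun p : I × I => x p.1 p.2) u = 0 → g u = 0) :
    PresentedBy x S := by
  set L := FreeAlgebra.lift K fun p : I × I => x p.1 p.2 with hL
  let φ : FreeAlgebra K (I × I) →ₐ[K] genAlg K x :=
    FreeAlgebra.lift K fun p : I × I => gen K x p.1 p.2
  have hφ : (genAlg K x).val.comp φ = L := by
    ext p
    simp [φ, hL, gen]
  have hφ' : ∀ u, φ u = 0 ↔ L u = 0 := by
    intro u
    rw [← hφ, AlgHom.comp_apply, Subalgebra.coe_val, ZeroMemClass.coe_eq_zero]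
  refine ⟨φ, fun i j => by simp [φ, gen], ?_, le_antisymm ?_ ?_⟩
  · rintro ⟨a, ha⟩
    have : (genAlg K x) ≤ L.range := by
      refine Algebra.adjoin_le ?_
      rintro _ ⟨i, j, rfl⟩
      exact ⟨FreeAlgebra.ι K (i, j), by simp [hL]⟩
    obtain ⟨u, hu⟩ := this ha
    refine ⟨u, Subtype.ext ?_⟩
    rw [← hφ] at hu
    exact hu
  · intro u hu
    rw [TwoSidedIdeal.mem_ker, hφ'] at hu
    refine spanQuot_eq_zero_iff.mp (h _ (spanQuot S) (RingCon.mk'_surjective _)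
      (fun s hs => spanQuot_eq_zero_iff.mpr (TwoSidedIdeal.subset_span hs)) (fun v hv => ?_) u hu)
    have hle : TwoSidedIdeal.span S ≤ TwoSidedIdeal.ker L :=
      TwoSidedIdeal.span_le.mpr fun s hs => (TwoSidedIdeal.mem_ker L).mpr (hS s hs)
    exact (TwoSidedIdeal.mem_ker L).mp (hle (spanQuot_eq_zero_iff.mp hv))
  · exact TwoSidedIdeal.span_le.mpr fun s hs =>
      (TwoSidedIdeal.mem_ker φ).mpr ((hφ' s).mpr (hS s hs))

end Presentation

section Universal

universe u

/-- `T` is the generic quantum matrix: `B` is the quantized function algebra on matrices attached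
to the order `lt`, and the entries of `T` are its generators. -/
structure IsGenericFRT {K I B : Type u} [Field K] [DecidableEq I] [Ring B] [Algebra K B]
    (lt : I → I → Prop) [DecidableRel lt] (q c : K) (T : Matrix I I B) : Prop where
  isFRT : IsFRT lt q c T
  lift : ∀ (C : Type u) [Ring C] [Algebra K C] (U : Matrix I I C), IsFRT lt q c U →
    ∃ f : B →ₐ[K] C, T.map f = U
  adjoin : Algebra.adjoin K (entrySet T) = ⊤

end Universal

section Generic

universe u

variable {I : Type u} [DecidableEq I] (lt : I → I → Prop) [DecidableRel lt]

/-- The letters of a polynomial algebra of functions on matrices that are symmetric (if `D` holds)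
or alternating (if `D` fails). -/
abbrev Letter (D : Prop) : Type u := {p : I × I // lt p.1 p.2 ∨ (p.1 = p.2 ∧ D)}

variable {D : Prop} [Decidable D] {F : Type u} [Field F]

open MvPolynomial in
/-- The generic matrix `Z` with `Zᵗ = σ Z`. -/
noncomputable def genericMat (D : Prop) [Decidable D] (σ : F) :
    Matrix I I (MvPolynomial (Letter lt D) F) :=
  Matrix.of fun i j =>
    if h : lt i j ∨ (i = j ∧ D) then X ⟨(i, j), h⟩
    else if h : lt j i then σ • X ⟨(j, i), Or.inl h⟩ else 0

variable {lt} {σ : F}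

theorem genericMat_transpose [IsStrictTotalOrder I lt] (hσ : σ * σ = 1) (hD : D → σ = 1) :
    (genericMat lt D σ).transpose = σ • genericMat lt D σ := by
  have hirr : ∀ i, ¬ lt i i := fun i => irrefl i
  ext1 i j
  rw [Matrix.transpose_apply, Matrix.smul_apply]
  rcases trichotomous_of lt i j with h | rfl | h
  · have hne : j ≠ i := fun e => hirr _ (e ▸ h)
    simp [genericMat, h, asymm h, hne]
  · by_cases hd : D
    · simp [hD hd]
    · simp [genericMat, hd, hirr]
  · have hne : i ≠ j := fun e => hirr _ (e ▸ h)
    simp [genericMat, h, asymm h, hne, smul_smul, hσ]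

theorem genericMat_mem (i j : I) :
    genericMat lt D σ i j ∈ MvPolynomial.idealOfVars (Letter lt D) F := by
  simp only [genericMat, Matrix.of_apply]
  split_ifs
  · exact Ideal.subset_span ⟨_, rfl⟩
  · exact Submodule.smul_of_tower_mem _ _ (Ideal.subset_span ⟨_, rfl⟩)
  · exact zero_mem _

/-- If `Jᵗ = σ J` and `Zᵗ = σ Z`, then `T = 1 + Z J⁻¹` satisfies `T J Tᵗ = J + 2 Z + Z J⁻¹ Z`. -/
theorem one_add_mul_mul_transpose [Fintype I] {P : Type*} [CommRing P] {J J' Z : Matrix I I P}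
    {s : P}
    (hs : s * s = 1) (hJJ' : J * J' = 1) (hJ : J.transpose = s • J) (hZ : Z.transpose = s • Z) :
    (1 + Z * J') * J * (1 + Z * J').transpose = J + (Z + Z) + Z * J' * Z := by
  have hJ'J : J' * J = 1 := mul_eq_one_comm.mp hJJ'
  have hJ' : J'.transpose = s • J' := by
    have h1 : J'.transpose * J.transpose = 1 := by
      rw [← Matrix.transpose_mul, hJJ', Matrix.transpose_one]
    calc J'.transpose = J'.transpose * (J.transpose * (s • J')) := by
          simp only [hJ, Matrix.smul_mul, Matrix.mul_smul, smul_smul, hs, one_smul, hJJ', mul_one]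
      _ = s • J' := by rw [← mul_assoc, h1, one_mul]
  have hZJ : (Z * J').transpose = J' * Z := by
    rw [Matrix.transpose_mul, hJ', hZ, Matrix.smul_mul, Matrix.mul_smul, smul_smul, hs, one_smul]
  rw [Matrix.transpose_add, Matrix.transpose_one, hZJ]
  have h1 : Z * J' * J = Z := by rw [mul_assoc, hJ'J, mul_one]
  have h2 : J * (J' * Z) = Z := by rw [← mul_assoc, hJJ', one_mul]
  rw [add_mul, one_mul, h1, mul_add, mul_one, add_mul, h2, ← mul_assoc]
  abel

/-- The entries of `T J Tᵗ`, for `T = 1 + Z J⁻¹` and the generic (skew-)symmetric matrix `Z`, are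
algebraically independent. -/
theorem algebraicIndependent_quad [Fintype I] [IsStrictTotalOrder I lt] (h2 : (2 : F) ≠ 0)
    {J J' : Matrix I I F}
    (hσ : σ * σ = 1) (hD : D → σ = 1) (hJJ' : J * J' = 1) (hJ : J.transpose = σ • J) :
    ∃ T : Matrix I I (MvPolynomial (Letter lt D) F),
      AlgebraicIndependent F fun p : Letter lt D =>
        (T * J.map MvPolynomial.C * T.transpose : Matrix I I (MvPolynomial (Letter lt D) F))
          p.1.1 p.1.2 := by
  set Z := genericMat lt D σ
  refine ⟨1 + Z * J'.map MvPolynomial.C, ?_⟩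
  have hP : J.map MvPolynomial.C * J'.map MvPolynomial.C =
      (1 : Matrix I I (MvPolynomial (Letter lt D) F)) := by
    rw [← Matrix.map_mul, hJJ', Matrix.map_one _ (map_zero _) (map_one _)]
  have hPJ : (J.map MvPolynomial.C).transpose =
      (MvPolynomial.C σ : MvPolynomial (Letter lt D) F) •
        (J.map MvPolynomial.C : Matrix I I (MvPolynomial (Letter lt D) F)) := by
    rw [← Matrix.transpose_map, hJ]
    ext1 i j
    simp
  have hPZ : Z.transpose = (MvPolynomial.C σ : MvPolynomial (Letter lt D) F) • Z := by
    rw [genericMat_transpose hσ hD]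
    ext1 i j
    simp [MvPolynomial.smul_eq_C_mul, Z]
  rw [one_add_mul_mul_transpose (by rw [← MvPolynomial.C_mul, hσ, MvPolynomial.C_1]) hP hPJ hPZ]
  have := algebraicIndependent_affine_add (Λ := Letter lt D) h2 (fun p => J p.1.1 p.1.2)
    (fun p => (Z * J'.map MvPolynomial.C * Z : Matrix I I (MvPolynomial (Letter lt D) F))
      p.1.1 p.1.2) ?_
  · convert this using 2 with p
    have hp : Z p.1.1 p.1.2 = MvPolynomial.X p := by
      simp only [Z, genericMat, Matrix.of_apply]
      rw [dif_pos p.2]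
    simp [hp, two_mul]
  · intro p
    rw [Matrix.mul_apply]
    refine sum_mem fun a _ => ?_
    rw [pow_two]
    refine Ideal.mul_mem_mul ?_ (genericMat_mem a _)
    rw [Matrix.mul_apply]
    exact sum_mem fun b _ => Ideal.mul_mem_right _ _ (genericMat_mem _ b)

end Generic

/-! ### Degeneration to commuting variables -/

section Flatness

universe u

variable {K O I : Type u} [Field K] [CommRing O] [Algebra O K] [DecidableEq I]
  {lt : I → I → Prop} [DecidableRel lt] {q c : O} {B : Type u} [Ring B] [Algebra K B]
  {T : Matrix I I B}

/-- Modulo the maximal ideal, the reflection equation says that the generators commute. -/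
theorem commutator_mem_of_reflElt [IsLocalRing O] {A : Type*} [Ring A] [Algebra O A]
    (hq1 : q - 1 ∈ IsLocalRing.maximalIdeal O) (hc : c ∈ IsLocalRing.maximalIdeal O)
    (y : Matrix I I A) (P : Submodule O A) (hP : ∀ i j, y i j ∈ P) (i j m l : I)
    (h : reflElt lt q c y i j m l = 0) :
    y i m * y j l - y j l * y i m ∈ IsLocalRing.maximalIdeal O • P ^ 2 := by
  set 𝔪 := IsLocalRing.maximalIdeal O
  have hPP : ∀ {a b d e}, y a b * y d e ∈ P ^ 2 := fun {a b d e} =>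
    pow_two P ▸ Submodule.mul_mem_mul (hP a b) (hP d e)
  have hw : ∀ a b : I, diagWt q a b - 1 ∈ 𝔪 := by
    intro a b
    simp only [diagWt]; split_ifs
    exacts [hq1, by simp]
  have hs : ∀ a b : I, stepWt lt c a b ∈ 𝔪 := by
    intro a b
    simp only [stepWt]; split_ifs
    exacts [hc, zero_mem _]
  have hww : ∀ a b d e : I, diagWt q a b * diagWt q d e - 1 ∈ 𝔪 := by
    intro a b d e
    have : diagWt q a b * diagWt q d e - 1 =
        diagWt q a b * (diagWt q d e - 1) + (diagWt q a b - 1) := by ring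
    rw [this]
    exact add_mem (Ideal.mul_mem_left _ _ (hw _ _)) (hw _ _)
  have key : y i m * y j l - y j l * y i m =
      -(diagWt q i j * diagWt q j m - 1) • (y i m * y j l) +
      (diagWt q m l * diagWt q i l - 1) • (y j l * y i m) -
      (diagWt q i j * stepWt lt c j m) • (y i j * y m l) -
      stepWt lt c j i • reflHalf lt q c y j i m l +
      (diagWt q m l * stepWt lt c i l) • (y j i * y l m) +
      stepWt lt c m l • reflHalf' lt q c y i j l m := by
    rw [← sub_eq_zero, ← h, reflElt]
    have e1 : reflHalf lt q c y i j m l =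
      diagWt q j m • (y i m * y j l) + stepWt lt c j m • (y i j * y m l) := rfl
    have e2 : reflHalf' lt q c y i j m l =
      diagWt q i l • (y j l * y i m) + stepWt lt c i l • (y j i * y l m) := rfl
    rw [e1, e2]
    module
  rw [key]
  have hm : ∀ {r : O} {z : A}, r ∈ 𝔪 → z ∈ P ^ 2 → r • z ∈ 𝔪 • P ^ 2 :=
    fun hr hz => Submodule.smul_mem_smul hr hz
  refine add_mem (add_mem (sub_mem (sub_mem (add_mem ?_ ?_) ?_) ?_) ?_) ?_
  · exact hm (neg_mem (hww _ _ _ _)) hPP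
  · exact hm (hww _ _ _ _) hPP
  · exact hm (Ideal.mul_mem_left _ _ (hs _ _)) hPP
  · exact hm (hs _ _) (add_mem (Submodule.smul_mem _ _ hPP) (Submodule.smul_mem _ _ hPP))
  · exact hm (Ideal.mul_mem_left _ _ (hs _ _)) hPP
  · exact hm (hs _ _) (add_mem (Submodule.smul_mem _ _ hPP) (Submodule.smul_mem _ _ hPP))

theorem not_isUnit_of_linearIndependent {O F P Λ : Type*} [CommRing O] [Field F] [Algebra O F]
    [CommRing P] [Algebra F P] [Algebra O P] [IsScalarTower O F P] {w : Λ → P}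
    (hw : LinearIndependent F w) (s : Finset Λ) (a : Λ → O) (h : ∑ m ∈ s, a m • w m = 0) :
    ∀ m ∈ s, ¬ IsUnit (a m) := by
  intro m hm hunit
  have h4 := linearIndependent_iff'.mp hw s (fun m => algebraMap O F (a m))
    (by simpa only [algebraMap_smul] using h) m hm
  exact (hunit.map (algebraMap O F)).ne_zero h4

variable [Fintype I] [IsFractionRing O K]

/-- A linear relation with coefficients in `O` between monomials in the entries of `T J Tᵗ`
specializes to a relation between the entries of `T₀ J T₀ᵗ` if `T₀` can be quantized. -/
theorem IsQuantizable.sum_prod_eq_zero {S : Type u} [CommRing S] [Algebra O S]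
    {T₀ : Matrix I I S} (h₀ : IsQuantizable lt q c T₀)
    (hT : IsGenericFRT lt (algebraMap O K q) (algebraMap O K c) T) (J : Matrix I I O)
    {Λ : Type*} (e : Λ → I × I) (s : Finset (Multiset Λ)) (a : Multiset Λ → O)
    (h : ∑ m ∈ s, algebraMap O K (a m) •
      sortedWord (fun p => quadMat T (J.map (algebraMap O K)) (e p).1 (e p).2) m = 0) :
    ∑ m ∈ s, a m • (m.map fun p => (T₀ * J.map (algebraMap O S) * T₀.transpose : Matrix I I S)
      (e p).1 (e p).2).prod = 0 := by
  obtain ⟨C, _, _, _, ε, U, hU, rfl⟩ := h₀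
  let ι : C →ₐ[O] K ⊗[O] C := Algebra.TensorProduct.includeRight
  have hι : Function.Injective ι :=
    Algebra.TensorProduct.includeRight_injective (IsFractionRing.injective O K)
  obtain ⟨f, hf⟩ := hT.lift (K ⊗[O] C) (U.map ι) (isFRT_algebraMap (hU.map ι))
  have hf' : ∀ i j, f (T i j) = ι (U i j) := fun i j => congrFun (congrFun hf i) j
  set X : Matrix I I C := U * J.map (algebraMap O C) * U.transpose with hX
  have hfX : ∀ i j, f (quadMat T (J.map (algebraMap O K)) i j) = ι (X i j) := by
    intro i j
    simp only [quadMat, scal, hX, Matrix.mul_apply, Matrix.map_apply, Matrix.transpose_apply,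
      map_sum, map_mul, AlgHom.commutes, ← IsScalarTower.algebraMap_apply, hf']
  have hεX : ∀ i j, ε (X i j) =
      (U.map ε * J.map (algebraMap O S) * (U.map ε).transpose : Matrix I I S) i j := by
    intro i j
    simp only [hX, Matrix.mul_apply, Matrix.map_apply, Matrix.transpose_apply, map_sum, map_mul,
      AlgHom.commutes]
  have h1 : ∑ m ∈ s, a m • sortedWord (fun p => X (e p).1 (e p).2) m = 0 := by
    apply hι
    rw [map_zero, ← map_zero f, ← h, map_sum, map_sum]
    refine Finset.sum_congr rfl fun m _ => ?_
    simp only [map_smul, map_sortedWord, algebraMap_smul, hfX]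
  rw [← map_zero ε, ← h1, map_sum]
  refine Finset.sum_congr rfl fun m _ => ?_
  rw [map_smul, map_sortedWord]
  congr 1
  rw [sortedWord, ← Multiset.prod_coe, ← Multiset.map_coe, Multiset.coe_toList]
  simp only [hεX]

variable [IsDomain O] [ValuationRing O] [IsStrictTotalOrder I lt]

theorem isQuantizable_of_isDomain {P : Type u} [CommRing P] [IsDomain P] [Algebra O P]
    (hq : q * (q - c) = 1) (hq1 : algebraMap O P q = 1) (T₁ : Matrix I I P) :
    IsQuantizable lt q c (T₁.map (algebraMap P (FractionRing P))) :=
  isQuantizable_of_field hq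
    (by rw [IsScalarTower.algebraMap_apply O P (FractionRing P), hq1, map_one]) _

/-- Over a domain every matrix will do, since it is quantizable over the fraction field. -/
theorem sum_prod_eq_zero_of_isDomain {P : Type u} [CommRing P] [IsDomain P] [Algebra O P]
    (hq : q * (q - c) = 1) (hq1 : algebraMap O P q = 1) (T₁ : Matrix I I P)
    (hT : IsGenericFRT lt (algebraMap O K q) (algebraMap O K c) T) (J : Matrix I I O)
    {Λ : Type*} (e : Λ → I × I) (s : Finset (Multiset Λ)) (a : Multiset Λ → O)
    (h : ∑ m ∈ s, algebraMap O K (a m) •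
      sortedWord (fun p => quadMat T (J.map (algebraMap O K)) (e p).1 (e p).2) m = 0) :
    ∑ m ∈ s, a m • (m.map fun p => (T₁ * J.map (algebraMap O P) * T₁.transpose : Matrix I I P)
      (e p).1 (e p).2).prod = 0 := by
  have h1 := (isQuantizable_of_isDomain hq hq1 T₁).sum_prod_eq_zero hT J e s a h
  apply IsFractionRing.injective P (FractionRing P)
  rw [map_zero, ← h1, map_sum]
  refine Finset.sum_congr rfl fun m _ => ?_
  rw [Algebra.smul_def, Algebra.smul_def, map_mul,
    ← IsScalarTower.algebraMap_apply O P (FractionRing P), map_multiset_prod, Multiset.map_map]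
  congr 2
  refine Multiset.map_congr rfl fun p _ => ?_
  simp only [Function.comp_apply, Matrix.mul_apply, Matrix.map_apply, Matrix.transpose_apply,
    map_sum, map_mul, ← IsScalarTower.algebraMap_apply O P (FractionRing P)]

/-- The ordered monomials in the entries of `T J Tᵗ` are linearly independent, because this holds
after specialization of `T` to a suitable commutative matrix at `q = 1`. -/
theorem linearIndependent_sortedWord_quadMat (D : Prop) [Decidable D] {F : Type u} [Field F]
    [Algebra O F]
    (hT : IsGenericFRT lt (algebraMap O K q) (algebraMap O K c) T) (hq : q * (q - c) = 1)
    (hq1 : algebraMap O F q = 1) (h2 : (2 : F) ≠ 0) {J : Matrix I I O} {σ : F} {J' : Matrix I I F}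
    (hσ : σ * σ = 1) (hD : D → σ = 1) (hJJ' : J.map (algebraMap O F) * J' = 1)
    (hJ : (J.map (algebraMap O F)).transpose = σ • J.map (algebraMap O F)) :
    LinearIndependent K (sortedWord fun p : Letter lt D =>
      quadMat T (J.map (algebraMap O K)) p.1.1 p.1.2) := by
  obtain ⟨T₁, hT₁⟩ := algebraicIndependent_quad (lt := lt) (D := D) h2 hσ hD hJJ' hJ
  have hq1' : algebraMap O (MvPolynomial (Letter lt D) F) q = 1 := by
    rw [IsScalarTower.algebraMap_apply O F, hq1, map_one]
  have hJP : (J.map (algebraMap O F)).map MvPolynomial.C =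
      J.map (algebraMap O (MvPolynomial (Letter lt D) F)) := by
    ext1 i j
    simp only [Matrix.map_apply]
    rw [IsScalarTower.algebraMap_apply O F (MvPolynomial (Letter lt D) F),
      MvPolynomial.algebraMap_eq]
  rw [hJP] at hT₁
  refine linearIndependent_of_integral (O := O) _ fun s a ha m hm hunit => ?_
  have h3 := sum_prod_eq_zero_of_isDomain hq hq1' T₁ hT J (fun p : Letter lt D => p.1) s a ha
  exact not_isUnit_of_linearIndependent (linearIndependent_prod_of_algebraicIndependent hT₁) s a h3
    m hm hunit

/-- The presentation of the algebra generated by the entries of `T J Tᵗ`: any set `R` of relations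
suffices that implies the reflection equation and makes the generators with `lt i j`, together with
those with `i = j` if `D` holds, span the linear part. -/
theorem presentedBy_quadMat (D : Prop) [Decidable D] {F : Type u} [Field F] [Algebra O F]
    (hT : IsGenericFRT lt (algebraMap O K q) (algebraMap O K c) T) (hq : q * (q - c) = 1)
    (hq1 : algebraMap O F q = 1) (h2 : (2 : F) ≠ 0) {J : Matrix I I O} {σ : F} {J' : Matrix I I F}
    (hσ : σ * σ = 1) (hD : D → σ = 1) (hJJ' : J.map (algebraMap O F) * J' = 1)
    (hJ : (J.map (algebraMap O F)).transpose = σ • J.map (algebraMap O F))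
    (R : Set (FreeAlgebra K (I × I)))
    (hR : ∀ s ∈ R, FreeAlgebra.lift K
      (fun p : I × I => quadMat T (J.map (algebraMap O K)) p.1 p.2) s = 0)
    (u : O)
    (hlin : ∀ (C : Type u) [Ring C] [Algebra K C] (y : Matrix I I C),
      (∀ s ∈ R, FreeAlgebra.lift K (fun p : I × I => y p.1 p.2) s = 0) →
      (∀ i j, lt i j → y j i = algebraMap O K u • y i j) ∧ (¬ D → ∀ i, y i i = 0) ∧
      ∀ i j m l, reflElt lt (algebraMap O K q) (algebraMap O K c) y i j m l = 0) :
    PresentedBy (quadMat T (J.map (algebraMap O K))) R := by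
  refine presentedBy_of _ _ hR fun C _ _ g hg hgR hker w hw => ?_
  have hm : ∀ r : O, algebraMap O F r = 0 → r ∈ IsLocalRing.maximalIdeal O := fun r hr =>
    (IsLocalRing.mem_maximalIdeal r).mpr fun hu => (hu.map (algebraMap O F)).ne_zero hr
  have hq1m : q - 1 ∈ IsLocalRing.maximalIdeal O := hm _ (by rw [map_sub, hq1, map_one, sub_self])
  have hcm : c ∈ IsLocalRing.maximalIdeal O := hm _ (by
    have := congrArg (algebraMap O F) hq
    rw [map_mul, map_sub, hq1, one_mul, map_one] at this
    linear_combination -this)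
  let _ : Algebra O C := Algebra.compHom C (algebraMap O K)
  have : IsScalarTower O K C := IsScalarTower.of_algebraMap_eq fun _ => rfl
  set y : Matrix I I C := Matrix.of fun i j => g (FreeAlgebra.ι K (i, j)) with hy
  have hgy : FreeAlgebra.lift K (fun p : I × I => y p.1 p.2) = g := by
    ext p
    simp [hy]
  obtain ⟨hy1, hy2, hy3⟩ := hlin C y fun s hs => by rw [hgy]; exact hgR s hs
  let v : Letter lt D → C := fun p => y p.1.1 p.1.2
  have hP : ∀ i j, y i j ∈ Submodule.span O (Set.range v) := by
    intro i j
    by_cases hd : lt i j ∨ (i = j ∧ D)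
    · exact Submodule.subset_span ⟨⟨(i, j), hd⟩, rfl⟩
    · push Not at hd
      rcases trichotomous_of lt i j with h | rfl | h
      · exact absurd h hd.1
      · rw [hy2 (hd.2 rfl) i]; exact zero_mem _
      · rw [hy1 j i h, algebraMap_smul]
        exact Submodule.smul_mem _ _ (Submodule.subset_span ⟨⟨(j, i), Or.inl h⟩, rfl⟩)
  have hgen : Algebra.adjoin K (Set.range v) = ⊤ := by
    rw [eq_top_iff]
    rintro x -
    obtain ⟨z, rfl⟩ := hg x
    have hle : g.range ≤ Algebra.adjoin K (Set.range v) := by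
      rw [← Algebra.map_top, ← FreeAlgebra.adjoin_range_ι, AlgHom.map_adjoin]
      refine Algebra.adjoin_le ?_
      rintro _ ⟨_, ⟨p, rfl⟩, rfl⟩
      have h1 : Submodule.span O (Set.range v) ≤
          (Submodule.span K (Set.range v)).restrictScalars O :=
        Submodule.span_le_restrictScalars O K _
      exact Algebra.span_le_adjoin K _ (h1 (hP p.1 p.2))
    exact hle ⟨z, rfl⟩
  have hcomm : ∀ i j m l, reflElt lt q c y i j m l = 0 := fun i j m l => by
    rw [← reflElt_algebraMap (K := K)]; exact hy3 i j m l
  have hspan := span_sortedWord_eq_top K v (fun a b => commutator_mem_of_reflElt hq1m hcm y _ hP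
    a.1.1 b.1.1 a.1.2 b.1.2 (hcomm _ _ _ _)) hgen
  have hmem : g w ∈ Submodule.span K (Set.range (sortedWord v)) := hspan ▸ Submodule.mem_top
  obtain ⟨a, ha⟩ := Finsupp.mem_span_range_iff_exists_finsupp.mp hmem
  -- lift the expression of `g w` through ordered monomials to the free algebra
  let ι' : Letter lt D → FreeAlgebra K (I × I) := fun p => FreeAlgebra.ι K p.1
  have h1 : g (w - a.sum fun m r => r • sortedWord ι' m) = 0 := by
    rw [map_sub, map_finsuppSum, ← ha, sub_eq_zero]
    refine Finsupp.sum_congr fun m _ => ?_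
    rw [map_smul, map_sortedWord]
    rfl
  have h5 := hker _ h1
  rw [map_sub, hw, zero_sub, neg_eq_zero, map_finsuppSum] at h5
  have hli := linearIndependent_sortedWord_quadMat D hT hq hq1 h2 hσ hD hJJ' hJ
  have ha0 : a = 0 := by
    rw [linearIndependent_iff] at hli
    apply hli
    rw [Finsupp.linearCombination_apply, ← h5]
    refine Finsupp.sum_congr fun m _ => ?_
    rw [map_smul, map_sortedWord]
    simp [ι']
  rw [← ha, ha0, Finsupp.sum_zero_index]

end Flatness

/-! ### The diagonal type -/

section Block

variable {k : Type*} [CommRing k] {I : Type*} {lt : I → I → Prop} [DecidableRel lt]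
variable {q c : k} {A : Type*} [Ring A] [Algebra k A]

/-- `y` has zero diagonal blocks, and its off-diagonal blocks are transposes of each other. -/
structure IsBlockSymm (y : Matrix (I ⊕ I) (I ⊕ I) A) : Prop where
  symm : ∀ i j, y (Sum.inr j) (Sum.inl i) = y (Sum.inl i) (Sum.inr j)
  inl : ∀ i j, y (Sum.inl i) (Sum.inl j) = 0
  inr : ∀ i j, y (Sum.inr i) (Sum.inr j) = 0

/-- The upper right block. -/
def upperRight (y : Matrix (I ⊕ I) (I ⊕ I) A) : Matrix I I A :=
  Matrix.of fun i j => y (Sum.inl i) (Sum.inr j)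

theorem stepWt_inl (i j : I) :
    stepWt (Sum.LiftRel lt lt) c (Sum.inl i) (Sum.inl j) = stepWt lt c i j := by
  simp [stepWt]

theorem stepWt_inr (i j : I) :
    stepWt (Sum.LiftRel lt lt) c (Sum.inr i) (Sum.inr j) = stepWt lt c i j := by
  simp [stepWt]

theorem stepWt_inl_inr (i j : I) :
    stepWt (Sum.LiftRel lt lt) c (Sum.inl i) (Sum.inr j) = 0 := by
  simp [stepWt]

theorem stepWt_inr_inl (i j : I) :
    stepWt (Sum.LiftRel lt lt) c (Sum.inr i) (Sum.inl j) = 0 := by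
  simp [stepWt]

variable [DecidableEq I]

theorem diagWt_inl (i j : I) : diagWt q (Sum.inl i : I ⊕ I) (Sum.inl j) = diagWt q i j := by
  simp [diagWt]

theorem diagWt_inr (i j : I) : diagWt q (Sum.inr i : I ⊕ I) (Sum.inr j) = diagWt q i j := by
  simp [diagWt]

theorem diagWt_inl_inr (i j : I) : diagWt q (Sum.inl i : I ⊕ I) (Sum.inr j) = 1 := by
  simp [diagWt]

theorem diagWt_inr_inl (i j : I) : diagWt q (Sum.inr i : I ⊕ I) (Sum.inl j) = 1 := by
  simp [diagWt]

/-- For a block symmetric matrix, the reflection equation of the block R-matrix is equivalent to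
the FRT relations for the upper right block. -/
theorem IsBlockSymm.reflElt_iff {y : Matrix (I ⊕ I) (I ⊕ I) A} (h : IsBlockSymm y) :
    (∀ i j m l, reflElt (Sum.LiftRel lt lt) q c y i j m l = 0) ↔
      IsFRT lt q c (upperRight y) := by
  refine ⟨fun hy i j m l => ?_, fun hy i j m l => ?_⟩
  · have := hy (Sum.inl i) (Sum.inl j) (Sum.inr m) (Sum.inr l)
    simpa [reflElt, reflHalf, reflHalf', diagWt_inl, diagWt_inr, diagWt_inl_inr, stepWt_inl,
      stepWt_inr, stepWt_inl_inr, h.inl, h.inr, sub_eq_zero, upperRight] using this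
  · simp only [IsFRT, upperRight, Matrix.of_apply] at hy
    rcases i with i | i <;> rcases j with j | j <;> rcases m with m | m <;> rcases l with l | l <;>
      simp only [reflElt, reflHalf, reflHalf', diagWt_inl, diagWt_inr, diagWt_inl_inr,
        diagWt_inr_inl, stepWt_inl, stepWt_inr, stepWt_inl_inr, stepWt_inr_inl, h.inl, h.inr,
        h.symm, mul_zero, zero_mul, smul_zero, zero_smul, add_zero, one_smul, sub_self,
        sub_eq_zero]
    · exact hy i j m l
    · have := (hy l i j m).symm
      rwa [diagWt_comm l i] at this
    · have := hy m j i l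
      rwa [diagWt_comm m j] at this
    · have := (hy l m j i).symm
      rwa [diagWt_comm l m, diagWt_comm j i] at this

end Block

section DiagonalType

universe u

variable {K I B : Type u} [Field K] [Fintype I] [DecidableEq I] {lt : I → I → Prop}
  [DecidableRel lt] {q c : K} [Ring B] [Algebra K B] {T : Matrix I I B}

/-- The block diagonal matrix `T ⊗ 1 ⊕ 1 ⊗ T`. -/
def diagBlocks (K : Type*) [Field K] {I B : Type*} [Ring B] [Algebra K B] (T : Matrix I I B) :
    Matrix (I ⊕ I) (I ⊕ I) (B ⊗[K] B) :=
  Matrix.fromBlocks (T.map fun t => t ⊗ₜ[K] (1 : B)) 0 0 (T.map fun t => (1 : B) ⊗ₜ[K] t)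

/-- The block antidiagonal matrix with both blocks `diag(a)`. -/
def antidiagBlocks (a : I → K) : Matrix (I ⊕ I) (I ⊕ I) K :=
  Matrix.fromBlocks 0 (Matrix.diagonal a) (Matrix.diagonal a) 0

theorem quadMat_diagBlocks (a : I → K) : quadMat (diagBlocks K T) (antidiagBlocks a) =
    Matrix.fromBlocks 0 (Matrix.of fun i j => ∑ k, a k • (T i k ⊗ₜ[K] T j k))
      (Matrix.of fun i j => ∑ k, a k • (T j k ⊗ₜ[K] T i k)) 0 := by
  have h : scal (B ⊗[K] B) (antidiagBlocks a) =
      Matrix.fromBlocks 0 (Matrix.diagonal fun i => algebraMap K (B ⊗[K] B) (a i))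
        (Matrix.diagonal fun i => algebraMap K (B ⊗[K] B) (a i)) 0 := by
    simp [scal, antidiagBlocks, Matrix.fromBlocks_map, Matrix.diagonal_map]
  rw [quadMat, h, diagBlocks, Matrix.fromBlocks_transpose, Matrix.fromBlocks_multiply,
    Matrix.fromBlocks_multiply]
  simp only [Matrix.mul_zero, Matrix.zero_mul, zero_add, add_zero, Matrix.transpose_zero]
  congr 1 <;>
  · ext i j
    rw [Matrix.mul_apply]
    refine Finset.sum_congr rfl fun k _ => ?_
    rw [Matrix.mul_diagonal, ← Algebra.commutes, ← Algebra.smul_def, smul_mul_assoc]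
    simp

theorem isBlockSymm_quadMat_diagBlocks (a : I → K) :
    IsBlockSymm (quadMat (diagBlocks K T) (antidiagBlocks a)) := by
  rw [quadMat_diagBlocks]
  exact ⟨fun i j => by simp, fun i j => by simp, fun i j => by simp⟩

theorem isFRT_upperRight_quadMat_diagBlocks (hT : IsFRT lt q c T) (a : I → K) :
    IsFRT lt q c (upperRight (quadMat (diagBlocks K T) (antidiagBlocks a))) := by
  have h1 : IsFRT lt q c (T.map (Algebra.TensorProduct.includeLeft : B →ₐ[K] B ⊗[K] B)) :=
    hT.map _
  have h2 : IsFRT lt q c (Matrix.diagonal fun i => algebraMap K (B ⊗[K] B) (a i)) :=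
    isFRT_diagonal fun _ _ => Algebra.commutes _ _
  have h3 : IsFRT lt q c
      (T.map (Algebra.TensorProduct.includeRight : B →ₐ[K] B ⊗[K] B)).transpose :=
    (hT.map _).transpose
  have h4 := (h1.mul h2 fun i j m l => ?_).mul h3 fun i j m l => ?_
  · convert h4 using 1
    rw [quadMat_diagBlocks]
    ext i j
    rw [Matrix.mul_apply]
    refine Finset.sum_congr rfl fun k _ => ?_
    rw [Matrix.mul_diagonal, ← Algebra.commutes, ← Algebra.smul_def, smul_mul_assoc]
    simp
  · simp only [Matrix.diagonal_apply]
    split_ifs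
    exacts [(Algebra.commutes _ _).symm, Commute.zero_right _]
  · rw [Matrix.mul_diagonal]
    refine Commute.mul_left ?_ (Algebra.commutes _ _)
    simp [Commute, SemiconjBy]

/-- The counit of the second factor, twisted by `a⁻¹`, maps `x_{i, n+j}` to `t_ij`. -/
theorem exists_counit (hT : IsGenericFRT lt q c T) {a : I → K} (ha : ∀ i, a i ≠ 0) :
    ∃ η : B ⊗[K] B →ₐ[K] B,
      ∀ i j, η (upperRight (quadMat (diagBlocks K T) (antidiagBlocks a)) i j) = T i j := by
  obtain ⟨θ, hθ⟩ := hT.lift K (Matrix.diagonal fun i => (a i)⁻¹)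
    (isFRT_diagonal fun _ _ => Commute.all _ _)
  have hθ' : ∀ i j, θ (T i j) = (Matrix.diagonal fun i => (a i)⁻¹) i j := fun i j =>
    congrFun (congrFun hθ i) j
  have hcomm : ∀ x y, Commute (AlgHom.id K B x) ((Algebra.ofId K B).comp θ y) := fun x y =>
    (Algebra.commutes (θ y) x).symm
  refine ⟨Algebra.TensorProduct.lift (AlgHom.id K B) ((Algebra.ofId K B).comp θ) hcomm,
    fun i j => ?_⟩
  rw [quadMat_diagBlocks]
  simp only [upperRight, Matrix.of_apply, Matrix.fromBlocks_apply₁₂, map_sum, map_smul,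
    Algebra.TensorProduct.lift_tmul, AlgHom.id_apply, AlgHom.comp_apply, hθ']
  rw [Finset.sum_eq_single j]
  · rw [Matrix.diagonal_apply_eq, Algebra.ofId_apply, ← Algebra.commutes, ← Algebra.smul_def,
      smul_smul, mul_inv_cancel₀ (ha j), one_smul]
  · intro b _ hb
    simp [Matrix.diagonal_apply_ne' _ hb]
  · simp

/-- A matrix `y` that satisfies the relations is the image of the quadratic elements under the
twisted counit followed by the homomorphism that `upperRight y` defines. -/
theorem presentedBy_diagBlocks (hT : IsGenericFRT lt q c T) {a : I → K} (ha : ∀ i, a i ≠ 0)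
    (R : Set (FreeAlgebra K ((I ⊕ I) × (I ⊕ I))))
    (hR : ∀ (C : Type u) [Ring C] [Algebra K C] (y : Matrix (I ⊕ I) (I ⊕ I) C),
      (∀ s ∈ R, FreeAlgebra.lift K (fun p : (I ⊕ I) × (I ⊕ I) => y p.1 p.2) s = 0) ↔
      IsBlockSymm y ∧ IsFRT lt q c (upperRight y)) :
    PresentedBy (quadMat (diagBlocks K T) (antidiagBlocks a)) R := by
  set x := quadMat (diagBlocks K T) (antidiagBlocks a) with hx
  have hxb : IsBlockSymm x := isBlockSymm_quadMat_diagBlocks a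
  refine presentedBy_of _ _ ((hR _ x).mpr ⟨hxb, isFRT_upperRight_quadMat_diagBlocks hT.isFRT a⟩)
    fun C _ _ g _ hgR _ w hw => ?_
  set y : Matrix (I ⊕ I) (I ⊕ I) C := Matrix.of fun i j => g (FreeAlgebra.ι K (i, j)) with hy
  have hgy : FreeAlgebra.lift K (fun p : (I ⊕ I) × (I ⊕ I) => y p.1 p.2) = g := by
    ext p
    simp [hy]
  obtain ⟨hyb, hyF⟩ := (hR C y).mp fun s hs => by rw [hgy]; exact hgR s hs
  obtain ⟨f, hf⟩ := hT.lift C _ hyF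
  obtain ⟨η, hη⟩ := exists_counit hT ha
  have h1 : ∀ i j, f (η (x (Sum.inl i) (Sum.inr j))) = y (Sum.inl i) (Sum.inr j) := fun i j =>
    (congrArg f (hη i j)).trans (congrFun (congrFun hf i) j)
  have h2 : (f.comp η).comp (FreeAlgebra.lift K fun p : (I ⊕ I) × (I ⊕ I) => x p.1 p.2) = g := by
    rw [← hgy]
    ext ⟨i | i, j | j⟩
    · simp [hxb.inl, hyb.inl]
    · simp [h1]
    · simp [hxb.symm, hyb.symm, h1]
    · simp [hxb.inr, hyb.inr]
  rw [← h2, AlgHom.comp_apply, hw, map_zero]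

theorem exists_algEquiv_diagBlocks (hT : IsGenericFRT lt q c T) {a : I → K} (ha : ∀ i, a i ≠ 0) :
    ∃ e : genAlg K (quadMat (diagBlocks K T) (antidiagBlocks a)) ≃ₐ[K] B, ∀ i j,
      e (gen K (quadMat (diagBlocks K T) (antidiagBlocks a)) (Sum.inl i) (Sum.inr j)) = T i j := by
  set x := quadMat (diagBlocks K T) (antidiagBlocks a) with hx
  have hxb : IsBlockSymm x := isBlockSymm_quadMat_diagBlocks a
  obtain ⟨f, hf⟩ := hT.lift _ _ (isFRT_upperRight_quadMat_diagBlocks hT.isFRT a)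
  obtain ⟨η, hη⟩ := exists_counit hT ha
  have hη' : ∀ i j, η (x (Sum.inl i) (Sum.inr j)) = T i j := hη
  have h1 : ∀ i j, f (η (x (Sum.inl i) (Sum.inr j))) = x (Sum.inl i) (Sum.inr j) := fun i j =>
    (congrArg f (hη i j)).trans (congrFun (congrFun hf i) j)
  have hle : genAlg K x ≤ AlgHom.equalizer (f.comp η) (AlgHom.id K _) := by
    refine Algebra.adjoin_le ?_
    rintro _ ⟨i | i, j | j, rfl⟩
    · simp [hxb.inl]
    · simp [h1]
    · simp [hxb.symm, h1]
    · simp [hxb.inr]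
  refine ⟨AlgEquiv.ofBijective (η.comp (genAlg K x).val) ⟨fun u v huv => ?_, ?_⟩, fun i j => ?_⟩
  · have hu : f (η u.1) = u.1 := hle u.2
    have hv : f (η v.1) = v.1 := hle v.2
    refine Subtype.ext ?_
    rw [← hu, ← hv]
    exact congrArg f huv
  · rw [← AlgHom.range_eq_top, eq_top_iff, ← hT.adjoin]
    refine Algebra.adjoin_le ?_
    rintro _ ⟨i, j, rfl⟩
    exact ⟨gen K x (Sum.inl i) (Sum.inr j), hη' i j⟩
  · exact hη' i j

end DiagonalType

/-! ### Relations as conditions on matrices -/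

section RMatrices

variable {K : Type*} [Field K]

theorem rMat_eq_rGen (q : K) (I : Type*) [LinearOrder I] :
    rMat q I = rGen (· < ·) q (q - q⁻¹) := by
  ext ⟨i, j⟩ ⟨m, l⟩
  rw [rGen_apply]
  simp only [rMat, Matrix.of_apply, Prod.mk.injEq, diagWt, stepWt]
  by_cases h1 : i = m ∧ j = l
  · obtain ⟨rfl, rfl⟩ := h1
    by_cases h2 : i = j <;> simp [h2]
  · by_cases h2 : i = l ∧ j = m
    · obtain ⟨rfl, rfl⟩ := h2
      have h3 : i ≠ j := fun h => h1 ⟨h, h.symm⟩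
      simp [h3]
    · rw [if_neg h1, if_neg (by rintro ⟨⟨rfl, rfl⟩, -⟩; exact h2 ⟨rfl, rfl⟩)]
      simp only [← ite_and, if_neg h1, zero_add]
      exact (if_neg fun h => h2 ⟨h.1, h.2.1⟩).symm

theorem rMatDiag_eq_rGen (q : K) (n : ℕ) :
    rMatDiag q n = rGen (Sum.LiftRel (· < ·) (· < ·)) q (q - q⁻¹) := by
  ext ⟨i, j⟩ ⟨m, l⟩
  rw [rGen_apply]
  rcases i with i | i <;> rcases j with j | j <;> rcases m with m | m <;> rcases l with l | l <;>
    simp [rMatDiag, rMat_eq_rGen, rGen_apply, diagWt_inl, diagWt_inr, diagWt_inl_inr,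
      diagWt_inr_inl, stepWt_inl, stepWt_inr, stepWt_inl_inr, stepWt_inr_inl, ite_and]

end RMatrices

section Opposite

variable {k : Type*} [CommRing k] {I : Type*} [DecidableEq I] {lt : I → I → Prop} [DecidableRel lt]
  {q c : k} {A : Type*} [Ring A] [Algebra k A]

theorem IsFRT.op {T : Matrix I I A} (h : IsFRT lt q c T) :
    IsFRT (fun a b => lt b a) q c (T.map MulOpposite.op) := by
  intro i j m l
  have := congrArg MulOpposite.op (h j i l m)
  rw [diagWt_comm j i, diagWt_comm l m] at this
  exact this

/-- The entries of `R Y₂ Y₁ - Y₁ Y₂ R`: the FRT relations for the reversed order. -/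
theorem isFRT_reverse_iff (T : Matrix I I A) : IsFRT (fun a b => lt b a) q c T ↔ ∀ i j m l,
    diagWt q i j • (T j l * T i m) + stepWt lt c j i • (T i l * T j m) =
      diagWt q m l • (T i m * T j l) + stepWt lt c m l • (T i l * T j m) := by
  refine ⟨fun h i j m l => ?_, fun h i j m l => ?_⟩
  · have := h j i l m
    rw [diagWt_comm j i, diagWt_comm l m] at this
    exact this
  · have := h j i l m
    rw [diagWt_comm j i, diagWt_comm l m] at this
    exact this

universe u

theorem IsGenericFRT.op {K I B : Type u} [Field K] [DecidableEq I] [Ring B] [Algebra K B]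
    {lt : I → I → Prop} [DecidableRel lt] {q c : K} {T : Matrix I I B}
    (h : IsGenericFRT lt q c T) :
    IsGenericFRT (fun a b => lt b a) q c (T.map MulOpposite.op) where
  isFRT := h.isFRT.op
  lift C _ _ U hU := by
    obtain ⟨f, hf⟩ := h.lift Cᵐᵒᵖ (U.map MulOpposite.op) hU.op
    refine ⟨AlgHom.opComm f, ?_⟩
    ext i j
    exact congrArg MulOpposite.unop (congrFun (congrFun hf i) j)
  adjoin := by
    have h1 := congrArg Subalgebra.op h.adjoin
    rw [Subalgebra.op_adjoin, Subalgebra.op_top] at h1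
    rw [← h1]
    congr 1
    ext x
    constructor
    · rintro ⟨i, j, rfl⟩
      exact ⟨i, j, rfl⟩
    · rintro ⟨i, j, hx⟩
      exact ⟨i, j, congrArg MulOpposite.op hx⟩

end Opposite

section FreeRelations

variable {K : Type*} [Field K] {I : Type*} {A : Type*} [Ring A] [Algebra K A]

theorem freeMat_map_lift (y : Matrix I I A) :
    (freeMat K I).map (FreeAlgebra.lift K fun p : I × I => y p.1 p.2) = y := by
  ext i j
  simp [freeMat]

theorem lift_freeMat (y : Matrix I I A) (i j : I) :
    FreeAlgebra.lift K (fun p : I × I => y p.1 p.2) (freeMat K I i j) = y i j := by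
  simp [freeMat]

theorem lift_entrySet_iff (y : Matrix I I A) {J J' : Type*}
    (M : Matrix (J × J) (J' × J') (FreeAlgebra K (I × I))) :
    (∀ s ∈ entrySet M, FreeAlgebra.lift K (fun p : I × I => y p.1 p.2) s = 0) ↔
      ∀ i j m l, FreeAlgebra.lift K (fun p : I × I => y p.1 p.2) (M (i, j) (m, l)) = 0 := by
  constructor
  · exact fun h i j m l => h _ ⟨_, _, rfl⟩
  · rintro h _ ⟨⟨i, j⟩, ⟨m, l⟩, rfl⟩
    exact h i j m l

variable [Fintype I] [DecidableEq I] {lt : I → I → Prop} [DecidableRel lt] {q c : K}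

theorem lift_relReflX_iff (y : Matrix I I A) :
    (∀ s ∈ relReflX (rGen lt q c), FreeAlgebra.lift K (fun p : I × I => y p.1 p.2) s = 0) ↔
      ∀ i j m l, reflElt lt q c y i j m l = 0 := by
  rw [relReflX, lift_entrySet_iff]
  simp only [reflX_apply, map_reflElt, freeMat_map_lift]

theorem lift_relReflD_iff (y : Matrix I I A) :
    (∀ s ∈ relReflD (rGen lt q c), FreeAlgebra.lift K (fun p : I × I => y p.1 p.2) s = 0) ↔
      ∀ i j m l, reflElt (fun a b => lt b a) q c y i j m l = 0 := by
  rw [relReflD, lift_entrySet_iff]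
  simp only [reflD_apply, map_reflElt, freeMat_map_lift]
  exact ⟨fun h i j m l => h j i l m, fun h i j m l => h j i l m⟩

end FreeRelations

section Instances

theorem isGenericFRT_tMat {K I : Type} [Field K] [Fintype I] [LinearOrder I] (q : K) :
    IsGenericFRT (fun a b : I => a < b) q (q - q⁻¹) (tMat q I) := by
  have hmap : ∀ {C : Type} [Ring C] [Algebra K C] (f : FreeAlgebra K (I × I) →ₐ[K] C)
      (i j m l : I),
      (f ((scal (FreeAlgebra K (I × I)) (rMat q I) * leg₁ (freeMat K I) * leg₂ (freeMat K I) :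
        Matrix (I × I) (I × I) (FreeAlgebra K (I × I))) (i, j) (m, l)) =
      f ((leg₂ (freeMat K I) * leg₁ (freeMat K I) * scal (FreeAlgebra K (I × I)) (rMat q I) :
        Matrix (I × I) (I × I) (FreeAlgebra K (I × I))) (i, j) (m, l))) ↔
      (diagWt q i j • (f (freeMat K I i m) * f (freeMat K I j l)) +
        stepWt (· < ·) (q - q⁻¹) j i • (f (freeMat K I j m) * f (freeMat K I i l)) =
      diagWt q m l • (f (freeMat K I j l) * f (freeMat K I i m)) +
        stepWt (· < ·) (q - q⁻¹) m l • (f (freeMat K I j m) * f (freeMat K I i l))) := by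
    intro C _ _ f i j m l
    rw [rMat_eq_rGen, frtLeft_apply, frtRight_apply]
    simp only [map_add, map_smul, map_mul]
  refine ⟨fun i j m l => ?_, fun C _ _ U hU => ?_, ?_⟩
  · exact (hmap (RingQuot.mkAlgHom K (frtRel q I)) i j m l).mp
      (RingQuot.mkAlgHom_rel K ⟨(i, j), (m, l), rfl, rfl⟩)
  · refine ⟨RingQuot.liftAlgHom K ⟨FreeAlgebra.lift K fun p : I × I => U p.1 p.2, ?_⟩, ?_⟩
    · rintro _ _ ⟨⟨i, j⟩, ⟨m, l⟩, rfl, rfl⟩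
      refine (hmap _ i j m l).mpr ?_
      simp only [lift_freeMat]
      exact hU i j m l
    · ext i j
      simp [tMat]
  · have h1 := congrArg (Subalgebra.map (RingQuot.mkAlgHom K (frtRel q I)))
      (FreeAlgebra.adjoin_range_ι K (I × I))
    rw [AlgHom.map_adjoin, Algebra.map_top,
      (AlgHom.range_eq_top _).mpr (RingQuot.mkAlgHom_surjective K _)] at h1
    rw [← h1]
    congr 1
    ext x
    constructor
    · rintro ⟨i, j, rfl⟩
      exact ⟨_, ⟨(i, j), rfl⟩, rfl⟩
    · rintro ⟨_, ⟨⟨i, j⟩, rfl⟩, rfl⟩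
      exact ⟨i, j, rfl⟩

theorem isGenericFRT_pMat {K I : Type} [Field K] [Fintype I] [LinearOrder I] (q : K) :
    IsGenericFRT (fun a b : I => b < a) q (q - q⁻¹) (pMat q I) :=
  (isGenericFRT_tMat q).op

variable {K : Type*} [Field K] {A : Type*} [Ring A] [Algebra K A] {n : ℕ}

theorem lift_relSym_iff (c : K) (y : Matrix (Fin n) (Fin n) A) :
    (∀ s ∈ relSym c n, FreeAlgebra.lift K (fun p : Fin n × Fin n => y p.1 p.2) s = 0) ↔
      ∀ i j, i < j → y i j = c • y j i := by
  constructor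
  · intro h i j hij
    simpa [lift_freeMat, sub_eq_zero] using h _ ⟨i, j, hij, rfl⟩
  · rintro h _ ⟨i, j, hij, rfl⟩
    simp [lift_freeMat, h i j hij]

theorem lift_relSkew_iff (c : K) (y : Matrix (Fin n) (Fin n) A) :
    (∀ s ∈ relSkew c n, FreeAlgebra.lift K (fun p : Fin n × Fin n => y p.1 p.2) s = 0) ↔
      (∀ i j, i < j → y i j = -(c • y j i)) ∧ ∀ i, y i i = 0 := by
  constructor
  · refine fun h => ⟨fun i j hij => ?_, fun i => ?_⟩
    · simpa [lift_freeMat, eq_neg_iff_add_eq_zero] using h _ (Or.inl ⟨i, j, hij, rfl⟩)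
    · simpa [lift_freeMat] using h _ (Or.inr ⟨i, rfl⟩)
  · rintro ⟨h1, h2⟩ _ (⟨i, j, hij, rfl⟩ | ⟨i, rfl⟩)
    · simp [lift_freeMat, h1 i j hij]
    · simp [lift_freeMat, h2]

theorem lift_relBlock_iff (y : Matrix (Fin n ⊕ Fin n) (Fin n ⊕ Fin n) A) :
    (∀ s ∈ relBlock K n, FreeAlgebra.lift K
      (fun p : (Fin n ⊕ Fin n) × (Fin n ⊕ Fin n) => y p.1 p.2) s = 0) ↔ IsBlockSymm y := by
  constructor
  · refine fun h => ⟨fun i j => ?_, fun i j => ?_, fun i j => ?_⟩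
    · refine Eq.symm ?_
      simpa [lift_freeMat, sub_eq_zero] using h _ ⟨i, j, Or.inl rfl⟩
    · simpa [lift_freeMat] using h _ ⟨i, j, Or.inr (Or.inl rfl)⟩
    · simpa [lift_freeMat] using h _ ⟨i, j, Or.inr (Or.inr rfl)⟩
  · rintro h _ ⟨i, j, rfl | rfl | rfl⟩
    · simp [lift_freeMat, h.symm]
    · simp [lift_freeMat, h.inl]
    · simp [lift_freeMat, h.inr]

theorem lift_hatMat (y : Matrix (Fin n ⊕ Fin n) (Fin n ⊕ Fin n) A) (i j : Fin n) :
    FreeAlgebra.lift K (fun p : (Fin n ⊕ Fin n) × (Fin n ⊕ Fin n) => y p.1 p.2) (hatMat K n i j) =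
      upperRight y i j :=
  lift_freeMat y _ _

theorem lift_relHatX_iff (q : K) (y : Matrix (Fin n ⊕ Fin n) (Fin n ⊕ Fin n) A) :
    (∀ s ∈ relHatX q n, FreeAlgebra.lift K
      (fun p : (Fin n ⊕ Fin n) × (Fin n ⊕ Fin n) => y p.1 p.2) s = 0) ↔
      IsFRT (· < ·) q (q - q⁻¹) (upperRight y) := by
  rw [relHatX, lift_entrySet_iff, rMat_eq_rGen]
  simp only [Matrix.sub_apply, frtLeft_apply, frtRight_apply, map_sub, map_add, map_smul, map_mul,
    lift_hatMat, sub_eq_zero]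
  rfl

theorem lift_relHatD_iff (q : K) (y : Matrix (Fin n ⊕ Fin n) (Fin n ⊕ Fin n) A) :
    (∀ s ∈ relHatD q n, FreeAlgebra.lift K
      (fun p : (Fin n ⊕ Fin n) × (Fin n ⊕ Fin n) => y p.1 p.2) s = 0) ↔
      IsFRT (fun a b => b < a) q (q - q⁻¹) (upperRight y) := by
  rw [relHatD, lift_entrySet_iff, rMat_eq_rGen, isFRT_reverse_iff (lt := (· < ·))]
  simp only [Matrix.sub_apply, frtLeft'_apply, frtRight'_apply, map_sub, map_add, map_smul,
    map_mul, lift_hatMat, sub_eq_zero]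

theorem reflElt_liftRel_reverse (q c : K) (y : Matrix (Fin n ⊕ Fin n) (Fin n ⊕ Fin n) A)
    (i j m l : Fin n ⊕ Fin n) :
    reflElt (fun a b => Sum.LiftRel (· < ·) (· < ·) b a) q c y i j m l =
      reflElt (Sum.LiftRel (fun a b : Fin n => b < a) fun a b => b < a) q c y i j m l := by
  have h : ∀ a b : Fin n ⊕ Fin n, Sum.LiftRel (· < ·) (· < ·) b a ↔
      Sum.LiftRel (fun a b : Fin n => b < a) (fun a b => b < a) a b := by
    rintro (a | a) (b | b) <;> simp
  simp only [reflElt, reflHalf, reflHalf', stepWt, h]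

end Instances

/-! ### Linear relations, symplectic forms and the degeneration -/

section LinearRelations

variable {K : Type*} [Field K] {I : Type*} [DecidableEq I] {lt : I → I → Prop}
  [DecidableRel lt] [IsStrictTotalOrder I lt] {q c : K} {B : Type*} [Ring B] [Algebra K B]
  {T : Matrix I I B}

theorem IsFRT.quadMat_diagonal [Fintype I] (h : IsFRT lt q c T) (a : I → K) {i j : I}
    (hij : lt i j) :
    quadMat T (Matrix.diagonal a) i j = q • quadMat T (Matrix.diagonal a) j i := by
  have hterm : ∀ i j, quadMat T (Matrix.diagonal a) i j = ∑ k, a k • (T i k * T j k) := by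
    intro i j
    rw [quadMat, Matrix.mul_apply]
    refine Finset.sum_congr rfl fun k _ => ?_
    rw [scal, Matrix.diagonal_map (map_zero _), Matrix.mul_diagonal, Matrix.transpose_apply,
      ← Algebra.commutes, ← Algebra.smul_def, smul_mul_assoc]
  rw [hterm, hterm, Finset.smul_sum]
  refine Finset.sum_congr rfl fun k _ => ?_
  have hne : i ≠ j := fun e => irrefl (r := lt) i (by rw [← e] at hij; exact hij)
  have h1 := h i j k k
  simp only [diagWt, stepWt, if_neg hne, if_neg (asymm hij), if_neg (irrefl (r := lt) k), if_true,
    one_smul, zero_smul, add_zero] at h1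
  rw [h1, smul_comm]

/-- Exchanging the rows multiplies a `2 × 2` quantum minor with columns `f`, `s` by `-q⁻¹`, and the
minor with equal rows vanishes. -/
theorem IsFRT.columns (h : IsFRT lt q c T) (hq : q * (q - c) = 1) {f s : I} (hfs : lt f s) :
    (∀ i j, lt i j → T i f * T j s - q • (T i s * T j f) =
      -((q - c) • (T j f * T i s - q • (T j s * T i f)))) ∧
    ∀ i, T i f * T i s - q • (T i s * T i f) = 0 := by
  have hne : ∀ {i j}, lt i j → i ≠ j := fun {i j} hij e =>
    irrefl (r := lt) i (by rw [← e] at hij; exact hij)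
  refine ⟨fun i j hij => ?_, fun i => ?_⟩
  · have h1 := h i j f s
    have h2 := h i j s f
    simp only [diagWt, stepWt, if_neg (hne hij), if_neg (hne hfs), if_neg (hne hfs).symm,
      if_neg (asymm hij), if_neg (asymm hfs), if_pos hfs, one_smul, zero_smul, add_zero] at h1 h2
    rw [h1, h2]
    have h3 : (q - c) • q • (T j s * T i f) = T j s * T i f := by
      rw [smul_smul, mul_comm, hq, one_smul]
    rw [smul_sub, h3, sub_smul]
    abel
  · have h1 := h i i f s
    simp only [diagWt, stepWt, if_true, if_neg (hne hfs), if_neg (irrefl (r := lt) i), if_pos hfs,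
      one_smul, zero_smul, add_zero] at h1
    have h2 : T i s * T i f = (q - c) • (T i f * T i s) := by
      rw [sub_smul, h1]; abel
    rw [h2, smul_smul, hq, one_smul, sub_self]

end LinearRelations

section Symplectic

/-- The `q`-symplectic form `∑ a_k (e_{2k-1,2k} - q e_{2k,2k-1})` over a commutative ring; over a
field it is `jAII q a` by definition. -/
def sympMat {k : Type*} [CommRing k] (q : k) {n : ℕ} (a : Fin n → k) :
    Matrix (Fin (2 * n)) (Fin (2 * n)) k :=
  ∑ k, a k • (Matrix.single (oddIdx k) (evenIdx k) 1 - q • Matrix.single (evenIdx k) (oddIdx k) 1)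

variable {n : ℕ}

/-- The involution exchanging `2k - 1` and `2k`. -/
def swapIdx (i : Fin (2 * n)) : Fin (2 * n) :=
  ⟨if i.1 % 2 = 0 then i.1 + 1 else i.1 - 1, by have := i.2; split_ifs <;> omega⟩

theorem swapIdx_oddIdx (k : Fin n) : swapIdx (oddIdx k) = evenIdx k := by
  ext; simp [swapIdx, oddIdx, evenIdx]

theorem swapIdx_evenIdx (k : Fin n) : swapIdx (evenIdx k) = oddIdx k := by
  ext; simp [swapIdx, oddIdx, evenIdx]

theorem swapIdx_swapIdx (i : Fin (2 * n)) : swapIdx (swapIdx i) = i := by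
  ext; simp only [swapIdx]; split_ifs <;> omega

theorem swapIdx_ne (i : Fin (2 * n)) : swapIdx i ≠ i := by
  rw [Ne, Fin.ext_iff]; simp only [swapIdx]; split_ifs <;> omega

theorem swapIdx_lt_iff (i j : Fin (2 * n)) (h1 : j ≠ i) (h2 : j ≠ swapIdx i) :
    i < j ↔ swapIdx i < j := by
  rw [Ne, Fin.ext_iff] at h1 h2
  rw [Fin.lt_def, Fin.lt_def]
  simp only [swapIdx] at h2 ⊢
  split_ifs at h2 ⊢ <;> omega

theorem lt_swapIdx_iff (i j : Fin (2 * n)) (h1 : j ≠ i) (h2 : j ≠ swapIdx i) :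
    j < i ↔ j < swapIdx i := by
  rw [Ne, Fin.ext_iff] at h1 h2
  rw [Fin.lt_def, Fin.lt_def]
  simp only [swapIdx] at h2 ⊢
  split_ifs at h2 ⊢ <;> omega

theorem oddIdx_or_evenIdx (i : Fin (2 * n)) : (∃ k, i = oddIdx k) ∨ ∃ k, i = evenIdx k := by
  have := i.2
  rcases Nat.mod_two_eq_zero_or_one i.1 with h | h
  · exact Or.inl ⟨⟨i.1 / 2, by omega⟩, by ext; simp only [oddIdx]; omega⟩
  · exact Or.inr ⟨⟨i.1 / 2, by omega⟩, by ext; simp only [evenIdx]; omega⟩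

theorem oddIdx_lt_evenIdx (k : Fin n) : oddIdx k < evenIdx k := by
  simp [Fin.lt_def, oddIdx, evenIdx]

theorem oddIdx_inj {k l : Fin n} : oddIdx k = oddIdx l ↔ k = l := by
  simp [oddIdx, Fin.ext_iff]

theorem evenIdx_inj {k l : Fin n} : evenIdx k = evenIdx l ↔ k = l := by
  simp [evenIdx, Fin.ext_iff]

theorem oddIdx_ne_evenIdx (k l : Fin n) : oddIdx k ≠ evenIdx l := by
  rw [Ne, Fin.ext_iff]; simp only [oddIdx, evenIdx]; omega

variable {k : Type*} [CommRing k] (q : k) (a : Fin n → k)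

theorem sympMat_odd_odd (r s : Fin n) : sympMat q a (oddIdx r) (oddIdx s) = 0 := by
  simp [sympMat, Matrix.sum_apply, (oddIdx_ne_evenIdx _ _).symm]

theorem sympMat_even_even (r s : Fin n) : sympMat q a (evenIdx r) (evenIdx s) = 0 := by
  simp [sympMat, Matrix.sum_apply, oddIdx_ne_evenIdx]

theorem sympMat_odd_even (r s : Fin n) :
    sympMat q a (oddIdx r) (evenIdx s) = if r = s then a r else 0 := by
  simp [sympMat, Matrix.sum_apply, Matrix.single_apply, oddIdx_ne_evenIdx, oddIdx_inj, evenIdx_inj,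
    (oddIdx_ne_evenIdx _ _).symm, ite_and]

theorem sympMat_even_odd (r s : Fin n) :
    sympMat q a (evenIdx r) (oddIdx s) = if r = s then -q * a r else 0 := by
  simp [sympMat, Matrix.sum_apply, Matrix.single_apply, oddIdx_ne_evenIdx, oddIdx_inj, evenIdx_inj,
    (oddIdx_ne_evenIdx _ _).symm, ite_and, mul_comm (a r)]
  split_ifs <;> simp

theorem sympMat_eq_zero (i j : Fin (2 * n)) (h : j ≠ swapIdx i) : sympMat q a i j = 0 := by
  rcases oddIdx_or_evenIdx i with ⟨r, rfl⟩ | ⟨r, rfl⟩ <;>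
    rcases oddIdx_or_evenIdx j with ⟨s, rfl⟩ | ⟨s, rfl⟩
  · exact sympMat_odd_odd q a r s
  · rw [swapIdx_oddIdx, Ne, evenIdx_inj] at h
    rw [sympMat_odd_even, if_neg (Ne.symm h)]
  · rw [swapIdx_evenIdx, Ne, oddIdx_inj] at h
    rw [sympMat_even_odd, if_neg (Ne.symm h)]
  · exact sympMat_even_even q a r s

theorem map_sympMat {k' : Type*} [CommRing k'] (f : k →+* k') :
    (sympMat q a).map f = sympMat (f q) fun r => f (a r) := by
  ext1 i j
  rw [Matrix.map_apply]
  rcases oddIdx_or_evenIdx i with ⟨r, rfl⟩ | ⟨r, rfl⟩ <;>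
    rcases oddIdx_or_evenIdx j with ⟨s, rfl⟩ | ⟨s, rfl⟩ <;>
    simp only [sympMat_odd_odd, sympMat_odd_even, sympMat_even_odd, sympMat_even_even, apply_ite f,
      map_zero, map_mul, map_neg]

theorem sympMat_one_transpose : (sympMat 1 a).transpose = -sympMat 1 a := by
  ext1 i j
  rw [Matrix.transpose_apply, Matrix.neg_apply]
  rcases oddIdx_or_evenIdx i with ⟨r, rfl⟩ | ⟨r, rfl⟩ <;>
    rcases oddIdx_or_evenIdx j with ⟨s, rfl⟩ | ⟨s, rfl⟩ <;>
    simp only [sympMat_odd_odd, sympMat_odd_even, sympMat_even_odd, sympMat_even_even, neg_zero]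
  · by_cases h : r = s <;> simp [h, eq_comm]
  · by_cases h : r = s <;> simp [h, eq_comm]

theorem sympMat_mul_neg : sympMat (1 : k) (fun _ : Fin n => 1) * -sympMat 1 (fun _ => 1) = 1 := by
  have hsum : ∀ g : Fin (2 * n) → k, ∀ i, (∀ j, j ≠ swapIdx i → g j = 0) →
      ∑ j, g j = g (swapIdx i) := fun g i hg =>
    Finset.sum_eq_single _ (fun j _ hj => hg j hj) fun h => absurd (Finset.mem_univ _) h
  ext i j
  rw [Matrix.mul_apply, hsum _ i fun m hm => by rw [sympMat_eq_zero _ _ _ _ hm, zero_mul]]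
  by_cases hij : i = j
  · subst hij
    rw [Matrix.one_apply_eq]
    rcases oddIdx_or_evenIdx i with ⟨r, rfl⟩ | ⟨r, rfl⟩
    · simp [swapIdx_oddIdx, sympMat_odd_even, sympMat_even_odd]
    · simp [swapIdx_evenIdx, sympMat_odd_even, sympMat_even_odd]
  · rw [Matrix.one_apply_ne hij, Matrix.neg_apply,
      sympMat_eq_zero _ _ (swapIdx i) j (by rw [swapIdx_swapIdx]; exact Ne.symm hij), neg_zero,
      mul_zero]

theorem reflElt_sympMat {c : k} (hq : q * (q - c) = 1) (i j m l : Fin (2 * n)) :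
    reflElt (fun a b => a < b) q c (sympMat q a) i j m l = 0 := by
  refine reflElt_symplectic hq _ swapIdx swapIdx_swapIdx swapIdx_ne swapIdx_lt_iff
    (sympMat_eq_zero q a) (fun i hi => ?_) i j m l
  rcases oddIdx_or_evenIdx i with ⟨r, rfl⟩ | ⟨r, rfl⟩
  · rw [swapIdx_oddIdx, sympMat_even_odd, sympMat_odd_even, if_pos rfl, if_pos rfl]
  · rw [swapIdx_evenIdx] at hi
    exact absurd hi (oddIdx_lt_evenIdx r).asymm

theorem reflElt_sympMat_transpose {c : k} (hq : q * (q - c) = 1) (i j m l : Fin (2 * n)) :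
    reflElt (fun a b => b < a) q c (sympMat q a).transpose i j m l = 0 := by
  refine reflElt_symplectic hq _ swapIdx swapIdx_swapIdx swapIdx_ne lt_swapIdx_iff
    (fun i j h => sympMat_eq_zero q a _ _ fun e => h ?_) (fun i hi => ?_) i j m l
  · rw [e, swapIdx_swapIdx]
  rcases oddIdx_or_evenIdx i with ⟨r, rfl⟩ | ⟨r, rfl⟩
  · rw [swapIdx_oddIdx] at hi
    exact absurd hi (oddIdx_lt_evenIdx r).asymm
  · rw [swapIdx_evenIdx]
    rw [sympMat_even_odd, sympMat_odd_even, if_pos rfl, if_pos rfl]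

end Symplectic

section SkewRelations

variable {K : Type*} [Field K] {n : ℕ} {q c : K} {B : Type*} [Ring B] [Algebra K B]
  {T : Matrix (Fin (2 * n)) (Fin (2 * n)) B}

theorem scal_sympMat (a : Fin n → K) :
    scal B (sympMat q a) = ∑ k, a k • (Matrix.single (oddIdx k) (evenIdx k) (1 : B) -
      q • Matrix.single (evenIdx k) (oddIdx k) 1) := by
  ext i j
  simp only [scal, Matrix.map_apply, sympMat, Matrix.sum_apply, Matrix.smul_apply,
    Matrix.sub_apply, map_sum, smul_eq_mul, map_mul, map_sub, Matrix.single_apply,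
    apply_ite (algebraMap K B), map_one, map_zero, ← Algebra.smul_def]

theorem mul_single_mul_transpose_apply (i j r s : Fin (2 * n)) :
    (T * Matrix.single r s 1 * T.transpose : Matrix _ _ B) i j = T i r * T j s := by
  rw [Matrix.mul_apply, Finset.sum_eq_single s]
  · simp
  · intro b _ hb
    rw [Matrix.mul_single_apply_of_ne _ _ _ _ _ hb, zero_mul]
  · simp

theorem quadMat_sympMat_apply (a : Fin n → K) (i j : Fin (2 * n)) :
    quadMat T (sympMat q a) i j =
      ∑ k, a k • (T i (oddIdx k) * T j (evenIdx k) - q • (T i (evenIdx k) * T j (oddIdx k))) := by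
  rw [quadMat, scal_sympMat]
  simp only [Matrix.mul_sum, Matrix.sum_mul, Matrix.sum_apply, Matrix.mul_smul, Matrix.smul_mul,
    Matrix.mul_sub, Matrix.sub_mul, Matrix.smul_apply, Matrix.sub_apply,
    mul_single_mul_transpose_apply]

theorem quadMat_sympMat_transpose_apply (a : Fin n → K) (i j : Fin (2 * n)) :
    quadMat T (sympMat q a).transpose i j =
      ∑ k, a k • (T i (evenIdx k) * T j (oddIdx k) - q • (T i (oddIdx k) * T j (evenIdx k))) := by
  have ht : scal B (sympMat q a).transpose = (scal B (sympMat q a)).transpose := rfl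
  rw [quadMat, ht, scal_sympMat, Matrix.transpose_sum]
  simp only [Matrix.transpose_smul, Matrix.transpose_sub, Matrix.transpose_single,
    Matrix.mul_sum, Matrix.sum_mul, Matrix.sum_apply, Matrix.mul_smul, Matrix.smul_mul,
    Matrix.mul_sub, Matrix.sub_mul, Matrix.smul_apply, Matrix.sub_apply,
    mul_single_mul_transpose_apply]

theorem IsFRT.quadMat_sympMat (h : IsFRT (fun a b => a < b) q c T) (hq : q * (q - c) = 1)
    (a : Fin n → K) :
    (∀ i j, i < j → quadMat T (sympMat q a) i j = -((q - c) • quadMat T (sympMat q a) j i)) ∧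
      ∀ i, quadMat T (sympMat q a) i i = 0 := by
  refine ⟨fun i j hij => ?_, fun i => ?_⟩
  · rw [quadMat_sympMat_apply, quadMat_sympMat_apply, Finset.smul_sum, ← Finset.sum_neg_distrib]
    refine Finset.sum_congr rfl fun k _ => ?_
    rw [(h.columns hq (oddIdx_lt_evenIdx k)).1 i j hij, smul_neg, smul_comm]
  · rw [quadMat_sympMat_apply]
    refine Finset.sum_eq_zero fun k _ => ?_
    rw [(h.columns hq (oddIdx_lt_evenIdx k)).2 i, smul_zero]

theorem IsFRT.quadMat_sympMat_transpose (h : IsFRT (fun a b => b < a) q c T)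
    (hq : q * (q - c) = 1) (a : Fin n → K) :
    (∀ i j, j < i → quadMat T (sympMat q a).transpose i j =
      -((q - c) • quadMat T (sympMat q a).transpose j i)) ∧
      ∀ i, quadMat T (sympMat q a).transpose i i = 0 := by
  refine ⟨fun i j hij => ?_, fun i => ?_⟩
  · rw [quadMat_sympMat_transpose_apply, quadMat_sympMat_transpose_apply, Finset.smul_sum,
      ← Finset.sum_neg_distrib]
    refine Finset.sum_congr rfl fun k _ => ?_
    rw [(h.columns hq (oddIdx_lt_evenIdx k)).1 i j hij, smul_neg, smul_comm]
  · rw [quadMat_sympMat_transpose_apply]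
    refine Finset.sum_eq_zero fun k _ => ?_
    rw [(h.columns hq (oddIdx_lt_evenIdx k)).2 i, smul_zero]

end SkewRelations

section Degeneration

open Polynomial IsDedekindDomain in
/-- The local ring of `ℂ[q]` at `q = 1`, with its residue field: a valuation ring of `ℂ(q)` that
contains `q^{±1}`. -/
theorem exists_degeneration : ∃ (O : Type) (_ : CommRing O) (_ : IsDomain O) (_ : ValuationRing O)
    (_ : Algebra O Cq) (_ : IsFractionRing O Cq) (F : Type) (_ : Field F) (_ : Algebra O F)
    (q c : O), algebraMap O Cq q = qq ∧ algebraMap O Cq c = qq - qq⁻¹ ∧ q * (q - c) = 1 ∧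
      algebraMap O F q = 1 ∧ (2 : F) ≠ 0 := by
  have hX : (X - C 1 : ℂ[X]) ≠ 0 := X_sub_C_ne_zero 1
  let v : HeightOneSpectrum ℂ[X] := ⟨Ideal.span {X - C 1},
    (Ideal.span_singleton_prime hX).mpr (prime_X_sub_C 1), by simpa using hX⟩
  let O := (v.valuation Cq).valuationSubring
  have hp : ∀ p : ℂ[X], algebraMap ℂ[X] Cq p ∈ O := fun p => v.valuation_le_one p
  have hv : ∀ p : ℂ[X], p.eval 1 ≠ 0 → v.valuation Cq (algebraMap ℂ[X] Cq p) = 1 := by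
    intro p h
    refine le_antisymm (v.valuation_le_one p) (not_lt.mp fun hlt => h ?_)
    rw [v.valuation_lt_one_iff_mem, Ideal.mem_span_singleton, dvd_iff_isRoot] at hlt
    exact hlt
  have hinv : ∀ p : ℂ[X], p.eval 1 ≠ 0 → (algebraMap ℂ[X] Cq p)⁻¹ ∈ O := by
    intro p h
    rw [Valuation.mem_valuationSubring_iff, map_inv₀, hv p h, inv_one]
  have hqX : algebraMap ℂ[X] Cq X = qq := RatFunc.algebraMap_X
  have hq0 : (qq : Cq) ≠ 0 := RatFunc.X_ne_zero
  let q : O := ⟨qq, hqX ▸ hp X⟩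
  let q' : O := ⟨qq⁻¹, hqX ▸ hinv X (by simp)⟩
  refine ⟨O, inferInstance, inferInstance, inferInstance, inferInstance, inferInstance,
    IsLocalRing.ResidueField O, inferInstance, inferInstance, q, q - q', rfl, rfl, ?_, ?_, ?_⟩
  · rw [sub_sub_cancel]
    exact Subtype.ext (mul_inv_cancel₀ hq0)
  · rw [IsLocalRing.ResidueField.algebraMap_eq, ← sub_eq_zero, ← map_one (IsLocalRing.residue O),
      ← map_sub, IsLocalRing.residue_eq_zero_iff, IsLocalRing.mem_maximalIdeal, mem_nonunits_iff]
    intro hu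
    obtain ⟨u, hu⟩ := hu.exists_right_inv
    have h1 : v.valuation Cq (qq - 1) < 1 := by
      have : v.valuation Cq (algebraMap ℂ[X] Cq (X - C 1)) < 1 :=
        (v.valuation_lt_one_iff_mem _).mpr (Ideal.mem_span_singleton_self _)
      rwa [map_sub, hqX, C_1, map_one] at this
    have h2 : v.valuation Cq ((qq - 1) * u) = 1 := by
      rw [show (qq - 1) * (u : Cq) = 1 from congrArg Subtype.val hu, map_one]
    rw [map_mul] at h2
    exact (mul_lt_one_of_lt_of_le h1 u.2).ne h2
  · have h1 : (2 : O) * ⟨_, hinv 2 (by simp)⟩ = 1 := by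
      refine Subtype.ext ?_
      change (2 : Cq) * (algebraMap ℂ[X] Cq 2)⁻¹ = 1
      rw [map_ofNat]
      exact mul_inv_cancel₀ two_ne_zero
    have h2 := ((IsUnit.of_mul_eq_one _ h1).map (algebraMap O (IsLocalRing.ResidueField O))).ne_zero
    rwa [map_ofNat] at h2

end Degeneration

/-! ### The presentations -/

section Span

universe u

/-- If every homomorphism that kills `S'` kills `S`, then so does the quotient map of the ideal
generated by `S'`. -/
theorem span_le_span_of_forall {K L : Type u} [Field K] (S S' : Set (FreeAlgebra K L))
    (h : ∀ (C : Type u) [Ring C] [Algebra K C] (g : FreeAlgebra K L →ₐ[K] C),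
      (∀ s ∈ S', g s = 0) → ∀ s ∈ S, g s = 0) :
    TwoSidedIdeal.span S ≤ TwoSidedIdeal.span S' := by
  exact TwoSidedIdeal.span_le.mpr fun s hs => spanQuot_eq_zero_iff.mp (h _ (spanQuot S')
    (fun s' hs' => spanQuot_eq_zero_iff.mpr (TwoSidedIdeal.subset_span hs')) s hs)

theorem span_eq_span_of_forall_matrix {K I : Type u} [Field K] (S S' : Set (FreeAlgebra K (I × I)))
    (h : ∀ (C : Type u) [Ring C] [Algebra K C] (y : Matrix I I C),
      (∀ s ∈ S, FreeAlgebra.lift K (fun p : I × I => y p.1 p.2) s = 0) ↔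
        ∀ s ∈ S', FreeAlgebra.lift K (fun p : I × I => y p.1 p.2) s = 0) :
    TwoSidedIdeal.span S = TwoSidedIdeal.span S' := by
  have hg : ∀ (C : Type u) [Ring C] [Algebra K C] (g : FreeAlgebra K (I × I) →ₐ[K] C),
      FreeAlgebra.lift K (fun p : I × I =>
        (Matrix.of fun i j => g (FreeAlgebra.ι K (i, j))) p.1 p.2) = g := by
    intro C _ _ g
    ext p
    simp
  refine le_antisymm (span_le_span_of_forall S S' fun C _ _ g hS => ?_)
    (span_le_span_of_forall S' S fun C _ _ g hS => ?_)
  · rw [← hg C g] at hS ⊢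
    exact (h C _).mpr hS
  · rw [← hg C g] at hS ⊢
    exact (h C _).mp hS

theorem forall_mem_union_iff {α : Type*} {S S' : Set α} {P : α → Prop} :
    (∀ s ∈ S ∪ S', P s) ↔ (∀ s ∈ S, P s) ∧ ∀ s ∈ S', P s := by
  simp only [Set.mem_union, or_imp, forall_and]

end Span

section Presentations

variable {I B : Type} [Fintype I] [DecidableEq I] [Ring B] [Algebra Cq B]

/-- The presentation for a diagonal form with entries powers of `q⁻¹`, which is the unit matrix at
`q = 1`. -/
theorem presentedBy_quadMat_diagonal {lt : I → I → Prop} [DecidableRel lt]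
    [IsStrictTotalOrder I lt] {T : Matrix I I B} (hT : IsGenericFRT lt qq (qq - qq⁻¹) T)
    (e : I → ℕ) (R : Set (FreeAlgebra Cq (I × I)))
    (hR : ∀ (C : Type) [Ring C] [Algebra Cq C] (y : Matrix I I C),
      (∀ s ∈ R, FreeAlgebra.lift Cq (fun p : I × I => y p.1 p.2) s = 0) ↔
      (∀ i j, lt i j → y i j = qq • y j i) ∧
        ∀ i j m l, reflElt lt qq (qq - qq⁻¹) y i j m l = 0) :
    PresentedBy (quadMat T (Matrix.diagonal fun i => (qq ^ e i)⁻¹)) R := by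
  obtain ⟨O, _, _, _, _, _, F, _, _, q, c, hq, hc, hqc, hq1, h2⟩ := exists_degeneration
  have hT' : IsGenericFRT lt (algebraMap O Cq q) (algebraMap O Cq c) T := by rwa [hq, hc]
  have hqc' : algebraMap O Cq (q - c) = qq⁻¹ := by rw [map_sub, hq, hc, sub_sub_cancel]
  have hqc1 : algebraMap O F (q - c) = 1 := by
    have := congrArg (algebraMap O F) hqc
    rwa [map_mul, hq1, one_mul, map_one] at this
  have hJ : (Matrix.diagonal fun i => (q - c) ^ e i).map (algebraMap O Cq) =
      Matrix.diagonal fun i => (qq ^ e i)⁻¹ := by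
    rw [Matrix.diagonal_map (map_zero _)]
    congr 1
    funext i
    rw [map_pow, hqc', inv_pow]
  have hJ1 : (Matrix.diagonal fun i => (q - c) ^ e i).map (algebraMap O F) = 1 := by
    rw [Matrix.diagonal_map (map_zero _), ← Matrix.diagonal_one]
    congr 1
    funext i
    rw [map_pow, hqc1, one_pow]
  have key := presentedBy_quadMat True hT' hqc hq1 h2 (J := Matrix.diagonal fun i => (q - c) ^ e i)
    (σ := 1) (J' := 1) (one_mul 1) (fun _ => rfl) (by rw [hJ1, one_mul])
    (by rw [hJ1, Matrix.transpose_one, one_smul]) R ?_ (q - c) fun C _ _ y hy => ?_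
  · rwa [hJ] at key
  · rw [hJ]
    exact (hR _ _).mpr ⟨fun i j hij => hT.isFRT.quadMat_diagonal _ hij,
      hT.isFRT.reflElt_quadMat (reflElt_diagonal _ fun i => irrefl i)⟩
  · obtain ⟨h1, h3⟩ := (hR C y).mp hy
    refine ⟨fun i j hij => ?_, fun h => absurd trivial h, ?_⟩
    · rw [hqc', h1 i j hij, inv_smul_smul₀ RatFunc.X_ne_zero]
    · rwa [hq, hc]

variable {n : ℕ}

/-- The presentation for a form `J₀` that is skew-symmetric at `q = 1`. The form `J` over the local
ring `O` becomes `J₀` over `ℂ(q)` and `J₁` at `q = 1`; the last factor in `J₁ * -J₁ = 1` is the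
inverse of `J₁`. -/
theorem presentedBy_quadMat_of_skew {lt : I → I → Prop} [DecidableRel lt]
    [IsStrictTotalOrder I lt] {T : Matrix I I B} (hT : IsGenericFRT lt qq (qq - qq⁻¹) T)
    {O F : Type} [CommRing O] [IsDomain O] [ValuationRing O] [Algebra O Cq] [IsFractionRing O Cq]
    [Field F] [Algebra O F] {q c : O} (hq : algebraMap O Cq q = qq)
    (hc : algebraMap O Cq c = qq - qq⁻¹) (hqc : q * (q - c) = 1) (hq1 : algebraMap O F q = 1)
    (h2 : (2 : F) ≠ 0) {J : Matrix I I O} {J₀ : Matrix I I Cq} {J₁ : Matrix I I F}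
    (hJ₀ : J.map (algebraMap O Cq) = J₀) (hJ₁ : J.map (algebraMap O F) = J₁)
    (hJ₁t : J₁.transpose = -J₁) (hJ₁i : J₁ * -J₁ = 1)
    (R : Set (FreeAlgebra Cq (I × I)))
    (hR : ∀ (C : Type) [Ring C] [Algebra Cq C] (y : Matrix I I C),
      (∀ s ∈ R, FreeAlgebra.lift Cq (fun p : I × I => y p.1 p.2) s = 0) ↔
      ((∀ i j, lt i j → y i j = -(qq⁻¹ • y j i)) ∧ ∀ i, y i i = 0) ∧
        ∀ i j m l, reflElt lt qq (qq - qq⁻¹) y i j m l = 0)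
    (hskew : (∀ i j, lt i j → quadMat T J₀ i j = -(qq⁻¹ • quadMat T J₀ j i)) ∧
      ∀ i, quadMat T J₀ i i = 0)
    (hrefl : ∀ i j m l, reflElt lt qq (qq - qq⁻¹) J₀ i j m l = 0) :
    PresentedBy (quadMat T J₀) R := by
  have hT' : IsGenericFRT lt (algebraMap O Cq q) (algebraMap O Cq c) T := by rwa [hq, hc]
  subst hJ₀ hJ₁
  refine presentedBy_quadMat False hT' hqc hq1 h2 (σ := -1) (by norm_num) False.elim hJ₁i
    (by rw [hJ₁t, neg_smul, one_smul]) R ?_ (-q) fun C _ _ y hy => ?_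
  · exact (hR _ _).mpr ⟨hskew, hT.isFRT.reflElt_quadMat hrefl⟩
  · obtain ⟨⟨h1, h3⟩, h4⟩ := (hR C y).mp hy
    refine ⟨fun i j hij => ?_, fun _ => h3, ?_⟩
    · rw [map_neg, hq, h1 i j hij, smul_neg, neg_smul, neg_neg, smul_inv_smul₀ RatFunc.X_ne_zero]
    · rwa [hq, hc]

theorem presentedBy_xAII (n : ℕ) : PresentedBy (xAII qq n)
    (relSkew qq⁻¹ (2 * n) ∪ relReflX (rMat qq (Fin (2 * n)))) := by
  obtain ⟨O, _, _, _, _, _, F, _, _, q, c, hq, hc, hqc, hq1, h2⟩ := exists_degeneration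
  have hqq : (qq : Cq) * (qq - (qq - qq⁻¹)) = 1 := by
    rw [sub_sub_cancel, mul_inv_cancel₀ RatFunc.X_ne_zero]
  have hT := isGenericFRT_tMat (I := Fin (2 * n)) qq
  have h := hT.isFRT.quadMat_sympMat hqq fun _ : Fin n => (1 : Cq)
  rw [sub_sub_cancel] at h
  refine presentedBy_quadMat_of_skew hT hq hc hqc hq1 h2 (J := sympMat q fun _ => 1)
    (J₁ := sympMat 1 fun _ => 1) ?_ ?_ (sympMat_one_transpose _) sympMat_mul_neg _ ?_ h
    (reflElt_sympMat _ _ hqq)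
  · simp only [map_sympMat, hq, map_one]
    rfl
  · simp only [map_sympMat, hq1, map_one]
  · intro C _ _ y
    rw [forall_mem_union_iff, lift_relSkew_iff, rMat_eq_rGen, lift_relReflX_iff]

theorem presentedBy_dAII (n : ℕ) : PresentedBy (dAII qq n)
    (relSkew qq (2 * n) ∪ relReflD (rMat qq (Fin (2 * n)))) := by
  obtain ⟨O, _, _, _, _, _, F, _, _, q, c, hq, hc, hqc, hq1, h2⟩ := exists_degeneration
  have hqq : (qq : Cq) * (qq - (qq - qq⁻¹)) = 1 := by
    rw [sub_sub_cancel, mul_inv_cancel₀ RatFunc.X_ne_zero]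
  have hqc' : algebraMap O Cq (q - c) = qq⁻¹ := by rw [map_sub, hq, hc, sub_sub_cancel]
  have hqc1 : algebraMap O F (q - c) = 1 := by
    have := congrArg (algebraMap O F) hqc
    rwa [map_mul, hq1, one_mul, map_one] at this
  have hT := isGenericFRT_pMat (I := Fin (2 * n)) qq
  have h := hT.isFRT.quadMat_sympMat_transpose hqq
    fun k : Fin n => ((qq : Cq) ^ (4 * (k.1 + 1) - 2))⁻¹
  rw [sub_sub_cancel] at h
  refine presentedBy_quadMat_of_skew hT hq hc hqc hq1 h2
    (J := (sympMat q fun k : Fin n => (q - c) ^ (4 * (k.1 + 1) - 2)).transpose)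
    (J₁ := (sympMat 1 fun _ => 1).transpose) ?_ ?_ ?_ ?_ _ ?_ h
    (reflElt_sympMat_transpose _ _ hqq)
  · rw [Matrix.transpose_map, map_sympMat, hq]
    simp only [map_pow, hqc', inv_pow]
    rfl
  · rw [Matrix.transpose_map, map_sympMat, hq1]
    simp only [map_pow, hqc1, one_pow]
  · rw [sympMat_one_transpose, Matrix.transpose_neg, sympMat_one_transpose]
  · rw [sympMat_one_transpose, neg_neg, ← mul_eq_one_comm]
    exact sympMat_mul_neg
  · intro C _ _ y
    rw [forall_mem_union_iff, lift_relSkew_iff, rMat_eq_rGen, lift_relReflD_iff]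
    refine and_congr_left fun _ => and_congr_left fun _ =>
      ⟨fun h i j hij => ?_, fun h i j hij => ?_⟩
    · rw [h j i hij, smul_neg, neg_neg, inv_smul_smul₀ RatFunc.X_ne_zero]
    · rw [h j i hij, smul_neg, neg_neg, smul_inv_smul₀ RatFunc.X_ne_zero]

theorem presentedBy_xAI (n : ℕ) : PresentedBy (xAI qq n)
    (relSym qq n ∪ relReflX (rMat qq (Fin n))) := by
  have key := presentedBy_quadMat_diagonal (isGenericFRT_tMat (I := Fin n) qq) (fun _ => 0)
    (relSym qq n ∪ relReflX (rMat qq (Fin n))) fun C _ _ y => by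
      rw [forall_mem_union_iff, lift_relSym_iff, rMat_eq_rGen, lift_relReflX_iff]
  simp only [pow_zero, inv_one] at key
  exact key

theorem presentedBy_dAI (n : ℕ) : PresentedBy (dAI qq n)
    (relSym qq⁻¹ n ∪ relReflD (rMat qq (Fin n))) := by
  have key := presentedBy_quadMat_diagonal (isGenericFRT_pMat (I := Fin n) qq)
    (fun k => 2 * (k.1 + 1)) (relSym qq⁻¹ n ∪ relReflD (rMat qq (Fin n))) fun C _ _ y => by
      rw [forall_mem_union_iff, lift_relSym_iff, rMat_eq_rGen, lift_relReflD_iff]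
      refine and_congr_left fun _ => ⟨fun h i j hij => ?_, fun h i j hij => ?_⟩
      · rw [h j i hij, smul_inv_smul₀ RatFunc.X_ne_zero]
      · rw [h j i hij, inv_smul_smul₀ RatFunc.X_ne_zero]
  rwa [dAI, jAI, Matrix.diagonal_transpose]

end Presentations

section DiagonalPresentation

variable {K A : Type*} [Field K] [Ring A] [Algebra K A] {n : ℕ}

theorem lift_relBlock_union_relReflX_iff (q : K) (y : Matrix (Fin n ⊕ Fin n) (Fin n ⊕ Fin n) A) :
    (∀ s ∈ relBlock K n ∪ relReflX (rMatDiag q n), FreeAlgebra.lift K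
      (fun p : (Fin n ⊕ Fin n) × (Fin n ⊕ Fin n) => y p.1 p.2) s = 0) ↔
      IsBlockSymm y ∧ IsFRT (fun a b => a < b) q (q - q⁻¹) (upperRight y) := by
  rw [forall_mem_union_iff, lift_relBlock_iff, rMatDiag_eq_rGen, lift_relReflX_iff]
  exact and_congr_right fun h => h.reflElt_iff

theorem lift_relBlock_union_relReflD_iff (q : K) (y : Matrix (Fin n ⊕ Fin n) (Fin n ⊕ Fin n) A) :
    (∀ s ∈ relBlock K n ∪ relReflD (rMatDiag q n), FreeAlgebra.lift K
      (fun p : (Fin n ⊕ Fin n) × (Fin n ⊕ Fin n) => y p.1 p.2) s = 0) ↔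
      IsBlockSymm y ∧ IsFRT (fun a b => b < a) q (q - q⁻¹) (upperRight y) := by
  rw [forall_mem_union_iff, lift_relBlock_iff, rMatDiag_eq_rGen, lift_relReflD_iff]
  simp only [reflElt_liftRel_reverse]
  exact and_congr_right fun h => h.reflElt_iff

theorem span_relBlock_union_relReflX {K : Type} [Field K] (q : K) (n : ℕ) :
    TwoSidedIdeal.span (relBlock K n ∪ relReflX (rMatDiag q n)) =
      TwoSidedIdeal.span (relBlock K n ∪ relHatX q n) :=
  span_eq_span_of_forall_matrix _ _ fun C _ _ y => by
    rw [lift_relBlock_union_relReflX_iff, forall_mem_union_iff, lift_relBlock_iff,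
      lift_relHatX_iff]

theorem span_relBlock_union_relReflD {K : Type} [Field K] (q : K) (n : ℕ) :
    TwoSidedIdeal.span (relBlock K n ∪ relReflD (rMatDiag q n)) =
      TwoSidedIdeal.span (relBlock K n ∪ relHatD q n) :=
  span_eq_span_of_forall_matrix _ _ fun C _ _ y => by
    rw [lift_relBlock_union_relReflD_iff, forall_mem_union_iff, lift_relBlock_iff,
      lift_relHatD_iff]

theorem dDiag_eq {K : Type} [Field K] (q : K) (n : ℕ) :
    dDiag q n = quadMat (diagBlocks K (pMat q (Fin n)))
      (antidiagBlocks fun k : Fin n => (q ^ (2 * (k.1 + 1)))⁻¹) := by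
  rw [dDiag, jDiag, Matrix.fromBlocks_transpose, Matrix.diagonal_transpose,
    Matrix.transpose_zero]
  rfl

end DiagonalPresentation

end QuantumHomogeneous

theorem mainTheorem3 (n : ℕ) :
    -- the algebras `𝒫_θ`
    PresentedBy
      (xAI qq n)
      (relSym qq n ∪
        relReflX
          (rMat qq (Fin n))) ∧
    PresentedBy
      (xAII qq n)
      (relSkew qq⁻¹ (2 * n) ∪
        relReflX
          (rMat qq (Fin (2 * n)))) ∧
    PresentedBy
      (xDiag qq n)
      (relBlock Cq n ∪
        relReflX
          (rMatDiag qq n)) ∧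
    TwoSidedIdeal.span
      (relBlock Cq n ∪
        relReflX
          (rMatDiag qq n)) =
      TwoSidedIdeal.span
        (relBlock Cq n ∪
          relHatX qq n) ∧
    (∃ e : genAlg Cq
          (xDiag qq n)
        ≃ₐ[Cq] OqMat qq (Fin n),
      ∀ i j : Fin n,
        e (gen Cq
            (xDiag qq n) (Sum.inl i) (Sum.inr j)) =
          tMat qq (Fin n) i j) ∧
    -- the algebras `𝒟_θ`
    PresentedBy
      (dAI qq n)
      (relSym qq⁻¹ n ∪
        relReflD
          (rMat qq (Fin n))) ∧
    PresentedBy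
      (dAII qq n)
      (relSkew qq (2 * n) ∪
        relReflD
          (rMat qq (Fin (2 * n)))) ∧
    PresentedBy
      (dDiag qq n)
      (relBlock Cq n ∪
        relReflD
          (rMatDiag qq n)) ∧
    TwoSidedIdeal.span
      (relBlock Cq n ∪
        relReflD
          (rMatDiag qq n)) =
      TwoSidedIdeal.span
        (relBlock Cq n ∪
          relHatD qq n) ∧
    (∃ e : genAlg Cq
          (dDiag qq n)
        ≃ₐ[Cq] (OqMat qq (Fin n))ᵐᵒᵖ,
      ∀ i j : Fin n,
        e (gen Cq
            (dDiag qq n) (Sum.inl i) (Sum.inr j)) =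
          pMat qq (Fin n) i j) := by
  have hT := isGenericFRT_tMat (I := Fin n) (qq : Cq)
  have hP := isGenericFRT_pMat (I := Fin n) (qq : Cq)
  have h1 : ∀ _ : Fin n, (1 : Cq) ≠ 0 := fun _ => one_ne_zero
  have hd : ∀ k : Fin n, ((qq : Cq) ^ (2 * (k.1 + 1)))⁻¹ ≠ 0 := fun k =>
    inv_ne_zero (pow_ne_zero _ RatFunc.X_ne_zero)
  refine ⟨presentedBy_xAI n, presentedBy_xAII n, ?_, span_relBlock_union_relReflX qq n,
    exists_algEquiv_diagBlocks hT h1, presentedBy_dAI n, presentedBy_dAII n, ?_,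
    span_relBlock_union_relReflD qq n, ?_⟩
  · exact presentedBy_diagBlocks hT h1 _ fun C _ _ y => lift_relBlock_union_relReflX_iff qq y
  · rw [dDiag_eq]
    exact presentedBy_diagBlocks hP hd _ fun C _ _ y => lift_relBlock_union_relReflD_iff qq y
  · rw [dDiag_eq]
    exact exists_algEquiv_diagBlocks hP hd
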